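/- Fix $r\in\mathbb N$. On one probability space consider, for $k=1,2$ and every dimension $d>r$, the factor model $X^k_t=\Lambda_kF^k_t+\varepsilon^k_t$, $t\in\mathbb Z$, with a $d\times r$ loading matrix $\Lambda_k=\Lambda_{k,d}$, an $\mathbb R^r$-valued factor process $F^k$ not depending on $d$, and an $\mathbb R^d$-valued error process $\varepsilon^k=\varepsilon^{k,d}$. Write $\|\cdot\|$ for the spectral norm, $\|\cdot\|_F$ for the Frobenius norm, and $\Pi_k$ for the diagonal matrix of the eigenvalues of $\Lambda_k'\Lambda_k$ in decreasing order. Assume for each $k=1,2$, with $M<\infty$ not depending on $d$: (a) $X^k$ is (second-order) stationary with mean zero and $\operatorname{Var}(X^k_{j,t})\le M$ for all $j,t,d$. (b) The processes $F^k$ and $\varepsilon^k$ are independent. $F^k_t=\sum_{l\ge0}C_la_{t-l}$ with $\sum_l\|C_l\|<\infty$ and $(a_t)$ i.i.d. with mean zero and finite fourth moments; $E F^k_tF^{k\prime}_t$ is positive definite. For each $d$, $\varepsilon^k_t=\sum_{l\ge0}D_lb_{t-l}$ with $\sum_l\|D_l\|\le M$ and $(b_t)$ i.i.d. over $t$ with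 mean zero and $E b_{j,t}^4\le M$ for all $j\le d$. (c) There is a positive definite diagonal matrix $\widetilde\Pi_k$ with $\|\Pi_k/d-\widetilde\Pi_k\|=O(1/\sqrt d)$ as $d\to\infty$, and for every $d>r$ the eigenvalues of $\Lambda_k'\Lambda_k$ are distinct. (d) $\limsup_{d\to\infty}\sum_{h\in\mathbb Z}\|E\varepsilon^k_{t+h}\varepsilon^{k\prime}_t\|<\infty$. Assume the null hypothesis: for every $d>r$, $\Lambda_k=\Lambda\Phi_k$ $(k=1,2)$ with a $d\times r$ matrix $\Lambda$ of full column rank and nonsingular $r\times r$ matrices $\Phi_1,\Phi_2$ (all possibly depending on $d$). No assumption is made on the dependence between the two series. Write $F=F^2$ and identify the factors of the second series as follows: $E F_tF_t'=I_r$, the diagonal entries of $\widetilde\Pi_2$ are distinct, and $R=R_d$ is an orthogonal matrix with $\Lambda_2'\Lambda_2=R\,\Pi_2R'$. For a $T\times d$ data matrix $X$ and $T\ge r$, a PCA factor estimate is a $T\times r$ matrix $\widehat F=\sqrt T\,\widehat Q$, where the columns of $\widehat Q$ are orthonormal eigenvectors of $XX'$ for its $r$ largest eigenvalues in decreasing order;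 the corresponding loading estimate is $\widehat\Lambda=\frac1TX'\widehat F$. Let $X^k$ be the $T\times d$ matrix with rows $X^{k\prime}_1,\dots,X^{k\prime}_T$, let $\widehat\Lambda_k$ be its loading estimate, and put $\widehat P_k=\widehat\Lambda_k(\widehat\Lambda_k'\widehat\Lambda_k)^{-1}\widehat\Lambda_k'$. Let $Y$ be the $T\times d$ matrix with rows $Y_t'$, where $Y_t=\frac12(\widehat P_1+I_d)X^2_t$ for $1\le t\le\lfloor T/2\rfloor$ and $Y_t=\frac12(\widehat P_2+I_d)X^2_t$ for $\lfloor T/2\rfloor<t\le T$. Let $\widehat F$ (rows $\widehat F_t'$) be a PCA factor estimate from $Y$ with loading estimate $\widehat\Lambda$, the signs of the eigenvectors being chosen such that the diagonal entries of $\widehat\Lambda'\Lambda_2R$ are nonnegative. Then, for all such choices of the eigenvectors, $$\frac1T\bigl\|\widehat F-FR\bigr\|_F^2=\frac1T\sum_{t=1}^T\bigl\|\widehat F_t-R'F_t\bigr\|^2=\mathcal O_P\Bigl(\frac1d\Bigr)+\mathcal O_P\Bigl(\frac1T\Bigr)\qquad\text{as }d,T\to\infty\text{ jointly},$$ where $F$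 is the $T\times r$ matrix with rows $F_t'$. In particular, when $\Lambda_2'\Lambda_2$ is diagonal with decreasing entries one can take $R=I_r$, and the bound holds for $\frac1T\sum_{t=1}^T\|\widehat F_t-F_t\|^2$. -/

import Mathlib

open MeasureTheory ProbabilityTheory Filter

noncomputable section

namespace FactorTest

/-! ### Matrices -/

open scoped Matrix.Norms.L2Operator in
/-- The spectral norm of a real matrix (operator norm for the Euclidean norms). -/
def specNorm {m n : ℕ} (A : Matrix (Fin m) (Fin n) ℝ) : ℝ := ‖A‖

/-- The squared Frobenius norm, which is also the sum of the squared Euclidean norms of the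
rows. -/
def frobSq {m n : ℕ} (A : Matrix (Fin m) (Fin n) ℝ) : ℝ := ∑ t, ∑ j, A t j ^ 2

/-- The eigenvalues of a symmetric real matrix with multiplicity, in decreasing order. -/
def sortedEigenvalues {n : ℕ} {A : Matrix (Fin n) (Fin n) ℝ} (hA : A.IsHermitian) :
    Fin n → ℝ :=
  fun j => hA.eigenvalues₀ (Fin.cast (Fintype.card_fin n).symm j)

/-- The transpose of `A` times `A` is symmetric. -/
theorem gram_isHermitian {m n : ℕ} (A : Matrix (Fin m) (Fin n) ℝ) :
    (A.transpose * A).IsHermitian := by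
  simpa using Matrix.isHermitian_conjTranspose_mul_self A

/-- `A` times its transpose is symmetric. -/
theorem outer_isHermitian {m n : ℕ} (A : Matrix (Fin m) (Fin n) ℝ) :
    (A * A.transpose).IsHermitian := by
  simpa using Matrix.isHermitian_mul_conjTranspose_self A

/-- The eigenvalues of `Λ'Λ` in decreasing order. -/
def gramEigenvalues {d r : ℕ} (Λ : Matrix (Fin d) (Fin r) ℝ) : Fin r → ℝ :=
  sortedEigenvalues (gram_isHermitian Λ)

/-- `R` is an orthogonal matrix that diagonalises `Λ'Λ`, the eigenvalues in decreasing order. -/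
def IsGramEigenbasis {d r : ℕ} (Λ : Matrix (Fin d) (Fin r) ℝ) (R : Matrix (Fin r) (Fin r) ℝ) :
    Prop :=
  R.transpose * R = 1 ∧
    Λ.transpose * Λ = R * Matrix.diagonal (gramEigenvalues Λ) * R.transpose

/-- The columns of `Q` are orthonormal eigenvectors of the symmetric matrix `A` for its `r` largest
eigenvalues (with multiplicity, in decreasing order). -/
def IsLeadingEigenvectors {n r : ℕ} {A : Matrix (Fin n) (Fin n) ℝ} (hA : A.IsHermitian)
    (Q : Matrix (Fin n) (Fin r) ℝ) : Prop :=
  ∃ h : r ≤ n, Q.transpose * Q = 1 ∧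
    A * Q = Q * Matrix.diagonal (fun j => sortedEigenvalues hA (Fin.castLE h j))

/-! ### Principal component estimators and the transformed series -/

/-- The `T × n` matrix whose rows are the observations at the times `1, …, T`. -/
def sampleMatrix {n : ℕ} (Z : ℤ → Fin n → ℝ) (T : ℕ) : Matrix (Fin T) (Fin n) ℝ :=
  Matrix.of fun t j => Z ((t : ℕ) + 1) j

/-- `Fh` is a PCA estimate of the factors from the `T × d` data matrix `X`: it is `√T` times
orthonormal eigenvectors of `XX'` for the `r` largest eigenvalues. -/
def IsPCAFactors {T d r : ℕ} (X : Matrix (Fin T) (Fin d) ℝ) (Fh : Matrix (Fin T) (Fin r) ℝ) :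
    Prop :=
  ∃ Q : Matrix (Fin T) (Fin r) ℝ,
    IsLeadingEigenvectors (outer_isHermitian X) Q ∧ Fh = Real.sqrt (T : ℝ) • Q

/-- The PCA estimate of the loadings, `X'Fh / T`. -/
def pcaLoadings {T d r : ℕ} (X : Matrix (Fin T) (Fin d) ℝ) (Fh : Matrix (Fin T) (Fin r) ℝ) :
    Matrix (Fin d) (Fin r) ℝ :=
  (1 / (T : ℝ)) • (X.transpose * Fh)

/-- `L (L'L)⁻¹ L'`, the orthogonal projection onto the column space of `L` when `L` has full
column rank. -/
def colProj {d r : ℕ} (L : Matrix (Fin d) (Fin r) ℝ) : Matrix (Fin d) (Fin d) ℝ :=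
  L * (L.transpose * L)⁻¹ * L.transpose

/-- The transformed data: the rows of `X` at the times `1, …, T/2` are multiplied by `(P₁ + I)/2`,
the later ones by `(P₂ + I)/2` (with `T/2` rounded down when `T` is odd). -/
def transformedMatrix {T d : ℕ} (P₁ P₂ : Matrix (Fin d) (Fin d) ℝ)
    (X : Matrix (Fin T) (Fin d) ℝ) : Matrix (Fin T) (Fin d) ℝ :=
  Matrix.of fun t =>
    if (t : ℕ) < T / 2 then ((1 / 2 : ℝ) • (P₁ + 1)).mulVec (X t)
    else ((1 / 2 : ℝ) • (P₂ + 1)).mulVec (X t)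

/-! ### Stochastic notions -/

section

variable {Ω : Type*} [MeasurableSpace Ω]

/-- `f = O_P(g)` along the filter `l`. -/
def IsBigOP {ι : Type*} (P : Measure Ω) (l : Filter ι) (f : ι → Ω → ℝ) (g : ι → ℝ) : Prop :=
  ∀ δ : ℝ, 0 < δ → ∃ C : ℝ, ∀ᶠ n in l, P {ω | C * |g n| < |f n ω|} ≤ ENNReal.ofReal δ

/-- The matrix `E Z_{t+h} Z_t'`. -/
def lagCov {n : ℕ} (P : Measure Ω) (Z : ℤ → Ω → Fin n → ℝ) (t h : ℤ) :
    Matrix (Fin n) (Fin n) ℝ :=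
  Matrix.of fun i j => ∫ ω, Z (t + h) ω i * Z t ω j ∂P

/-- The autocovariance function `Γ_Z(h) = E Z_{t+h} Z_t'` of a stationary mean-zero series. -/
def autocov {n : ℕ} (P : Measure Ω) (Z : ℤ → Ω → Fin n → ℝ) (h : ℤ) :
    Matrix (Fin n) (Fin n) ℝ :=
  lagCov P Z 0 h

/-- Second-order stationarity with mean zero. -/
structure IsStationaryMeanZero {n : ℕ} (P : Measure Ω) (Z : ℤ → Ω → Fin n → ℝ) : Prop where
  memLp : ∀ t j, MemLp (fun ω => Z t ω j) 2 P
  mean_zero : ∀ t j, ∫ ω, Z t ω j ∂P = 0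
  lagCov_eq : ∀ t h, lagCov P Z t h = autocov P Z h

/-- White noise in the strong sense: independent, identically distributed, with mean zero; here
always with finite fourth moments. -/
structure IsWhiteNoise {n : ℕ} (P : Measure Ω) (a : ℤ → Ω → Fin n → ℝ) : Prop where
  measurable : ∀ t, Measurable (a t)
  indep : iIndepFun a P
  identDistrib : ∀ t, IdentDistrib (a t) (a 0) P P
  memLp_four : ∀ t j, MemLp (fun ω => a t ω j) 4 P
  mean_zero : ∀ t j, ∫ ω, a t ω j ∂P = 0

/-- `Z_t = ∑_{k ≥ 0} C_k a_{t-k}`, almost surely for every `t`. -/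
def IsLinearProcess {n : ℕ} (P : Measure Ω) (Z : ℤ → Ω → Fin n → ℝ)
    (C : ℕ → Matrix (Fin n) (Fin n) ℝ) (a : ℤ → Ω → Fin n → ℝ) : Prop :=
  ∀ t : ℤ, ∀ᵐ ω ∂P, HasSum (fun k : ℕ => (C k).mulVec (a (t - k) ω)) (Z t ω)

/-- The observed series `X_t = Λ F_t + ε_t`. -/
def factorSeries {d r : ℕ} (Λ : Matrix (Fin d) (Fin r) ℝ) (F : ℤ → Ω → Fin r → ℝ)
    (ε : ℤ → Ω → Fin d → ℝ) : ℤ → Ω → Fin d → ℝ :=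
  fun t ω => Λ.mulVec (F t ω) + ε t ω

/-- The assumptions on one factor model `X_t = Λ F_t + ε_t` with `r` factors, where the loadings
`Λ d` and the errors `ε d` are given for every cross-sectional dimension `d > r`, and the factors
`F` do not depend on `d`. The vector `π` holds the diagonal of the limit of `Π/d`, where `Π` is the
diagonal matrix of the decreasingly ordered eigenvalues of `Λ'Λ`. -/
structure FactorModel {r : ℕ} (P : Measure Ω) (Λ : (d : ℕ) → Matrix (Fin d) (Fin r) ℝ)
    (F : ℤ → Ω → Fin r → ℝ) (ε : (d : ℕ) → ℤ → Ω → Fin d → ℝ) (π : Fin r → ℝ) : Prop where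
  measurable_factor : ∀ t, Measurable (F t)
  measurable_error : ∀ d t, r < d → Measurable (ε d t)
  /-- `X` is stationary with mean zero. -/
  stationary : ∀ d, r < d → IsStationaryMeanZero P (factorSeries (Λ d) F (ε d))
  /-- The variances of the components of `X` are bounded, uniformly in `d`. -/
  variance_le : ∃ M : ℝ, ∀ d t j, r < d →
    variance (fun ω => factorSeries (Λ d) F (ε d) t ω j) P ≤ M
  /-- The factor process and the error process are independent. -/
  indep : ∀ d, r < d → IndepFun (fun ω t => F t ω) (fun ω t => ε d t ω) P
  /-- The factors are a linear process with absolutely summable coefficients. -/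
  factor_linear : ∃ (C : ℕ → Matrix (Fin r) (Fin r) ℝ) (a : ℤ → Ω → Fin r → ℝ),
    IsWhiteNoise P a ∧ Summable (fun k => specNorm (C k)) ∧ IsLinearProcess P F C a
  /-- The factors have a positive definite covariance matrix. -/
  factor_posDef : (autocov P F 0).PosDef
  /-- The errors are a linear process with absolutely summable coefficients, the sum and the fourth
  moments of the innovations being bounded uniformly in `d`. -/
  error_linear : ∃ M : ℝ, ∀ d, r < d →
    ∃ (D : ℕ → Matrix (Fin d) (Fin d) ℝ) (b : ℤ → Ω → Fin d → ℝ),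
      IsWhiteNoise P b ∧ (∀ t j, ∫ ω, b t ω j ^ 4 ∂P ≤ M) ∧
      Summable (fun k => specNorm (D k)) ∧ ∑' k, specNorm (D k) ≤ M ∧
      IsLinearProcess P (ε d) D b
  /-- The limit of `Π/d` is positive definite. -/
  limit_pos : ∀ j, 0 < π j
  /-- `‖Π/d - diag π‖ = O(1/√d)`; in particular it tends to zero. -/
  limit_rate : ∃ K : ℝ, ∀ᶠ d : ℕ in atTop,
    specNorm ((1 / (d : ℝ)) • Matrix.diagonal (gramEigenvalues (Λ d)) - Matrix.diagonal π)
      ≤ K / Real.sqrt d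
  /-- The eigenvalues of `Λ'Λ` are distinct. -/
  distinct : ∀ d, r < d → Function.Injective (gramEigenvalues (Λ d))
  /-- `limsup_d ∑_h ‖Γ_ε(h)‖ < ∞`. -/
  error_autocov : limsup
    (fun d : ℕ => ∑' h : ℤ, ENNReal.ofReal (specNorm (autocov P (ε d) h))) atTop < ⊤

end

/-- The null hypothesis: both loading matrices are nonsingular transformations of one matrix of
full column rank. -/
def NullHypothesis {d r : ℕ} (Λ₁ Λ₂ : Matrix (Fin d) (Fin r) ℝ) : Prop :=
  ∃ (Λ : Matrix (Fin d) (Fin r) ℝ) (Φ₁ Φ₂ : Matrix (Fin r) (Fin r) ℝ),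
    Λ.rank = r ∧ IsUnit Φ₁ ∧ IsUnit Φ₂ ∧ Λ₁ = Λ * Φ₁ ∧ Λ₂ = Λ * Φ₂

/-- The transformed data matrix `Y` built from the two samples `X₁`, `X₂` and the PCA estimates
`Fh₁`, `Fh₂` of their factors: the rows of `X₂` are transformed with the estimated projections
onto the column spaces of the two loading matrices. -/
def transformedSample {T d r : ℕ} (X₁ X₂ : Matrix (Fin T) (Fin d) ℝ)
    (Fh₁ Fh₂ : Matrix (Fin T) (Fin r) ℝ) : Matrix (Fin T) (Fin d) ℝ :=
  transformedMatrix (colProj (pcaLoadings X₁ Fh₁)) (colProj (pcaLoadings X₂ Fh₂)) X₂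

end FactorTest

end

noncomputable section

namespace FactorTest

section

/-! Divide the factors by √T, the loadings by √d and the errors by √(Td). Each sample becomes x = f
l' + e with f and l bounded and well conditioned. The error e is bounded in Frobenius norm but not
small. Outside an event of probability O(1/S), the quantities e l, e e', e' f and f'f - Γ (Γ the
factor covariance) are at most η = √(S(1/d + 1/T)); see `SampleBounds` and `exists_factorBounds`.
The rest is deterministic linear algebra on the good event, so neither the dependence between the
two series nor that between the estimated projections and the data plays a role.

Expanding Q V = x x' Q shows that the leading eigenvectors are Q = f K + W with W = O(η), provided
the eigenvalues V stay away from zero, which the lower half of Courant-Fischer gives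
(`FactorBounds.le_eigenvalue`, `FactorBounds.exists_decomposition`). The estimated projection fixes
the estimated loadings x'Q = l f'Q + e'Q, where e'Q = O(η), so it almost fixes l. Under the null
hypothesis l₂ = l₁ S with S bounded, so both projections almost fix l₂. Averaging them with the
identity therefore changes the signal by O(η) and contracts the noise: Y is again f₂ l₂' + E with E
l₂ and E E' of order η (`transformed_error_bounds`).

The decomposition is then applied to Y. After rotation by R, f₂'f₂ is close to I and l₂'l₂ is
diagonal with separated entries p. Hence K'K = I + O(η) and K V = diag(p) K + O(η), which forces K
to be diagonal with entries ±1 up to O(η) (`almost_diagonal`); the sign convention selects +1. So Q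
differs from f₂ R by O(η), and the square of this is the claimed rate.

The moment bounds come from expanding a linear process in its lags. For a fixed pair of lags the
centered products of innovations are uncorrelated over time, so their sum over T times has second
moment of order T; summable coefficients combine the lags by Cauchy-Schwarz (`exists_dominating`).
Because e e' and e'e have the same Frobenius norm, the decisive term is controlled by the sample
covariance of the errors: its fluctuation contributes T d² and its mean T² d, which scale to 1/T and
1/d. -/

open scoped Matrix.Norms.L2Operator in
theorem specNorm_nonneg {m n : ℕ} (A : Matrix (Fin m) (Fin n) ℝ) : 0 ≤ specNorm A :=
  norm_nonneg A

open scoped Matrix.Norms.Frobenius Matrix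

/-! ### The Frobenius norm -/

theorem frobSq_eq_norm_sq {m n : ℕ} (A : Matrix (Fin m) (Fin n) ℝ) : frobSq A = ‖A‖ ^ 2 := by
  have h : (0 : ℝ) ≤ ∑ i, ∑ j, A i j ^ 2 := by positivity
  rw [Matrix.frobenius_norm_def, frobSq, ← Real.sqrt_eq_rpow, Real.sq_sqrt]
  · simp
  · simpa using h

theorem frobSq_nonneg {m n : ℕ} (A : Matrix (Fin m) (Fin n) ℝ) : 0 ≤ frobSq A := by
  unfold frobSq; positivity

theorem norm_sq_eq_trace {m n : ℕ} (A : Matrix (Fin m) (Fin n) ℝ) :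
    ‖A‖ ^ 2 = (Aᵀ * A).trace := by
  rw [← frobSq_eq_norm_sq, frobSq, Finset.sum_comm]
  simp [Matrix.trace, Matrix.mul_apply, sq]

theorem abs_entry_le_norm {m n : ℕ} (A : Matrix (Fin m) (Fin n) ℝ) (i : Fin m) (j : Fin n) :
    |A i j| ≤ ‖A‖ := by
  refine abs_le_of_sq_le_sq ?_ (norm_nonneg _)
  rw [← frobSq_eq_norm_sq, frobSq]
  calc A i j ^ 2 ≤ ∑ j, A i j ^ 2 :=
        Finset.single_le_sum (f := fun j => A i j ^ 2) (fun _ _ => sq_nonneg _) (Finset.mem_univ j)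
    _ ≤ _ := Finset.single_le_sum (f := fun i => ∑ j, A i j ^ 2)
        (fun _ _ => Finset.sum_nonneg fun _ _ => sq_nonneg _) (Finset.mem_univ i)

/-- A matrix with entries bounded by `c` has Frobenius norm at most `c` times its number of
rows, when it is square. -/
theorem norm_le_of_abs_entry_le {n : ℕ} {A : Matrix (Fin n) (Fin n) ℝ} {c : ℝ} (hc : 0 ≤ c)
    (h : ∀ i j, |A i j| ≤ c) : ‖A‖ ≤ n * c := by
  refine abs_le_of_sq_le_sq' ?_ (by positivity) |>.2
  rw [← frobSq_eq_norm_sq, frobSq]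
  calc ∑ i, ∑ j, A i j ^ 2 ≤ ∑ _i : Fin n, ∑ _j : Fin n, c ^ 2 := by
        refine Finset.sum_le_sum fun i _ => Finset.sum_le_sum fun j _ => ?_
        exact sq_le_sq.mpr ((h i j).trans (le_abs_self c))
    _ = (n * c) ^ 2 := by simp; ring

/-- Multiplication by a matrix with orthonormal columns preserves the Frobenius norm. -/
theorem norm_mul_of_orthonormal {m n k : ℕ} {Q : Matrix (Fin m) (Fin n) ℝ} (hQ : Qᵀ * Q = 1)
    (A : Matrix (Fin n) (Fin k) ℝ) : ‖Q * A‖ = ‖A‖ := by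
  rw [← sq_eq_sq₀ (norm_nonneg _) (norm_nonneg _), norm_sq_eq_trace, norm_sq_eq_trace,
    Matrix.transpose_mul, Matrix.mul_assoc, ← Matrix.mul_assoc Qᵀ, hQ, Matrix.one_mul]

theorem norm_sq_of_orthonormal {m n : ℕ} {Q : Matrix (Fin m) (Fin n) ℝ} (hQ : Qᵀ * Q = 1) :
    ‖Q‖ ^ 2 = n := by
  rw [norm_sq_eq_trace, hQ]; simp

theorem norm_mul_of_orthogonal_right {m n : ℕ} {R : Matrix (Fin n) (Fin n) ℝ} (hR : Rᵀ * R = 1)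
    (A : Matrix (Fin m) (Fin n) ℝ) : ‖A * R‖ = ‖A‖ := by
  have hR' : (Rᵀ)ᵀ * Rᵀ = 1 := by
    rw [Matrix.transpose_transpose]; exact mul_eq_one_comm.mp hR
  rw [← Matrix.frobenius_norm_transpose, Matrix.transpose_mul, norm_mul_of_orthonormal hR',
    Matrix.frobenius_norm_transpose]

/-- Both squares equal the trace of (A'A)² by cyclicity. This allows moving between the T × T matrix
e e', whose smallness PCA needs, and the d × d matrix e'e, on which the projections and the
covariance act. -/
theorem norm_gram_eq_norm_outer {m n : ℕ} (A : Matrix (Fin m) (Fin n) ℝ) :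
    ‖Aᵀ * A‖ = ‖A * Aᵀ‖ := by
  rw [← sq_eq_sq₀ (norm_nonneg _) (norm_nonneg _), norm_sq_eq_trace, norm_sq_eq_trace]
  simp only [Matrix.transpose_mul, Matrix.transpose_transpose]
  rw [Matrix.mul_assoc, Matrix.trace_mul_comm]
  simp only [Matrix.mul_assoc]

/-- Orthogonal projections are contractions for the Frobenius norm. -/
theorem norm_mul_sq_add_norm_compl_mul_sq {m n : ℕ} {P : Matrix (Fin m) (Fin m) ℝ} (hs : Pᵀ = P)
    (hi : P * P = P) (A : Matrix (Fin m) (Fin n) ℝ) :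
    ‖P * A‖ ^ 2 + ‖(1 - P) * A‖ ^ 2 = ‖A‖ ^ 2 := by
  have h1 : (1 - P) * (1 - P) = 1 - P := by
    simp [mul_sub, sub_mul, hi]
  simp only [norm_sq_eq_trace, Matrix.transpose_mul, Matrix.transpose_sub, Matrix.transpose_one, hs]
  rw [Matrix.mul_assoc, ← Matrix.mul_assoc P, hi, Matrix.mul_assoc, ← Matrix.mul_assoc (1 - P), h1,
    ← Matrix.trace_add, ← Matrix.mul_add, ← Matrix.add_mul]
  simp

theorem norm_proj_mul_le {m n : ℕ} {P : Matrix (Fin m) (Fin m) ℝ} (hs : Pᵀ = P)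
    (hi : P * P = P) (A : Matrix (Fin m) (Fin n) ℝ) : ‖P * A‖ ≤ ‖A‖ := by
  refine abs_le_of_sq_le_sq' ?_ (by positivity) |>.2
  nlinarith [norm_mul_sq_add_norm_compl_mul_sq hs hi A, sq_nonneg ‖(1 - P) * A‖]

theorem norm_compl_proj_mul_le {m n : ℕ} {P : Matrix (Fin m) (Fin m) ℝ} (hs : Pᵀ = P)
    (hi : P * P = P) (A : Matrix (Fin m) (Fin n) ℝ) : ‖(1 - P) * A‖ ≤ ‖A‖ := by
  refine abs_le_of_sq_le_sq' ?_ (by positivity) |>.2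
  nlinarith [norm_mul_sq_add_norm_compl_mul_sq hs hi A, sq_nonneg ‖P * A‖]

/-- The map `A ↦ (P + 1) A / 2` is a contraction for the Frobenius norm. -/
theorem norm_half_proj_mul_le {m n : ℕ} {P : Matrix (Fin m) (Fin m) ℝ} (hs : Pᵀ = P)
    (hi : P * P = P) (A : Matrix (Fin m) (Fin n) ℝ) : ‖(1 / 2 : ℝ) • (P + 1) * A‖ ≤ ‖A‖ := by
  rw [Matrix.smul_mul, norm_smul, Matrix.add_mul, Matrix.one_mul]
  have := norm_add_le (P * A) A
  have := norm_proj_mul_le hs hi A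
  norm_num
  linarith

/-- The Frobenius norm of a product is at most the spectral norm of the first factor times the
Frobenius norm of the second. -/
theorem norm_mul_le_specNorm_mul {m n k : ℕ} (A : Matrix (Fin m) (Fin n) ℝ)
    (B : Matrix (Fin n) (Fin k) ℝ) : ‖A * B‖ ≤ specNorm A * ‖B‖ := by
  have hA := specNorm_nonneg A
  refine abs_le_of_sq_le_sq' ?_ (by positivity) |>.2
  rw [mul_pow, ← frobSq_eq_norm_sq, ← frobSq_eq_norm_sq, frobSq, frobSq, Finset.sum_comm,
    Finset.sum_comm (γ := Fin n), Finset.mul_sum]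
  refine Finset.sum_le_sum fun j _ => ?_
  have h := Matrix.l2_opNorm_mulVec A (WithLp.toLp 2 fun i => B i j)
  have h2 := pow_le_pow_left₀ (norm_nonneg _) h 2
  rw [mul_pow, EuclideanSpace.norm_sq_eq, EuclideanSpace.norm_sq_eq] at h2
  simpa [Matrix.mulVec, dotProduct, Matrix.mul_apply] using! h2

/-! ### Eigenvalues -/

/-- The spectral theorem with the eigenvalues in decreasing order. -/
theorem exists_sorted_spectral {n : ℕ} {A : Matrix (Fin n) (Fin n) ℝ} (hA : A.IsHermitian) :
    ∃ U : Matrix (Fin n) (Fin n) ℝ, Uᵀ * U = 1 ∧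
      A = U * Matrix.diagonal (sortedEigenvalues hA) * Uᵀ := by
  let e : Fin n ≃ Fin n :=
    (finCongr (Fintype.card_fin n).symm).trans (Fintype.equivOfCardEq (Fintype.card_fin _))
  let V : Matrix (Fin n) (Fin n) ℝ := hA.eigenvectorUnitary
  have hV : Vᵀ * V = 1 := by
    have := Unitary.coe_star_mul_self hA.eigenvectorUnitary
    simpa [Matrix.star_eq_conjTranspose] using this
  have hs : sortedEigenvalues hA = hA.eigenvalues ∘ e := by
    funext j
    simp [sortedEigenvalues, Matrix.IsHermitian.eigenvalues, e]
  have hAV : A = V * Matrix.diagonal hA.eigenvalues * Vᵀ := by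
    have := hA.spectral_theorem
    rw [Unitary.conjStarAlgAut_apply] at this
    simpa [Matrix.star_eq_conjTranspose, V] using this
  refine ⟨V.submatrix id e, ?_, ?_⟩
  · rw [Matrix.transpose_submatrix, ← Matrix.submatrix_mul Vᵀ V e id e Function.bijective_id, hV,
      Matrix.submatrix_one_equiv]
  · rw [hs, ← Matrix.submatrix_diagonal_equiv, Matrix.transpose_submatrix,
      Matrix.submatrix_mul_equiv, Matrix.submatrix_mul_equiv]
    simpa using hAV

theorem sortedEigenvalues_antitone {n : ℕ} {A : Matrix (Fin n) (Fin n) ℝ} (hA : A.IsHermitian) :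
    Antitone (sortedEigenvalues hA) :=
  fun _ _ h => hA.eigenvalues₀_antitone (by simpa using h)

/-- The lower bound in the Courant-Fischer theorem. -/
theorem le_sortedEigenvalues_outer {n r m : ℕ} (x : Matrix (Fin n) (Fin m) ℝ) (h : r ≤ n) {c : ℝ}
    (W : Matrix (Fin n) (Fin r) ℝ)
    (hW : ∀ u : Matrix (Fin r) (Fin 1) ℝ, u ≠ 0 → W * u ≠ 0)
    (hc : ∀ u : Matrix (Fin r) (Fin 1) ℝ, c * ‖W * u‖ ^ 2 ≤ ‖xᵀ * (W * u)‖ ^ 2) (j : Fin r) :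
    c ≤ sortedEigenvalues (outer_isHermitian x) (Fin.castLE h j) := by
  obtain ⟨U, hU, hA⟩ := exists_sorted_spectral (outer_isHermitian x)
  set ev := sortedEigenvalues (outer_isHermitian x) with hev
  have hU' : (Uᵀ)ᵀ * Uᵀ = 1 := by
    rw [Matrix.transpose_transpose]; exact mul_eq_one_comm.mp hU
  -- Orthogonality to the eigenvectors with index below j is j linear conditions on r > j unknowns.
  -- A nonzero solution u gives W u a Rayleigh quotient of at most the eigenvalue with index j.
  let B : Matrix (Fin j) (Fin r) ℝ :=
    (Uᵀ * W).submatrix (Fin.castLE (j.2.le.trans h)) id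
  have hker : LinearMap.ker B.mulVecLin ≠ ⊥ :=
    LinearMap.ker_ne_bot_of_finrank_lt (by simp)
  obtain ⟨v, hv, hv0⟩ := (Submodule.ne_bot_iff _).mp hker
  let u : Matrix (Fin r) (Fin 1) ℝ := Matrix.of fun i _ => v i
  have hu : u ≠ 0 := fun hu => hv0 (by
    funext i
    exact congrFun (congrFun hu i) 0)
  set z := Uᵀ * (W * u) with hz
  have hz0 : ∀ i : Fin n, (i : ℕ) < j → z i 0 = 0 := by
    intro i hi
    have := congrFun hv ⟨i, hi⟩
    simpa [B, hz, u, ← Matrix.mul_assoc, Matrix.mul_apply, Matrix.mulVec, dotProduct] using this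
  have hzn : ‖z‖ = ‖W * u‖ := norm_mul_of_orthonormal hU' _
  have hzpos : 0 < ‖z‖ := by rw [hzn]; exact norm_pos_iff.mpr (hW u hu)
  have hzx : ‖xᵀ * (W * u)‖ ^ 2 = ∑ i, ev i * z i 0 ^ 2 := by
    rw [norm_sq_eq_trace, Matrix.transpose_mul, Matrix.transpose_transpose, Matrix.mul_assoc,
      ← Matrix.mul_assoc x, hA]
    have : (W * u)ᵀ * (U * Matrix.diagonal ev * Uᵀ * (W * u)) = zᵀ * (Matrix.diagonal ev * z) := by
      rw [hz, Matrix.transpose_mul Uᵀ, Matrix.transpose_transpose]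
      simp only [Matrix.mul_assoc]
    rw [this]
    rw [Matrix.trace_fin_one, Matrix.mul_apply]
    simp only [Matrix.transpose_apply, Matrix.diagonal_mul]
    exact Finset.sum_congr rfl fun i _ => by ring
  have hle : ∑ i, ev i * z i 0 ^ 2 ≤ ev (Fin.castLE h j) * ‖z‖ ^ 2 := by
    rw [← frobSq_eq_norm_sq, frobSq, Finset.mul_sum]
    refine Finset.sum_le_sum fun i _ => ?_
    simp only [Finset.univ_unique, Fin.default_eq_zero, Finset.sum_singleton]
    rcases lt_or_ge (i : ℕ) j with hi | hi
    · simp [hz0 i hi]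
    · exact mul_le_mul_of_nonneg_right (sortedEigenvalues_antitone _ (by simpa [Fin.le_def] using hi))
        (sq_nonneg _)
  have := hc u
  rw [hzx, ← hzn] at this
  exact le_of_mul_le_mul_right (this.trans hle) (by positivity)

end

section

open scoped Matrix.Norms.Frobenius Matrix

/-! ### Perturbation bounds for principal components -/

/-- The columns of `Q` are orthonormal eigenvectors of `xx'` with eigenvalues `v`, for which the
lower bound in the Courant-Fischer theorem holds. -/
structure IsLeadingPair {n m r : ℕ} (x : Matrix (Fin n) (Fin m) ℝ) (Q : Matrix (Fin n) (Fin r) ℝ)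
    (v : Fin r → ℝ) : Prop where
  orthonormal : Qᵀ * Q = 1
  eigen : x * xᵀ * Q = Q * Matrix.diagonal v
  antitone : Antitone v
  le_of_subspace : ∀ (c : ℝ) (W : Matrix (Fin n) (Fin r) ℝ),
    (∀ u : Matrix (Fin r) (Fin 1) ℝ, u ≠ 0 → W * u ≠ 0) →
    (∀ u : Matrix (Fin r) (Fin 1) ℝ, c * ‖W * u‖ ^ 2 ≤ ‖xᵀ * (W * u)‖ ^ 2) → ∀ j, c ≤ v j

theorem IsLeadingEigenvectors.isLeadingPair {n m r : ℕ} {x : Matrix (Fin n) (Fin m) ℝ}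
    {Q : Matrix (Fin n) (Fin r) ℝ} (hQ : IsLeadingEigenvectors (outer_isHermitian x) Q) :
    ∃ v, IsLeadingPair x Q v := by
  obtain ⟨h, h1, h2⟩ := hQ
  exact ⟨_, h1, h2, fun i j hij => sortedEigenvalues_antitone _ (by simpa using hij),
    fun c W hW hc j => le_sortedEigenvalues_outer x h W hW hc j⟩

/-- Eigenvectors are unchanged by scaling the data, so those of the raw sample serve for the sample
divided by √(Td), where the perturbation bounds live. -/
theorem IsLeadingPair.smul {n m r : ℕ} {x : Matrix (Fin n) (Fin m) ℝ}
    {Q : Matrix (Fin n) (Fin r) ℝ} {v : Fin r → ℝ} (h : IsLeadingPair x Q v) {s : ℝ}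
    (hs : s ≠ 0) : IsLeadingPair (s • x) Q (fun j => s ^ 2 * v j) where
  orthonormal := h.orthonormal
  eigen := by
    have : (fun j => s ^ 2 * v j) = s ^ 2 • v := rfl
    rw [this, Matrix.diagonal_smul, Matrix.mul_smul, ← h.eigen]
    simp [smul_smul, sq]
  antitone := fun i j hij => mul_le_mul_of_nonneg_left (h.antitone hij) (sq_nonneg s)
  le_of_subspace := fun c W hW hc j => by
    have hs2 : 0 < s ^ 2 := by positivity
    have := h.le_of_subspace (c / s ^ 2) W hW (fun u => by
      have := hc u
      rw [Matrix.transpose_smul, Matrix.smul_mul, norm_smul, mul_pow, Real.norm_eq_abs,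
        sq_abs] at this
      rw [div_mul_eq_mul_div, div_le_iff₀ hs2]
      linarith) j
    rw [div_le_iff₀ hs2] at this
    linarith

/-- Bounds on the parts of an approximate factor structure `x = f l' + e`, in which `η` is small,
and `B` and `c` are bounds from above and below. -/
structure FactorBounds {T d r : ℕ} (f : Matrix (Fin T) (Fin r) ℝ) (l : Matrix (Fin d) (Fin r) ℝ)
    (e : Matrix (Fin T) (Fin d) ℝ) (B c η : ℝ) : Prop where
  dim_le : (r : ℝ) + 1 ≤ B
  pos : 0 < c
  factor_le : ‖f‖ ≤ B
  loading_le : ‖l‖ ≤ B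
  factor_ge : ∀ u : Matrix (Fin r) (Fin 1) ℝ, c * ‖u‖ ≤ ‖f * u‖
  loading_ge : ∀ u : Matrix (Fin r) (Fin 1) ℝ, c * ‖u‖ ≤ ‖l * u‖
  error_loading : ‖e * l‖ ≤ η
  error_outer : ‖e * eᵀ‖ ≤ η

theorem norm_sq_le_norm_gram {n : ℕ} (a : Matrix (Fin n) (Fin 1) ℝ) : ‖a‖ ^ 2 ≤ ‖aᵀ * a‖ := by
  rw [norm_sq_eq_trace, Matrix.trace_fin_one]
  exact (le_abs_self _).trans (abs_entry_le_norm _ _ _)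

/-- The norm is √n; the crude bound n + 1 matches the requirement r + 1 ≤ B in `FactorBounds`, so
that B bounds Q too. -/
theorem norm_le_of_orthonormal {m n : ℕ} {Q : Matrix (Fin m) (Fin n) ℝ} (hQ : Qᵀ * Q = 1) :
    ‖Q‖ ≤ n + 1 := by
  refine abs_le_of_sq_le_sq' ?_ (by positivity) |>.2
  rw [norm_sq_of_orthonormal hQ]
  have : (0 : ℝ) ≤ n := n.cast_nonneg
  nlinarith

theorem FactorBounds.one_le {T d r : ℕ} {f : Matrix (Fin T) (Fin r) ℝ}
    {l : Matrix (Fin d) (Fin r) ℝ} {e : Matrix (Fin T) (Fin d) ℝ} {B c η : ℝ}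
    (h : FactorBounds f l e B c η) : 1 ≤ B := by
  have := h.dim_le
  have : (0 : ℝ) ≤ r := r.cast_nonneg
  linarith

theorem FactorBounds.nonneg {T d r : ℕ} {f : Matrix (Fin T) (Fin r) ℝ}
    {l : Matrix (Fin d) (Fin r) ℝ} {e : Matrix (Fin T) (Fin d) ℝ} {B c η : ℝ}
    (h : FactorBounds f l e B c η) : 0 ≤ η :=
  (norm_nonneg _).trans h.error_outer

theorem norm_mul_le_of_le {m n k : ℕ} {A : Matrix (Fin m) (Fin n) ℝ}
    {A' : Matrix (Fin n) (Fin k) ℝ} {a b : ℝ} (hA : ‖A‖ ≤ a) (hA' : ‖A'‖ ≤ b) :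
    ‖A * A'‖ ≤ a * b :=
  (Matrix.frobenius_norm_mul A A').trans
    (mul_le_mul hA hA' (norm_nonneg _) ((norm_nonneg _).trans hA))

/-- The leading eigenvalues are bounded away from zero. -/
theorem FactorBounds.le_eigenvalue {T d r : ℕ} {f : Matrix (Fin T) (Fin r) ℝ}
    {l : Matrix (Fin d) (Fin r) ℝ} {e : Matrix (Fin T) (Fin d) ℝ} {B c η : ℝ}
    (h : FactorBounds f l e B c η) (hη : η ≤ c ^ 3 / 2) {Q : Matrix (Fin T) (Fin r) ℝ}
    {v : Fin r → ℝ} (hQ : IsLeadingPair (f * lᵀ + e) Q v) (j : Fin r) :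
    (c ^ 3 / (2 * B)) ^ 2 ≤ v j := by
  have hc := h.pos
  have hB := h.one_le
  have hll : ∀ u : Matrix (Fin r) (Fin 1) ℝ, c ^ 2 * ‖u‖ ≤ ‖lᵀ * (l * u)‖ := by
    intro u
    rcases (norm_nonneg u).eq_or_lt with hu | hu
    · rw [← hu, mul_zero]; exact norm_nonneg _
    have h1 := h.loading_ge u
    have h2 := norm_sq_le_norm_gram (l * u)
    rw [Matrix.transpose_mul, Matrix.mul_assoc] at h2
    have h3 := Matrix.frobenius_norm_mul uᵀ (lᵀ * (l * u))
    rw [Matrix.frobenius_norm_transpose] at h3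
    have h4 : (c * ‖u‖) ^ 2 ≤ ‖l * u‖ ^ 2 := pow_le_pow_left₀ (by positivity) h1 2
    have h5 : ‖u‖ * (c ^ 2 * ‖u‖) ≤ ‖u‖ * ‖lᵀ * (l * u)‖ := by nlinarith
    exact le_of_mul_le_mul_left h5 hu
  have hw : ∀ u : Matrix (Fin r) (Fin 1) ℝ, c ^ 3 / 2 * ‖u‖ ≤ ‖(f * lᵀ + e) * l * u‖ := by
    intro u
    have h1 : (f * lᵀ + e) * l * u = f * (lᵀ * (l * u)) + e * l * u := by
      simp only [Matrix.add_mul, Matrix.mul_assoc]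
    have h2 := norm_sub_le_norm_add (f * (lᵀ * (l * u))) (e * l * u)
    have h3 := norm_mul_le_of_le h.error_loading (le_refl ‖u‖)
    have h4 := h.factor_ge (lᵀ * (l * u))
    have h5 := mul_le_mul_of_nonneg_left (hll u) hc.le
    have h6 := mul_le_mul_of_nonneg_right hη (norm_nonneg u)
    rw [h1]
    have h7 : c * (c ^ 2 * ‖u‖) = c ^ 3 * ‖u‖ := by ring
    linarith
  -- The test space is the range of w = x l u, not of f u, so that the error enters through e l
  -- alone and no bound on e'f is needed; such a bound is not available for the transformed series.
  -- Cauchy-Schwarz in ‖w‖² = ⟨x'w, l u⟩ together with c³/2 ‖u‖ ≤ ‖w‖ gives c³/(2B) ‖w‖ ≤ ‖x'w‖.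
  refine hQ.le_of_subspace _ ((f * lᵀ + e) * l) (fun u hu h0 => ?_) (fun u => ?_) j
  · have h1 := hw u
    rw [h0, norm_zero] at h1
    have : 0 < c ^ 3 / 2 * ‖u‖ := by have := norm_pos_iff.mpr hu; positivity
    linarith
  · set x := f * lᵀ + e
    set w := x * l * u with hwdef
    rcases (norm_nonneg w).eq_or_lt with hw0 | hw0
    · rw [← hw0]; simp
    have h1 := norm_sq_le_norm_gram w
    have h2 : wᵀ * w = (xᵀ * w)ᵀ * (l * u) := by
      rw [Matrix.transpose_mul xᵀ, Matrix.transpose_transpose, Matrix.mul_assoc,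
        ← Matrix.mul_assoc x, ← hwdef]
    rw [h2] at h1
    have h3 : ‖l * u‖ ≤ B * ‖u‖ := norm_mul_le_of_le h.loading_le le_rfl
    have h4 : ‖(xᵀ * w)ᵀ * (l * u)‖ ≤ ‖xᵀ * w‖ * (B * ‖u‖) :=
      norm_mul_le_of_le (Matrix.frobenius_norm_transpose _).le h3
    have h5 := hw u
    have h6 : ‖u‖ ≤ 2 / c ^ 3 * ‖w‖ := by
      rw [div_mul_eq_mul_div, le_div_iff₀ (by positivity)]
      linarith
    have h7 : ‖w‖ * ‖w‖ ≤ ‖w‖ * (‖xᵀ * w‖ * (2 * B / c ^ 3)) := by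
      calc ‖w‖ * ‖w‖ ≤ ‖xᵀ * w‖ * (B * ‖u‖) := by rw [← sq]; exact h1.trans h4
        _ ≤ ‖xᵀ * w‖ * (B * (2 / c ^ 3 * ‖w‖)) := by gcongr
        _ = _ := by ring
    have h8 := le_of_mul_le_mul_left h7 hw0
    rw [← mul_pow]
    refine pow_le_pow_left₀ (by positivity) ?_ 2
    rw [div_mul_eq_mul_div, div_le_iff₀ (by positivity)]
    have h9 := mul_le_mul_of_nonneg_left h8 (by positivity : 0 ≤ c ^ 3)
    calc c ^ 3 * ‖w‖ ≤ _ := h9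
      _ = _ := by field_simp

/-- The leading eigenvectors are close to the column space of the factors. -/
theorem FactorBounds.exists_decomposition {T d r : ℕ} {f : Matrix (Fin T) (Fin r) ℝ}
    {l : Matrix (Fin d) (Fin r) ℝ} {e : Matrix (Fin T) (Fin d) ℝ} {B c η : ℝ}
    (h : FactorBounds f l e B c η) (hη : η ≤ 1) {c' : ℝ} (hc' : 0 < c')
    {Q : Matrix (Fin T) (Fin r) ℝ} {v : Fin r → ℝ} (hQ : IsLeadingPair (f * lᵀ + e) Q v)
    (hv : ∀ j, c' ≤ v j) :
    ∃ (K : Matrix (Fin r) (Fin r) ℝ) (W : Matrix (Fin T) (Fin r) ℝ),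
      Q = f * K + W ∧ ‖K‖ ≤ 2 * B ^ 5 / c' ∧ ‖W‖ ≤ 2 * B ^ 5 / c' * η ∧
      K * Matrix.diagonal v = lᵀ * l * (fᵀ * Q) + (e * l)ᵀ * Q := by
  have hB := h.one_le
  have hη0 := h.nonneg
  have hv0 : ∀ j, 0 < v j := fun j => hc'.trans_le (hv j)
  have hQn : ‖Q‖ ≤ B := (norm_le_of_orthonormal hQ.orthonormal).trans h.dim_le
  have hV : Matrix.diagonal v * Matrix.diagonal (fun j => (v j)⁻¹) = 1 := by
    rw [Matrix.diagonal_mul_diagonal, ← Matrix.diagonal_one]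
    congr 1; funext j; exact mul_inv_cancel₀ (hv0 j).ne'
  have hVn : ‖Matrix.diagonal (fun j => (v j)⁻¹)‖ ≤ B / c' := by
    refine (norm_le_of_abs_entry_le (c := c'⁻¹) (by positivity) fun i j => ?_).trans ?_
    · rw [Matrix.diagonal_apply]
      split_ifs
      · rw [abs_of_pos (inv_pos.mpr (hv0 i))]
        exact inv_anti₀ hc' (hv i)
      · simp [hc'.le]
    · rw [div_eq_mul_inv]
      have := h.dim_le
      gcongr
      linarith
  -- Expand x x' Q = Q V. The terms with left factor f make up f (K V); the remaining ones all
  -- contain e l or e e' and make up W V.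
  refine ⟨(lᵀ * l * (fᵀ * Q) + (e * l)ᵀ * Q) * Matrix.diagonal (fun j => (v j)⁻¹),
    ((e * l) * (fᵀ * Q) + e * eᵀ * Q) * Matrix.diagonal (fun j => (v j)⁻¹), ?_, ?_, ?_, ?_⟩
  · have h1 : Q * Matrix.diagonal v = f * (lᵀ * l * (fᵀ * Q) + (e * l)ᵀ * Q) +
        ((e * l) * (fᵀ * Q) + e * eᵀ * Q) := by
      rw [← hQ.eigen]
      simp only [Matrix.transpose_add, Matrix.transpose_mul, Matrix.transpose_transpose,
        Matrix.add_mul, Matrix.mul_add, Matrix.mul_assoc]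
      abel
    rw [← Matrix.mul_assoc, ← Matrix.add_mul, ← h1, Matrix.mul_assoc, hV, Matrix.mul_one]
  · have hfQ : ‖fᵀ * Q‖ ≤ B * B :=
      norm_mul_le_of_le ((Matrix.frobenius_norm_transpose _).le.trans h.factor_le) hQn
    have hl : ‖lᵀ * l‖ ≤ B * B :=
      norm_mul_le_of_le ((Matrix.frobenius_norm_transpose _).le.trans h.loading_le) h.loading_le
    have he : ‖(e * l)ᵀ * Q‖ ≤ η * B :=
      norm_mul_le_of_le ((Matrix.frobenius_norm_transpose _).le.trans h.error_loading) hQn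
    have h1 := (norm_add_le _ _).trans (add_le_add (norm_mul_le_of_le hl hfQ) he)
    refine (norm_mul_le_of_le h1 hVn).trans ?_
    have h2 : η * B ≤ B ^ 4 := by
      calc η * B ≤ 1 * B := by gcongr
        _ = B ^ 1 := by ring
        _ ≤ B ^ 4 := pow_le_pow_right₀ hB (by norm_num)
    calc (B * B * (B * B) + η * B) * (B / c') ≤ (B ^ 4 + B ^ 4) * (B / c') := by
          gcongr; exact le_of_eq (by ring)
      _ = _ := by ring
  · have hfQ : ‖fᵀ * Q‖ ≤ B * B :=
      norm_mul_le_of_le ((Matrix.frobenius_norm_transpose _).le.trans h.factor_le) hQn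
    have h1 := (norm_add_le _ _).trans (add_le_add (norm_mul_le_of_le h.error_loading hfQ)
      (norm_mul_le_of_le h.error_outer hQn))
    refine (norm_mul_le_of_le h1 hVn).trans ?_
    have h2 : B ^ 2 ≤ B ^ 4 := pow_le_pow_right₀ hB (by norm_num)
    have h3 : B ^ 1 ≤ B ^ 4 := pow_le_pow_right₀ hB (by norm_num)
    calc (η * (B * B) + η * B) * (B / c') = (B ^ 2 + B ^ 1) * (B / c') * η := by ring
      _ ≤ (B ^ 4 + B ^ 4) * (B / c') * η := by gcongr
      _ = _ := by ring
  · rw [Matrix.mul_assoc, mul_eq_one_comm.mp hV, Matrix.mul_one]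

/-! ### Projections onto estimated column spaces -/

theorem colProj_transpose {d r : ℕ} (L : Matrix (Fin d) (Fin r) ℝ) :
    (colProj L)ᵀ = colProj L := by
  simp [colProj, Matrix.transpose_mul, Matrix.transpose_nonsing_inv, Matrix.mul_assoc]

theorem colProj_mul_self {d r : ℕ} {L : Matrix (Fin d) (Fin r) ℝ} (hL : IsUnit (Lᵀ * L)) :
    colProj L * L = L := by
  rw [colProj, Matrix.mul_assoc, Matrix.mul_assoc,
    Matrix.nonsing_inv_mul _ ((Matrix.isUnit_iff_isUnit_det _).mp hL), Matrix.mul_one]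

theorem colProj_idempotent {d r : ℕ} {L : Matrix (Fin d) (Fin r) ℝ} (hL : IsUnit (Lᵀ * L)) :
    colProj L * colProj L = colProj L := by
  conv_lhs => rw [colProj.eq_1 (L := L)]; rhs; rw [Matrix.mul_assoc]
  rw [← colProj, ← Matrix.mul_assoc, colProj_mul_self hL, ← Matrix.mul_assoc, colProj]

/-- Raw and scaled samples give proportional loadings, hence the same projection. The singular case
holds as well, since the matrix inverse is then zero on both sides. -/
theorem colProj_smul {d r : ℕ} (L : Matrix (Fin d) (Fin r) ℝ) {s : ℝ} (hs : s ≠ 0) :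
    colProj (s • L) = colProj L := by
  have h1 : ((s * s) • (Lᵀ * L))⁻¹ = (s * s)⁻¹ • (Lᵀ * L)⁻¹ := by
    by_cases hL : IsUnit (Lᵀ * L)
    swap
    · have hL' : ¬ IsUnit ((s * s) • (Lᵀ * L)) := fun h => hL <| by
        have := h.smul (Units.mk0 (s * s)⁻¹ (inv_ne_zero (mul_ne_zero hs hs)))
        rwa [Units.smul_mk0, smul_smul, inv_mul_cancel₀ (mul_ne_zero hs hs), one_smul] at this
      rw [Matrix.isUnit_iff_isUnit_det] at hL hL'
      rw [Matrix.nonsing_inv_apply_not_isUnit _ hL, Matrix.nonsing_inv_apply_not_isUnit _ hL',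
        smul_zero]
    refine Matrix.inv_eq_right_inv ?_
    rw [Matrix.smul_mul, Matrix.mul_smul, smul_smul, mul_inv_cancel₀ (mul_ne_zero hs hs),
      Matrix.mul_nonsing_inv _ ((Matrix.isUnit_iff_isUnit_det _).mp hL), one_smul]
  have h2 : (s • L)ᵀ * (s • L) = (s * s) • (Lᵀ * L) := by
    rw [Matrix.transpose_smul, Matrix.smul_mul, Matrix.mul_smul, smul_smul]
  rw [colProj, colProj, h2, h1, Matrix.transpose_smul]
  simp only [Matrix.smul_mul, Matrix.mul_smul, smul_smul]
  rw [show s * ((s * s)⁻¹ * s) = 1 by field_simp, one_smul]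

/-- This turns the lower bound on the eigenvalues into invertibility of L'L, without which `colProj
L` would not be a genuine projection. -/
theorem IsLeadingPair.gram_loading {T d r : ℕ} {x : Matrix (Fin T) (Fin d) ℝ}
    {Q : Matrix (Fin T) (Fin r) ℝ} {v : Fin r → ℝ} (hQ : IsLeadingPair x Q v) :
    (xᵀ * Q)ᵀ * (xᵀ * Q) = Matrix.diagonal v := by
  rw [Matrix.transpose_mul, Matrix.transpose_transpose, Matrix.mul_assoc, ← Matrix.mul_assoc x,
    hQ.eigen, ← Matrix.mul_assoc, hQ.orthonormal, Matrix.one_mul]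

theorem IsLeadingPair.isUnit_gram_loading {T d r : ℕ} {x : Matrix (Fin T) (Fin d) ℝ}
    {Q : Matrix (Fin T) (Fin r) ℝ} {v : Fin r → ℝ} (hQ : IsLeadingPair x Q v)
    (hv : ∀ j, 0 < v j) : IsUnit ((xᵀ * Q)ᵀ * (xᵀ * Q)) := by
  rw [hQ.gram_loading, Matrix.isUnit_diagonal, Pi.isUnit_iff]
  exact fun j => (hv j).ne'.isUnit

/-- The projection onto the estimated column space almost preserves the loadings. -/
theorem FactorBounds.norm_compl_colProj_mul_le {T d r : ℕ} {f : Matrix (Fin T) (Fin r) ℝ}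
    {l : Matrix (Fin d) (Fin r) ℝ} {e : Matrix (Fin T) (Fin d) ℝ} {B c η : ℝ}
    (h : FactorBounds f l e B c η) (he : ‖e‖ ≤ B) (hef : ‖eᵀ * f‖ ≤ η)
    {Q : Matrix (Fin T) (Fin r) ℝ} {v : Fin r → ℝ} (hQ : IsLeadingPair (f * lᵀ + e) Q v)
    (hv : ∀ j, 0 < v j) {K : Matrix (Fin r) (Fin r) ℝ} {W : Matrix (Fin T) (Fin r) ℝ} {C : ℝ}
    (hC : 1 ≤ C) (hdec : Q = f * K + W) (hK : ‖K‖ ≤ C) (hW : ‖W‖ ≤ C * η)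
    (hη : 2 * B * C * η ≤ 1) :
    ‖(1 - colProj ((f * lᵀ + e)ᵀ * Q)) * l‖ ≤ 4 * B ^ 2 * C ^ 2 * η := by
  have hB := h.one_le
  have hη0 := h.nonneg
  have hQn : ‖Q‖ ≤ B := (norm_le_of_orthonormal hQ.orthonormal).trans h.dim_le
  set x := f * lᵀ + e with hx
  set L := xᵀ * Q with hL
  have hu : IsUnit (Lᵀ * L) := hQ.isUnit_gram_loading hv
  set Δ := Wᵀ * Q with hΔ
  have hΔn : ‖Δ‖ ≤ 1 / 2 := by
    refine (norm_mul_le_of_le ((Matrix.frobenius_norm_transpose _).le.trans hW) hQn).trans ?_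
    linarith
  -- Multiplying the transpose of Q = f K + W by Q gives 1 = K'(f'Q) + Δ with Δ small. Hence f'Q is
  -- invertible, with inverse N K', where N inverts 1 - Δ.
  have hKH : Kᵀ * (fᵀ * Q) = 1 - Δ := by
    rw [eq_sub_iff_add_eq, ← hQ.orthonormal, hΔ]
    conv_rhs => lhs; rw [hdec]
    rw [Matrix.transpose_add, Matrix.transpose_mul, Matrix.add_mul, Matrix.mul_assoc]
  obtain ⟨N, hN⟩ : ∃ N, N * (1 - Δ) = 1 := by
    obtain ⟨u, hu⟩ := isUnit_one_sub_of_norm_lt_one (lt_of_le_of_lt hΔn (by norm_num))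
    exact ⟨_, by rw [← hu]; exact u.inv_mul⟩
  have hNn : ‖N‖ ≤ 2 * B := by
    have h1 : N = 1 + N * Δ := by
      rw [mul_sub, mul_one, sub_eq_iff_eq_add] at hN
      exact hN
    have h2 : ‖N‖ ≤ ‖(1 : Matrix (Fin r) (Fin r) ℝ)‖ + ‖N‖ * (1 / 2) := by
      conv_lhs => rw [h1]
      exact (norm_add_le _ _).trans (by gcongr; exact norm_mul_le_of_le le_rfl hΔn)
    have h3 : ‖(1 : Matrix (Fin r) (Fin r) ℝ)‖ ≤ B :=
      (norm_le_of_orthonormal (by simp)).trans h.dim_le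
    linarith
  have hinv : fᵀ * Q * (N * Kᵀ) = 1 := by
    rw [mul_eq_one_comm, Matrix.mul_assoc, hKH, hN]
  -- As e is only bounded, the smallness comes from e'f in the first term and from W in the second.
  have heQ : ‖eᵀ * Q‖ ≤ 2 * B * C * η := by
    rw [hdec, Matrix.mul_add, ← Matrix.mul_assoc]
    refine (norm_add_le _ _).trans ((add_le_add (norm_mul_le_of_le hef hK) (norm_mul_le_of_le
      ((Matrix.frobenius_norm_transpose _).le.trans he) hW)).trans ?_)
    have : 0 ≤ η * C := by positivity
    nlinarith
  -- The complementary projection annihilates L = l f'Q + e'Q, so on l f'Q it equals minus its value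
  -- on e'Q; then f'Q is cancelled by its inverse.
  have hZ : (1 - colProj L) * l = -((1 - colProj L) * (eᵀ * Q)) * (N * Kᵀ) := by
    have h1 : (1 - colProj L) * l * (fᵀ * Q) = -((1 - colProj L) * (eᵀ * Q)) := by
      rw [eq_neg_iff_add_eq_zero, Matrix.mul_assoc, ← Matrix.mul_add]
      have : l * (fᵀ * Q) + eᵀ * Q = L := by
        rw [hL, hx, Matrix.transpose_add, Matrix.transpose_mul, Matrix.transpose_transpose,
          Matrix.add_mul, Matrix.mul_assoc]
      rw [this, Matrix.sub_mul, colProj_mul_self hu, Matrix.one_mul, sub_self]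
    rw [← h1, Matrix.mul_assoc _ (fᵀ * Q), hinv, Matrix.mul_one]
  rw [hZ]
  have h1 : ‖-((1 - colProj L) * (eᵀ * Q))‖ ≤ 2 * B * C * η := by
    rw [norm_neg]
    exact (norm_compl_proj_mul_le (colProj_transpose L) (colProj_idempotent hu) _).trans heQ
  refine (norm_mul_le_of_le h1 (norm_mul_le_of_le hNn
    ((Matrix.frobenius_norm_transpose _).le.trans hK))).trans (le_of_eq (by ring))

/-! ### Error terms after the transformation of the two half samples. -/

theorem norm_mul_half_proj_le {k d : ℕ} {P : Matrix (Fin d) (Fin d) ℝ} (hs : Pᵀ = P)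
    (hi : P * P = P) (A : Matrix (Fin k) (Fin d) ℝ) : ‖A * ((1 / 2 : ℝ) • (P + 1))‖ ≤ ‖A‖ := by
  have := norm_half_proj_mul_le hs hi Aᵀ
  rw [← Matrix.frobenius_norm_transpose, Matrix.transpose_mul]
  simpa [hs] using this

/-- In the outer product the factor (P + 1)/2 sits between e and e', where the bound on e e' cannot
be used. In the Gram matrix it stands on the outside and acts as a contraction; what remains is (J
e)'(J e), whose norm is that of J e e' J. -/
theorem norm_gram_split_le {T d : ℕ} {e : Matrix (Fin T) (Fin d) ℝ} {η : ℝ}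
    (hee : ‖e * eᵀ‖ ≤ η) {J : Matrix (Fin T) (Fin T) ℝ} (hJs : Jᵀ = J) (hJi : J * J = J)
    {P : Matrix (Fin d) (Fin d) ℝ} (hs : Pᵀ = P) (hi : P * P = P) :
    ‖(J * e * ((1 / 2 : ℝ) • (P + 1)))ᵀ * (J * e * ((1 / 2 : ℝ) • (P + 1)))‖ ≤ η := by
  have hMs : ((1 / 2 : ℝ) • (P + 1))ᵀ = (1 / 2 : ℝ) • (P + 1) := by simp [hs]
  have h1 : ‖(J * e)ᵀ * (J * e)‖ ≤ η := by
    rw [norm_gram_eq_norm_outer, Matrix.transpose_mul, hJs, Matrix.mul_assoc]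
    refine (norm_proj_mul_le hJs hJi _).trans ?_
    rw [← Matrix.frobenius_norm_transpose, Matrix.transpose_mul, Matrix.transpose_mul, hJs,
      Matrix.transpose_transpose, Matrix.mul_assoc]
    exact (norm_proj_mul_le hJs hJi _).trans hee
  rw [Matrix.transpose_mul, hMs, ← Matrix.mul_assoc, Matrix.mul_assoc _ (J * e)ᵀ]
  exact (norm_mul_half_proj_le hs hi _).trans ((norm_half_proj_mul_le hs hi _).trans h1)

/-- The two halves occupy disjoint rows, J(1 - J) = 0, so the cross terms of the Gram matrix vanish.
This is a second reason to leave the outer product, where the cross terms survive. -/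
theorem norm_outer_split_le {T d : ℕ} {e : Matrix (Fin T) (Fin d) ℝ} {η : ℝ}
    (hee : ‖e * eᵀ‖ ≤ η) {J : Matrix (Fin T) (Fin T) ℝ} (hJs : Jᵀ = J) (hJi : J * J = J)
    {P₁ P₂ : Matrix (Fin d) (Fin d) ℝ} (hs₁ : P₁ᵀ = P₁) (hi₁ : P₁ * P₁ = P₁)
    (hs₂ : P₂ᵀ = P₂) (hi₂ : P₂ * P₂ = P₂) :
    ‖(J * e * ((1 / 2 : ℝ) • (P₁ + 1)) + (1 - J) * e * ((1 / 2 : ℝ) • (P₂ + 1))) *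
      (J * e * ((1 / 2 : ℝ) • (P₁ + 1)) + (1 - J) * e * ((1 / 2 : ℝ) • (P₂ + 1)))ᵀ‖ ≤ 2 * η := by
  have hJs' : (1 - J)ᵀ = 1 - J := by rw [Matrix.transpose_sub, hJs, Matrix.transpose_one]
  have hJi' : (1 - J) * (1 - J) = 1 - J := by simp [mul_sub, sub_mul, hJi]
  have hJJ : J * (1 - J) = 0 := by rw [mul_sub, mul_one, hJi, sub_self]
  have hJJ' : (1 - J) * J = 0 := by rw [sub_mul, one_mul, hJi, sub_self]
  have hcross : ∀ (J₁ J₂ : Matrix (Fin T) (Fin T) ℝ) (M M' : Matrix (Fin d) (Fin d) ℝ),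
      J₁ᵀ = J₁ → J₁ * J₂ = 0 → (J₁ * e * M)ᵀ * (J₂ * e * M') = 0 := by
    intro J₁ J₂ M M' h h0
    rw [Matrix.transpose_mul, Matrix.transpose_mul, h]
    have : Mᵀ * (eᵀ * J₁) * (J₂ * e * M') = Mᵀ * eᵀ * (J₁ * J₂) * e * M' := by
      simp only [Matrix.mul_assoc]
    rw [this, h0]
    simp
  have h1 := norm_gram_split_le hee hJs hJi hs₁ hi₁
  have h2 := norm_gram_split_le hee hJs' hJi' hs₂ hi₂
  rw [← norm_gram_eq_norm_outer, Matrix.transpose_add, Matrix.add_mul, Matrix.mul_add,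
    Matrix.mul_add, hcross _ _ _ _ hJs hJJ, hcross _ _ _ _ hJs' hJJ', add_zero, zero_add]
  exact (norm_add_le _ _).trans (by linarith)

/-- The bounds for the error terms after a transformation of the data with two projections. -/
theorem transformed_error_bounds {T d r : ℕ} {f : Matrix (Fin T) (Fin r) ℝ}
    {l : Matrix (Fin d) (Fin r) ℝ} {e : Matrix (Fin T) (Fin d) ℝ} {B η ζ : ℝ} (hB : 1 ≤ B)
    (hf : ‖f‖ ≤ B) (hl : ‖l‖ ≤ B) (he : ‖e‖ ≤ B) (hel : ‖e * l‖ ≤ η) (hee : ‖e * eᵀ‖ ≤ η)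
    (hζ1 : ζ ≤ 1) {J : Matrix (Fin T) (Fin T) ℝ} (hJs : Jᵀ = J) (hJi : J * J = J)
    {P₁ P₂ : Matrix (Fin d) (Fin d) ℝ} (hs₁ : P₁ᵀ = P₁) (hi₁ : P₁ * P₁ = P₁)
    (hs₂ : P₂ᵀ = P₂) (hi₂ : P₂ * P₂ = P₂) (h₁ : ‖(1 - P₁) * l‖ ≤ ζ) (h₂ : ‖(1 - P₂) * l‖ ≤ ζ)
    {E : Matrix (Fin T) (Fin d) ℝ}
    (hE : f * lᵀ + E = J * (f * lᵀ + e) * ((1 / 2 : ℝ) • (P₁ + 1)) +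
      (1 - J) * (f * lᵀ + e) * ((1 / 2 : ℝ) • (P₂ + 1))) :
    ‖E * l‖ ≤ 5 * B ^ 2 * (η + ζ) ∧ ‖E * Eᵀ‖ ≤ 5 * B ^ 2 * (η + ζ) := by
  have hη0 : 0 ≤ η := (norm_nonneg _).trans hee
  have hζ0 : 0 ≤ ζ := (norm_nonneg _).trans h₁
  have hJs' : (1 - J)ᵀ = 1 - J := by rw [Matrix.transpose_sub, hJs, Matrix.transpose_one]
  have hJi' : (1 - J) * (1 - J) = 1 - J := by simp [mul_sub, sub_mul, hJi]
  set M₁ := (1 / 2 : ℝ) • (P₁ + 1) with hM₁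
  set M₂ := (1 / 2 : ℝ) • (P₂ + 1) with hM₂
  have hMP : ∀ P : Matrix (Fin d) (Fin d) ℝ,
      (1 / 2 : ℝ) • (P + 1) = 1 - (1 / 2 : ℝ) • (1 - P) := fun P => by module
  have hMl : ∀ (P : Matrix (Fin d) (Fin d) ℝ), ‖(1 - P) * l‖ ≤ ζ →
      ‖((1 / 2 : ℝ) • (1 - P)) * l‖ ≤ ζ / 2 := by
    intro P hP
    rw [Matrix.smul_mul, norm_smul]
    norm_num
    linarith
  set N := J * e * M₁ + (1 - J) * e * M₂ with hN
  -- E splits into the signal lost because the projections do not fix l exactly, G = O(ζ), and the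
  -- transformed noise N, which is bounded with N l and N N' small. Every product in E l and E E'
  -- thus contains G or is one of these two.
  set G := -(J * (f * (((1 / 2 : ℝ) • (1 - P₁)) * l)ᵀ) +
    (1 - J) * (f * (((1 / 2 : ℝ) • (1 - P₂)) * l)ᵀ)) with hG
  have hEGN : E = G + N := by
    have h3 : ∀ (J : Matrix (Fin T) (Fin T) ℝ) (P : Matrix (Fin d) (Fin d) ℝ), Pᵀ = P →
        J * (f * lᵀ + e) * ((1 / 2 : ℝ) • (P + 1)) =
        J * (f * lᵀ) - J * (f * (((1 / 2 : ℝ) • (1 - P)) * l)ᵀ) +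
          J * e * ((1 / 2 : ℝ) • (P + 1)) := by
      intro J P hP
      rw [Matrix.mul_add, Matrix.add_mul, add_left_inj]
      have : ((1 / 2 : ℝ) • (1 - P))ᵀ = (1 / 2 : ℝ) • (1 - P) := by simp [hP]
      rw [hMP, Matrix.transpose_mul, this, Matrix.mul_sub, Matrix.mul_one]
      simp only [Matrix.mul_assoc]
    rw [h3 _ _ hs₁, h3 _ _ hs₂] at hE
    have h4 : f * lᵀ = J * (f * lᵀ) + (1 - J) * (f * lᵀ) := by
      rw [← Matrix.add_mul, add_sub_cancel, Matrix.one_mul]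
    rw [← add_right_inj (f * lᵀ), hE, hG, hN]
    conv_rhs => lhs; rw [h4]
    abel
  have hGn : ‖G‖ ≤ B * ζ := by
    rw [hG, norm_neg]
    refine (norm_add_le _ _).trans ?_
    have h3 := (norm_proj_mul_le hJs hJi (f * (((1 / 2 : ℝ) • (1 - P₁)) * l)ᵀ)).trans
      (norm_mul_le_of_le hf ((Matrix.frobenius_norm_transpose _).le.trans (hMl P₁ h₁)))
    have h4 := (norm_proj_mul_le hJs' hJi' (f * (((1 / 2 : ℝ) • (1 - P₂)) * l)ᵀ)).trans
      (norm_mul_le_of_le hf ((Matrix.frobenius_norm_transpose _).le.trans (hMl P₂ h₂)))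
    linarith
  have hNn : ‖N‖ ≤ 2 * B := by
    have h3 := (norm_mul_half_proj_le hs₁ hi₁ (J * e)).trans (norm_proj_mul_le hJs hJi e)
    have h4 := (norm_mul_half_proj_le hs₂ hi₂ ((1 - J) * e)).trans (norm_proj_mul_le hJs' hJi' e)
    have h5 := norm_add_le (J * e * M₁) ((1 - J) * e * M₂)
    linarith
  have hNl : ‖N * l‖ ≤ 2 * η + B * ζ := by
    have h3 : ∀ J : Matrix (Fin T) (Fin T) ℝ, Jᵀ = J → J * J = J →
        ∀ P : Matrix (Fin d) (Fin d) ℝ, ‖(1 - P) * l‖ ≤ ζ →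
        ‖J * e * ((1 / 2 : ℝ) • (P + 1)) * l‖ ≤ η + B * (ζ / 2) := by
      intro J hs hi P hP
      rw [Matrix.mul_assoc, Matrix.mul_assoc, hMP, Matrix.sub_mul, Matrix.one_mul, Matrix.mul_sub]
      refine (norm_proj_mul_le hs hi _).trans ((norm_sub_le _ _).trans ?_)
      exact add_le_add hel (norm_mul_le_of_le he (hMl P hP))
    rw [hN, Matrix.add_mul]
    refine (norm_add_le _ _).trans ((add_le_add (h3 J hJs hJi P₁ h₁)
      (h3 (1 - J) hJs' hJi' P₂ h₂)).trans (le_of_eq (by ring)))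
  have hNN : ‖N * Nᵀ‖ ≤ 2 * η := norm_outer_split_le hee hJs hJi hs₁ hi₁ hs₂ hi₂
  have hB2 : B ≤ B ^ 2 := by nlinarith
  constructor
  · rw [hEGN, Matrix.add_mul]
    refine (norm_add_le _ _).trans ((add_le_add (norm_mul_le_of_le hGn hl) hNl).trans ?_)
    nlinarith [mul_nonneg hζ0 (sub_nonneg.mpr hB2), mul_nonneg hη0 (sub_nonneg.mpr (hB.trans hB2))]
  · have h6 : E * Eᵀ = G * Gᵀ + G * Nᵀ + (N * Gᵀ + N * Nᵀ) := by
      rw [hEGN, Matrix.transpose_add, Matrix.add_mul, Matrix.mul_add, Matrix.mul_add]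
    have hGt : ‖Gᵀ‖ ≤ B * ζ := (Matrix.frobenius_norm_transpose _).le.trans hGn
    have hNt : ‖Nᵀ‖ ≤ 2 * B := (Matrix.frobenius_norm_transpose _).le.trans hNn
    rw [h6]
    refine (norm_add_le _ _).trans ((add_le_add ((norm_add_le _ _).trans (add_le_add
      (norm_mul_le_of_le hGn hGt) (norm_mul_le_of_le hGn hNt))) ((norm_add_le _ _).trans (add_le_add
      (norm_mul_le_of_le hNn hGt) hNN))).trans ?_)
    have h7 : ζ * ζ ≤ ζ := by nlinarith
    nlinarith [mul_le_mul_of_nonneg_left h7 (sq_nonneg B),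
      mul_nonneg hη0 (sub_nonneg.mpr (hB.trans hB2))]

end

section

open scoped Matrix.Norms.Frobenius Matrix

/-! ### Identification of the factors -/

theorem exists_sq_ge_of_sum_ge {r : ℕ} (hr : 0 < r) {a : Fin r → ℝ} (h : 1 / 2 ≤ ∑ i, a i ^ 2) :
    ∃ i, 1 / (2 * r : ℝ) ≤ |a i| := by
  by_contra! hlt
  have hr' : (1 : ℝ) ≤ r := by exact_mod_cast hr
  have : Nonempty (Fin r) := ⟨⟨0, hr⟩⟩
  have h1 : ∑ i, a i ^ 2 < ∑ _i : Fin r, (1 / (2 * r : ℝ)) ^ 2 := by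
    refine Finset.sum_lt_sum_of_nonempty Finset.univ_nonempty fun i _ => ?_
    rw [← sq_abs]
    exact pow_lt_pow_left₀ (hlt i) (abs_nonneg _) two_ne_zero
  have h2 : ∑ _i : Fin r, (1 / (2 * r : ℝ)) ^ 2 = 1 / (4 * r : ℝ) := by
    rw [Finset.sum_const, Finset.card_univ, Fintype.card_fin, nsmul_eq_mul]
    field_simp; norm_num
  have h3 : 1 / (4 * r : ℝ) ≤ 1 / 4 := by
    apply one_div_le_one_div_of_le <;> linarith
  linarith

/-- An almost orthogonal matrix that almost intertwines two diagonal matrices with decreasing and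
well separated entries is almost diagonal, with diagonal entries close to `±1`. -/
theorem almost_diagonal {r : ℕ} {K : Matrix (Fin r) (Fin r) ℝ} {v p π : Fin r → ℝ} {g θ : ℝ}
    (hg : 0 < g) (hgap : ∀ i j, i < j → π j + g ≤ π i) (hp : ∀ i, |p i - π i| ≤ g / 8)
    (hv : Antitone v) (h1 : ‖Kᵀ * K - 1‖ ≤ θ)
    (h2 : ‖K * Matrix.diagonal v - Matrix.diagonal p * K‖ ≤ θ)
    (hθ1 : θ ≤ 1 / 2) (hθ2 : 2 * r * θ ≤ g / 8) (hθ3 : 2 * θ / g ≤ 1)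
    (hθ4 : 4 * r ^ 2 * (θ + r * (2 * θ / g)) < 1) :
    (∀ i j, i ≠ j → |K i j| ≤ 2 * θ / g) ∧
      ∀ j, |K j j ^ 2 - 1| ≤ θ + r * (2 * θ / g) := by
  rcases Nat.eq_zero_or_pos r with rfl | hr
  · exact ⟨fun i => i.elim0, fun i => i.elim0⟩
  have hr' : (1 : ℝ) ≤ r := by exact_mod_cast hr
  have hθ0 : 0 ≤ θ := (norm_nonneg _).trans h1
  have hKK : ∀ j k, |∑ i, K i j * K i k - (1 : Matrix (Fin r) (Fin r) ℝ) j k| ≤ θ := by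
    intro j k
    have := (abs_entry_le_norm _ j k).trans h1
    simpa [Matrix.mul_apply] using this
  have hKV : ∀ i j, |K i j| * |v j - p i| ≤ θ := by
    intro i j
    have := (abs_entry_le_norm _ i j).trans h2
    rw [Matrix.sub_apply, Matrix.mul_diagonal, Matrix.diagonal_mul] at this
    rw [← abs_mul]
    have h3 : K i j * (v j - p i) = K i j * v j - p i * K i j := by ring
    rwa [h3]
  -- Column j of K has squared norm at least 1/2, so it has a dominant entry, in row σ j. The proof
  -- shows that σ is the identity.
  have hcol : ∀ j, ∃ i, 1 / (2 * r : ℝ) ≤ |K i j| := by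
    intro j
    refine exists_sq_ge_of_sum_ge (a := fun i => K i j) hr ?_
    have := abs_le.mp (hKK j j)
    simp only [Matrix.one_apply_eq, ← sq] at this
    linarith
  choose σ hσ using hcol
  -- An entry bounded below makes the intertwining relation force v j close to p (σ j).
  have hvσ : ∀ j, |v j - p (σ j)| ≤ g / 8 := by
    intro j
    refine le_trans ?_ hθ2
    have h3 := (mul_le_mul_of_nonneg_right (hσ j) (abs_nonneg (v j - p (σ j)))).trans (hKV (σ j) j)
    rw [div_mul_eq_mul_div, div_le_iff₀ (by positivity)] at h3
    linarith
  have hvπ : ∀ j, |v j - π (σ j)| ≤ g / 4 := by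
    intro j
    have h3 := abs_le.mp (hvσ j)
    have h4 := abs_le.mp (hp (σ j))
    exact abs_le.mpr ⟨by linarith, by linarith⟩
  -- Now v j is within g/4 of π (σ j), hence at least g - g/4 - g/8 ≥ g/2 away from every other p i,
  -- and the same relation makes the other entries of the column small.
  have hoff : ∀ i j, i ≠ σ j → |K i j| ≤ 2 * θ / g := by
    intro i j hij
    have h3 : g / 2 ≤ |v j - p i| := by
      have h4 := abs_le.mp (hvπ j)
      have h5 := abs_le.mp (hp i)
      rcases lt_or_gt_of_ne hij with h6 | h6
      · have := hgap _ _ h6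
        exact le_trans (by linarith) (neg_le_abs _)
      · have := hgap _ _ h6
        exact le_trans (by linarith) (le_abs_self _)
    have h4 := (mul_le_mul_of_nonneg_left h3 (abs_nonneg (K i j))).trans (hKV i j)
    rw [le_div_iff₀ hg]
    linarith
  -- Two columns with the same dominant row would have an inner product of at least 1/(4r²) up to
  -- the small entries, against near orthogonality; `hθ4` makes this impossible.
  have hinj : Function.Injective σ := by
    intro j k hjk
    by_contra hne
    have h3 := hKK j k
    rw [Matrix.one_apply_ne hne, sub_zero, ← Finset.add_sum_erase _ _ (Finset.mem_univ (σ j))] at h3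
    have h4 : |∑ i ∈ Finset.univ.erase (σ j), K i j * K i k| ≤ r * (2 * θ / g) := by
      refine (Finset.abs_sum_le_sum_abs _ _).trans ?_
      calc ∑ i ∈ Finset.univ.erase (σ j), |K i j * K i k|
          ≤ ∑ _i ∈ Finset.univ.erase (σ j), 2 * θ / g := by
            refine Finset.sum_le_sum fun i hi => ?_
            have hi' := Finset.ne_of_mem_erase hi
            rw [abs_mul]
            calc |K i j| * |K i k| ≤ (2 * θ / g) * 1 :=
                  mul_le_mul (hoff i j hi') ((hoff i k (hjk ▸ hi')).trans hθ3) (abs_nonneg _)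
                    (by positivity)
              _ = _ := mul_one _
        _ ≤ ∑ _i : Fin r, 2 * θ / g :=
            Finset.sum_le_sum_of_subset_of_nonneg (Finset.erase_subset _ _)
              fun _ _ _ => by positivity
        _ = _ := by simp
    have h5 : 1 / (4 * r ^ 2 : ℝ) ≤ |K (σ j) j * K (σ j) k| := by
      rw [abs_mul]
      have h6 := hσ k
      rw [← hjk] at h6
      calc 1 / (4 * r ^ 2 : ℝ) = 1 / (2 * r) * (1 / (2 * r)) := by field_simp; norm_num
        _ ≤ _ := mul_le_mul (hσ j) h6 (by positivity) (abs_nonneg _)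
    have h6 := abs_sub_abs_le_abs_sub (K (σ j) j * K (σ j) k)
      (-∑ i ∈ Finset.univ.erase (σ j), K i j * K i k)
    rw [abs_neg, sub_neg_eq_add] at h6
    rw [div_le_iff₀ (by positivity)] at h5
    have h7 : |K (σ j) j * K (σ j) k| ≤ θ + r * (2 * θ / g) := by linarith
    have h8 := mul_le_mul_of_nonneg_left h7 (by positivity : 0 ≤ 4 * (r : ℝ) ^ 2)
    linarith
  -- Both v and π decrease, and v j is within g/4 of π (σ j), so σ cannot reverse an order. A
  -- strictly monotone self-map of `Fin r` is the identity.
  have hmono : StrictMono σ := by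
    intro j k hjk
    refine lt_of_le_of_ne ?_ fun h => hjk.ne (hinj h)
    by_contra! hlt
    have h3 := hgap _ _ hlt
    have h4 := abs_le.mp (hvπ j)
    have h5 := abs_le.mp (hvπ k)
    have h6 := hv hjk.le
    linarith
  have hid : σ = id := hmono.eq_id
  simp only [hid, id] at hoff
  refine ⟨hoff, fun j => ?_⟩
  have h3 := hKK j j
  rw [Matrix.one_apply_eq, ← Finset.add_sum_erase _ _ (Finset.mem_univ j)] at h3
  have h4 : |∑ i ∈ Finset.univ.erase j, K i j * K i j| ≤ r * (2 * θ / g) := by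
    refine (Finset.abs_sum_le_sum_abs _ _).trans ?_
    calc ∑ i ∈ Finset.univ.erase j, |K i j * K i j|
        ≤ ∑ _i ∈ Finset.univ.erase j, 2 * θ / g := by
          refine Finset.sum_le_sum fun i hi => ?_
          have hi' := Finset.ne_of_mem_erase hi
          rw [abs_mul]
          calc |K i j| * |K i j| ≤ (2 * θ / g) * 1 :=
                mul_le_mul (hoff i j hi') ((hoff i j hi').trans hθ3) (abs_nonneg _)
                  (by positivity)
            _ = _ := mul_one _
      _ ≤ ∑ _i : Fin r, 2 * θ / g :=
          Finset.sum_le_sum_of_subset_of_nonneg (Finset.erase_subset _ _)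
            fun _ _ _ => by positivity
      _ = _ := by simp
  have h5 := abs_le.mp h3
  have h6 := abs_le.mp h4
  rw [sq]
  exact abs_le.mpr ⟨by linarith, by linarith⟩

/-- For k ≥ 0, |k - 1| ≤ |k - 1|(k + 1) = |k² - 1|, so diagonal entries with square near 1 are
themselves near 1. -/
theorem norm_sub_one_le {r : ℕ} {K : Matrix (Fin r) (Fin r) ℝ} {θ a : ℝ} (hθ : 0 ≤ θ)
    (ha : 0 ≤ a) (hoff : ∀ i j, i ≠ j → |K i j| ≤ a) (hdiag : ∀ j, |K j j ^ 2 - 1| ≤ θ + r * a)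
    (hpos : ∀ j, 0 ≤ K j j) : ‖K - 1‖ ≤ r * (θ + (r + 1) * a) := by
  have hr0 : (0 : ℝ) ≤ r := r.cast_nonneg
  refine norm_le_of_abs_entry_le (by positivity) fun i j => ?_
  rcases eq_or_ne i j with rfl | hij
  · rw [Matrix.sub_apply, Matrix.one_apply_eq]
    have h3 := hdiag i
    have h4 : K i i ^ 2 - 1 = (K i i - 1) * (K i i + 1) := by ring
    have h5 := hpos i
    rw [h4, abs_mul, abs_of_nonneg (by linarith : 0 ≤ K i i + 1)] at h3
    have h6 : |K i i - 1| ≤ |K i i - 1| * (K i i + 1) :=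
      le_mul_of_one_le_right (abs_nonneg _) (by linarith)
    linarith
  · rw [Matrix.sub_apply, Matrix.one_apply_ne hij, sub_zero]
    have := hoff i j hij
    nlinarith [mul_nonneg hr0 ha]

/-- A negative k would be at most -3/4, making (k + θ)p + θ at most -(5/8)(g/2) + g/8 < 0. With p a
diagonal entry of l'l, this transfers the sign convention for the loadings to the diagonal of K. -/
theorem nonneg_of_abs_sq_sub_one_le {k p θ g : ℝ} (hk : |k ^ 2 - 1| ≤ 1 / 4)
    (h : 0 ≤ (k + θ) * p + θ) (hp : g / 2 ≤ p) (hg : 0 < g) (hθ : θ ≤ 1 / 8) (hθg : θ ≤ g / 8) :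
    0 ≤ k := by
  by_contra! hneg
  have h1 := (abs_le.mp hk).1
  have h2 : k ≤ -(3 / 4) := by
    by_contra! hlt
    nlinarith
  have h3 : (k + θ) * p ≤ -(5 / 8) * p := mul_le_mul_of_nonneg_right (by linarith) (by linarith)
  linarith

/-- Under the identification of the factors, the leading eigenvectors are close to the factors. -/
theorem FactorBounds.norm_sub_factor_le {T d r : ℕ} {f : Matrix (Fin T) (Fin r) ℝ}
    {l : Matrix (Fin d) (Fin r) ℝ} {e : Matrix (Fin T) (Fin d) ℝ} {B c η : ℝ}
    (h : FactorBounds f l e B c η) {Q : Matrix (Fin T) (Fin r) ℝ} {v : Fin r → ℝ}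
    (hQ : IsLeadingPair (f * lᵀ + e) Q v) {K : Matrix (Fin r) (Fin r) ℝ}
    {W : Matrix (Fin T) (Fin r) ℝ} {C : ℝ} (hC : 1 ≤ C) (hdec : Q = f * K + W) (hK : ‖K‖ ≤ C)
    (hW : ‖W‖ ≤ C * η)
    (hKv : K * Matrix.diagonal v = lᵀ * l * (fᵀ * Q) + (e * l)ᵀ * Q)
    (hff : ‖fᵀ * f - 1‖ ≤ η) {p π : Fin r → ℝ} (hll : lᵀ * l = Matrix.diagonal p) {g θ : ℝ}
    (hθ : θ = 3 * B ^ 3 * C ^ 2 * η)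
    (hg : 0 < g) (hgap : ∀ i j, i < j → π j + g ≤ π i) (hp : ∀ i, |p i - π i| ≤ g / 8)
    (hpg : ∀ i, g / 2 ≤ p i)
    (hθ1 : θ ≤ 1 / 8) (hθ2 : 2 * r * θ ≤ g / 8) (hθ3 : 8 * θ / g ≤ 1)
    (hθ4 : 4 * r ^ 2 * (θ + r * (2 * θ / g)) < 1) (hθ5 : θ + r * (2 * θ / g) ≤ 1 / 4)
    (hsign : ∀ j, 0 ≤ (((f * lᵀ + e)ᵀ * Q)ᵀ * l) j j) :
    ‖Q - f‖ ≤ B * (r * (θ + (r + 1) * (2 * θ / g))) + C * η := by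
  have hB := h.one_le
  have hη0 := h.nonneg
  have hQn : ‖Q‖ ≤ B := (norm_le_of_orthonormal hQ.orthonormal).trans h.dim_le
  have hft : ‖fᵀ‖ ≤ B := (Matrix.frobenius_norm_transpose _).le.trans h.factor_le
  have hKt : ‖Kᵀ‖ ≤ C := (Matrix.frobenius_norm_transpose _).le.trans hK
  have hWt : ‖Wᵀ‖ ≤ C * η := (Matrix.frobenius_norm_transpose _).le.trans hW
  have hel : ‖(e * l)ᵀ‖ ≤ η := (Matrix.frobenius_norm_transpose _).le.trans h.error_loading
  have hθ0 : 0 ≤ θ := by rw [hθ]; positivity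
  have hBC : 1 ≤ B * C := by nlinarith
  have hfQ : ‖fᵀ * Q - K‖ ≤ 2 * B * C * η := by
    have h1 : fᵀ * Q - K = (fᵀ * f - 1) * K + fᵀ * W := by
      rw [hdec, Matrix.mul_add, Matrix.sub_mul, Matrix.one_mul, Matrix.mul_assoc]
      abel
    rw [h1]
    refine (norm_add_le _ _).trans ((add_le_add (norm_mul_le_of_le hff hK)
      (norm_mul_le_of_le hft hW)).trans ?_)
    have : 0 ≤ C * η := by positivity
    nlinarith
  have hB13 : B ≤ B ^ 3 := by
    calc B = B ^ 1 := (pow_one B).symm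
      _ ≤ B ^ 3 := pow_le_pow_right₀ hB (by norm_num)
  have hC12 : C ≤ C ^ 2 := by nlinarith
  have hθfQ : ‖fᵀ * Q - K‖ ≤ θ := by
    refine hfQ.trans ?_
    rw [hθ]
    have : B * C ≤ B ^ 3 * C ^ 2 := by gcongr
    nlinarith [mul_le_mul_of_nonneg_right this hη0, mul_nonneg (mul_nonneg (zero_le_one.trans hB)
      (zero_le_one.trans hC)) hη0]
  -- Orthonormality of Q reads 1 = K'(f'Q) + W'Q, and f'Q is close to K because f'f is close to 1.
  have h1 : ‖Kᵀ * K - 1‖ ≤ θ := by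
    have h2 : Kᵀ * K - 1 = -(Kᵀ * (fᵀ * Q - K) + Wᵀ * Q) := by
      have : (1 : Matrix (Fin r) (Fin r) ℝ) = Kᵀ * (fᵀ * Q) + Wᵀ * Q := by
        rw [← hQ.orthonormal]
        conv_lhs => lhs; rw [hdec]
        rw [Matrix.transpose_add, Matrix.transpose_mul, Matrix.add_mul, Matrix.mul_assoc]
      conv_lhs => rw [this]
      rw [Matrix.mul_sub]
      abel
    rw [h2, norm_neg]
    refine (norm_add_le _ _).trans ((add_le_add (norm_mul_le_of_le hKt hfQ)
      (norm_mul_le_of_le hWt hQn)).trans ?_)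
    rw [hθ]
    calc C * (2 * B * C * η) + C * η * B = 2 * (B * C ^ 2 * η) + B * C * η := by ring
      _ ≤ 2 * (B ^ 3 * C ^ 2 * η) + B ^ 3 * C ^ 2 * η := by gcongr
      _ = _ := by ring
  -- As l'l = diag p, replacing f'Q by K in the formula for K V yields the approximate intertwining.
  have h2 : ‖K * Matrix.diagonal v - Matrix.diagonal p * K‖ ≤ θ := by
    have h3 : K * Matrix.diagonal v - Matrix.diagonal p * K =
        lᵀ * l * (fᵀ * Q - K) + (e * l)ᵀ * Q := by
      rw [hKv, ← hll, Matrix.mul_sub]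
      abel
    have hl : ‖lᵀ * l‖ ≤ B * B :=
      norm_mul_le_of_le ((Matrix.frobenius_norm_transpose _).le.trans h.loading_le) h.loading_le
    rw [h3]
    refine (norm_add_le _ _).trans ((add_le_add (norm_mul_le_of_le hl hfQ)
      (norm_mul_le_of_le hel hQn)).trans ?_)
    rw [hθ]
    calc B * B * (2 * B * C * η) + η * B = 2 * (B ^ 3 * C * η) + B * 1 * η := by ring
      _ ≤ 2 * (B ^ 3 * C ^ 2 * η) + B ^ 3 * C ^ 2 * η := by
          have : 1 ≤ C ^ 2 := hC.trans hC12
          gcongr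
      _ = _ := by ring
  obtain ⟨hoff, hdiag⟩ := almost_diagonal hg hgap hp hQ.antitone h1 h2 (by linarith) hθ2
    (le_trans (by gcongr; norm_num) hθ3) hθ4
  have hpos : ∀ j, 0 ≤ K j j := by
    intro j
    have h3 := hsign j
    have h4 : ((f * lᵀ + e)ᵀ * Q)ᵀ * l = (fᵀ * Q)ᵀ * Matrix.diagonal p + ((e * l)ᵀ * Q)ᵀ := by
      rw [← hll]
      simp only [Matrix.transpose_add, Matrix.transpose_mul, Matrix.transpose_transpose,
        Matrix.add_mul, Matrix.mul_assoc]
    rw [h4, Matrix.add_apply, Matrix.mul_diagonal, Matrix.transpose_apply,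
      Matrix.transpose_apply] at h3
    have h5 := (abs_le.mp ((abs_entry_le_norm _ j j).trans hθfQ)).2
    rw [Matrix.sub_apply] at h5
    have h6 := (abs_le.mp ((abs_entry_le_norm ((e * l)ᵀ * Q) j j).trans
      (norm_mul_le_of_le hel hQn))).2
    have h7 : η * B ≤ θ := by
      rw [hθ]
      calc η * B = B * 1 * η := by ring
        _ ≤ B ^ 3 * C ^ 2 * η := by
            have : 1 ≤ C ^ 2 := hC.trans hC12
            gcongr
        _ ≤ 3 * B ^ 3 * C ^ 2 * η := by nlinarith [show 0 ≤ B ^ 3 * C ^ 2 * η by positivity]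
    have hpj := hpg j
    have h8 : (fᵀ * Q) j j * p j ≤ (K j j + θ) * p j :=
      mul_le_mul_of_nonneg_right (by linarith) (by linarith)
    have h12 : θ ≤ g / 8 := by
      rw [div_le_one hg] at hθ3; linarith
    exact nonneg_of_abs_sq_sub_one_le ((hdiag j).trans hθ5) (by linarith) hpj hg hθ1 h12
  have hK1 : ‖K - 1‖ ≤ r * (θ + (r + 1) * (2 * θ / g)) :=
    norm_sub_one_le hθ0 (by positivity) hoff hdiag hpos
  have h3 : Q - f = f * (K - 1) + W := by
    conv_lhs => rw [hdec]
    rw [Matrix.mul_sub, Matrix.mul_one]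
    abel
  rw [h3]
  exact (norm_add_le _ _).trans (add_le_add (norm_mul_le_of_le h.factor_le hK1) hW)

end

/-! ### The deterministic bound for the transformed series. -/

section

open scoped Matrix.Norms.Frobenius Matrix Topology

theorem eventually_mul_lt (a : ℝ) {b : ℝ} (hb : 0 < b) : ∀ᶠ η in 𝓝 (0 : ℝ), a * η < b := by
  have h : Tendsto (fun η : ℝ => a * η) (𝓝 0) (𝓝 0) := by
    simpa using (continuous_const_mul a).tendsto 0
  exact h.eventually_lt_const hb

/-- The bound for the estimated factors of the transformed series, for data that are scaled to
have factors and loadings of order one. -/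
theorem exists_bound_transformed (r : ℕ) {B c g : ℝ} (hB : 1 ≤ B) (hc : 0 < c) (hg : 0 < g) :
    ∃ C η₀ : ℝ, 0 ≤ C ∧ 0 < η₀ ∧ ∀ (T d : ℕ) (f₁ f₂ : Matrix (Fin T) (Fin r) ℝ)
      (l₁ l₂ : Matrix (Fin d) (Fin r) ℝ) (e₁ e₂ : Matrix (Fin T) (Fin d) ℝ)
      (S : Matrix (Fin r) (Fin r) ℝ) (Q₁ Q₂ Q : Matrix (Fin T) (Fin r) ℝ) (v₁ v₂ v p π : Fin r → ℝ)
      (J : Matrix (Fin T) (Fin T) ℝ) (η : ℝ), η ≤ η₀ →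
      FactorBounds f₁ l₁ e₁ B c η → ‖e₁‖ ≤ B → ‖e₁ᵀ * f₁‖ ≤ η →
      FactorBounds f₂ l₂ e₂ B c η → ‖e₂‖ ≤ B → ‖e₂ᵀ * f₂‖ ≤ η →
      l₂ = l₁ * S → ‖S‖ ≤ B →
      IsLeadingPair (f₁ * l₁ᵀ + e₁) Q₁ v₁ → IsLeadingPair (f₂ * l₂ᵀ + e₂) Q₂ v₂ →
      ‖f₂ᵀ * f₂ - 1‖ ≤ η → l₂ᵀ * l₂ = Matrix.diagonal p →
      (∀ i j, i < j → π j + g ≤ π i) → (∀ i, |p i - π i| ≤ g / 8) → (∀ i, g / 2 ≤ p i) →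
      Jᵀ = J → J * J = J →
      ∀ y, y = J * (f₂ * l₂ᵀ + e₂) *
          ((1 / 2 : ℝ) • (colProj ((f₁ * l₁ᵀ + e₁)ᵀ * Q₁) + 1)) +
        (1 - J) * (f₂ * l₂ᵀ + e₂) *
          ((1 / 2 : ℝ) • (colProj ((f₂ * l₂ᵀ + e₂)ᵀ * Q₂) + 1)) →
      IsLeadingPair y Q v → (∀ j, 0 ≤ ((yᵀ * Q)ᵀ * l₂) j j) →
      ‖Q - f₂‖ ≤ C * η := by
  set c' := (c ^ 3 / (2 * B)) ^ 2 with hc'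
  have hc'0 : 0 < c' := by positivity
  set D := max 1 (2 * B ^ 5 / c') with hD
  have hD1 : 1 ≤ D := le_max_left _ _
  -- The projections move the loadings l₂ by at most ζ = 4B³D²η, and 5B²(η + ζ) = Aη bounds the
  -- errors of the transformed series. With Aη in place of η, the θ of
  -- `FactorBounds.norm_sub_factor_le` is A'η.
  set A := 5 * B ^ 2 * (1 + 4 * B ^ 3 * D ^ 2) with hA
  have hA0 : 0 ≤ A := by positivity
  set A' := 3 * B ^ 3 * D ^ 2 * A with hA'
  -- Every smallness condition of the preceding lemmas is a linear function of η against a positive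
  -- constant, so all of them hold near zero at once.
  have hev := ((((((((((eventually_mul_lt 1 (show 0 < c ^ 3 / 2 by positivity)).and
    (eventually_mul_lt 1 one_pos)).and
    (eventually_mul_lt (2 * B * D) one_pos)).and
    (eventually_mul_lt (4 * B ^ 3 * D ^ 2) one_pos)).and
    (eventually_mul_lt A (show 0 < c ^ 3 / 2 by positivity))).and
    (eventually_mul_lt A one_pos)).and
    (eventually_mul_lt A' (show (0 : ℝ) < 1 / 8 by norm_num))).and
    (eventually_mul_lt (2 * r * A') (show 0 < g / 8 by positivity))).and
    (eventually_mul_lt (8 * A' / g) one_pos)).and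
    (eventually_mul_lt (4 * r ^ 2 * (A' + r * (2 * A' / g))) one_pos)).and
    (eventually_mul_lt (A' + r * (2 * A' / g)) (show (0 : ℝ) < 1 / 4 by norm_num))
  obtain ⟨δ, hδ, hev⟩ := Metric.eventually_nhds_iff.mp hev
  refine ⟨B * (r * (A' + (r + 1) * (2 * A' / g))) + D * A, δ / 2, by positivity, by positivity, ?_⟩
  intro T d f₁ f₂ l₁ l₂ e₁ e₂ S Q₁ Q₂ Q v₁ v₂ v p π J η hη h₁ he₁ hef₁ h₂ he₂ hef₂ hS hSB hQ₁ hQ₂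
    hff hll hgap hp hpg hJs hJi y hy hQ hsign
  have hη0 := h₁.nonneg
  obtain ⟨⟨⟨⟨⟨⟨⟨⟨⟨⟨s1, s2⟩, s3⟩, s4⟩, s5⟩, s6⟩, s7⟩, s8⟩, s9⟩, s10⟩, s11⟩ := hev (y := η) (by
    rw [Real.dist_eq, sub_zero, abs_of_nonneg hη0]; linarith)
  rw [one_mul] at s1 s2
  have hDle : 2 * B ^ 5 / c' ≤ D := le_max_right _ _
  have hv₁ : ∀ j, c' ≤ v₁ j := fun j => h₁.le_eigenvalue s1.le hQ₁ j
  have hv₂ : ∀ j, c' ≤ v₂ j := fun j => h₂.le_eigenvalue s1.le hQ₂ j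
  obtain ⟨K₁, W₁, hd₁, hK₁, hW₁, -⟩ := h₁.exists_decomposition s2.le hc'0 hQ₁ hv₁
  obtain ⟨K₂, W₂, hd₂, hK₂, hW₂, -⟩ := h₂.exists_decomposition s2.le hc'0 hQ₂ hv₂
  have hp₁ := h₁.norm_compl_colProj_mul_le he₁ hef₁ hQ₁ (fun j => hc'0.trans_le (hv₁ j)) hD1 hd₁
    (hK₁.trans hDle) (hW₁.trans (by gcongr)) s3.le
  have hp₂ := h₂.norm_compl_colProj_mul_le he₂ hef₂ hQ₂ (fun j => hc'0.trans_le (hv₂ j)) hD1 hd₂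
    (hK₂.trans hDle) (hW₂.trans (by gcongr)) s3.le
  -- The null hypothesis enters here: since l₂ = l₁ S, the projection estimated from the first
  -- series also almost fixes the loadings of the second.
  have hζ₁ : ‖(1 - colProj ((f₁ * l₁ᵀ + e₁)ᵀ * Q₁)) * l₂‖ ≤ 4 * B ^ 3 * D ^ 2 * η := by
    rw [hS, ← Matrix.mul_assoc]
    exact (norm_mul_le_of_le hp₁ hSB).trans (le_of_eq (by ring))
  have hζ₂ : ‖(1 - colProj ((f₂ * l₂ᵀ + e₂)ᵀ * Q₂)) * l₂‖ ≤ 4 * B ^ 3 * D ^ 2 * η := by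
    refine hp₂.trans ?_
    have : B ^ 2 ≤ B ^ 3 := pow_le_pow_right₀ hB (by norm_num)
    gcongr
  have hu₁ := hQ₁.isUnit_gram_loading (fun j => hc'0.trans_le (hv₁ j))
  have hu₂ := hQ₂.isUnit_gram_loading (fun j => hc'0.trans_le (hv₂ j))
  obtain ⟨E, hE⟩ : ∃ E, f₂ * l₂ᵀ + E = y := ⟨y - f₂ * l₂ᵀ, by abel⟩
  obtain ⟨hEl, hEE⟩ := transformed_error_bounds hB h₂.factor_le h₂.loading_le he₂ h₂.error_loading
    h₂.error_outer s4.le hJs hJi (colProj_transpose _) (colProj_idempotent hu₁)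
    (colProj_transpose _) (colProj_idempotent hu₂) hζ₁ hζ₂ (hE.trans hy)
  have hAη : 5 * B ^ 2 * (η + 4 * B ^ 3 * D ^ 2 * η) = A * η := by rw [hA]; ring
  rw [hAη] at hEl hEE
  have h : FactorBounds f₂ l₂ E B c (A * η) :=
    { h₂ with error_loading := hEl, error_outer := hEE }
  rw [← hE] at hQ hsign
  obtain ⟨K, W, hd, hK, hW, hKv⟩ := h.exists_decomposition s6.le hc'0 hQ
    (fun j => h.le_eigenvalue s5.le hQ j)
  have hA1 : η ≤ A * η := by
    refine le_mul_of_one_le_left hη0 ?_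
    rw [hA]
    have h1 : 1 ≤ B ^ 2 := one_le_pow₀ hB
    have h2 : 0 ≤ 4 * B ^ 3 * D ^ 2 := by positivity
    nlinarith
  have hfin := h.norm_sub_factor_le hQ hD1 hd (hK.trans hDle) (hW.trans (by gcongr)) hKv
    (hff.trans hA1) hll (θ := A' * η) (by rw [hA']; ring) hg hgap hp hpg s7.le
    (by linarith) (le_trans (le_of_eq (by ring)) s9.le)
    (lt_of_le_of_lt (le_of_eq (by ring)) s10) (le_trans (le_of_eq (by ring)) s11.le) hsign
  exact hfin.trans (le_of_eq (by ring))

end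

section

open scoped Matrix.Norms.Frobenius Matrix Topology

/-! ### Loadings and scaled samples -/

theorem exists_pos_forall_le {ι : Type*} [Finite ι] {a : ι → ℝ} (h : ∀ i, 0 < a i) :
    ∃ g, 0 < g ∧ ∀ i, g ≤ a i := by
  rcases isEmpty_or_nonempty ι with hι | hι
  · exact ⟨1, one_pos, fun i => (hι.false i).elim⟩
  · obtain ⟨i, hi⟩ := Finite.exists_min a
    exact ⟨a i, h i, hi⟩

theorem trace_quadratic {r k : ℕ} {A U : Matrix (Fin r) (Fin r) ℝ} {D : Fin r → ℝ}
    (hA : A = U * Matrix.diagonal D * Uᵀ) (u : Matrix (Fin r) (Fin k) ℝ) :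
    (uᵀ * A * u).trace = ∑ i, ∑ j, D i * (Uᵀ * u) i j ^ 2 := by
  have h : uᵀ * A * u = (Uᵀ * u)ᵀ * (Matrix.diagonal D * (Uᵀ * u)) := by
    rw [hA, Matrix.transpose_mul, Matrix.transpose_transpose]
    simp only [Matrix.mul_assoc]
  rw [h, Finset.sum_comm, Matrix.trace]
  refine Finset.sum_congr rfl fun j _ => ?_
  rw [Matrix.diag_apply, Matrix.mul_apply]
  refine Finset.sum_congr rfl fun i _ => ?_
  rw [Matrix.transpose_apply, Matrix.diagonal_mul]
  ring

theorem le_trace_quadratic {r k : ℕ} {A U : Matrix (Fin r) (Fin r) ℝ} {D : Fin r → ℝ}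
    (hU : Uᵀ * U = 1) (hA : A = U * Matrix.diagonal D * Uᵀ) {γ : ℝ} (hγ : ∀ i, γ ≤ D i)
    (u : Matrix (Fin r) (Fin k) ℝ) : γ * ‖u‖ ^ 2 ≤ (uᵀ * A * u).trace := by
  have hU' : (Uᵀ)ᵀ * Uᵀ = 1 := by
    rw [Matrix.transpose_transpose]; exact mul_eq_one_comm.mp hU
  rw [trace_quadratic hA, ← norm_mul_of_orthonormal hU', ← frobSq_eq_norm_sq, frobSq,
    Finset.mul_sum]
  refine Finset.sum_le_sum fun i _ => ?_
  rw [Finset.mul_sum]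
  exact Finset.sum_le_sum fun j _ => mul_le_mul_of_nonneg_right (hγ i) (sq_nonneg _)

theorem exists_pos_le_trace_quadratic {r : ℕ} {Γ : Matrix (Fin r) (Fin r) ℝ} (hΓ : Γ.PosDef) :
    ∃ γ, 0 < γ ∧ ∀ u : Matrix (Fin r) (Fin 1) ℝ, γ * ‖u‖ ^ 2 ≤ (uᵀ * Γ * u).trace := by
  obtain ⟨U, hU, hA⟩ := exists_sorted_spectral hΓ.1
  have hpos : ∀ j, 0 < sortedEigenvalues hΓ.1 j := by
    intro j
    have h := hΓ.eigenvalues_pos (Fintype.equivOfCardEq (Fintype.card_fin _)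
      (Fin.cast (Fintype.card_fin r).symm j))
    rw [Matrix.IsHermitian.eigenvalues, Equiv.symm_apply_apply] at h
    exact h
  obtain ⟨γ, hγ, hle⟩ := exists_pos_forall_le hpos
  exact ⟨γ, hγ, fun u => le_trace_quadratic hU hA hle u⟩

theorem norm_mul_sq_eq_trace {m r k : ℕ} (A : Matrix (Fin m) (Fin r) ℝ)
    (u : Matrix (Fin r) (Fin k) ℝ) : ‖A * u‖ ^ 2 = (uᵀ * (Aᵀ * A) * u).trace := by
  rw [norm_sq_eq_trace, Matrix.transpose_mul]
  simp only [Matrix.mul_assoc]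

theorem abs_entry_le_specNorm {m n : ℕ} (A : Matrix (Fin m) (Fin n) ℝ) (i : Fin m) (j : Fin n) :
    |A i j| ≤ specNorm A := by
  have h := norm_mul_le_specNorm_mul A (Matrix.of fun k (_ : Fin 1) => if k = j then (1 : ℝ) else 0)
  have h1 : ‖(Matrix.of fun k (_ : Fin 1) => if k = j then (1 : ℝ) else 0)‖ = 1 := by
    rw [← sq_eq_sq₀ (norm_nonneg _) zero_le_one, ← frobSq_eq_norm_sq, frobSq]
    simp
  rw [h1, mul_one] at h
  refine le_trans ?_ ((abs_entry_le_norm _ i 0).trans h)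
  simp [Matrix.mul_apply]

/-- The scaled eigenvalues of the loadings converge. -/
theorem tendsto_gramEigenvalues {r : ℕ} {Λ : (d : ℕ) → Matrix (Fin d) (Fin r) ℝ} {π : Fin r → ℝ}
    (h : ∃ K : ℝ, ∀ᶠ d : ℕ in atTop,
      specNorm ((1 / (d : ℝ)) • Matrix.diagonal (gramEigenvalues (Λ d)) - Matrix.diagonal π)
        ≤ K / Real.sqrt d) (i : Fin r) :
    Tendsto (fun d : ℕ => gramEigenvalues (Λ d) i / d) atTop (𝓝 (π i)) := by
  obtain ⟨K, hK⟩ := h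
  rw [tendsto_iff_norm_sub_tendsto_zero]
  have h0 : Tendsto (fun d : ℕ => K / Real.sqrt d) atTop (𝓝 0) :=
    tendsto_const_nhds.div_atTop (Real.tendsto_sqrt_atTop.comp tendsto_natCast_atTop_atTop)
  refine squeeze_zero' (Eventually.of_forall fun _ => norm_nonneg _) ?_ h0
  filter_upwards [hK] with d hd
  refine le_trans ?_ ((abs_entry_le_specNorm _ i i).trans hd)
  rw [Matrix.sub_apply, Matrix.smul_apply, Matrix.diagonal_apply_eq, Matrix.diagonal_apply_eq,
    Real.norm_eq_abs, smul_eq_mul, one_div_mul_eq_div]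

theorem exists_isGramEigenbasis {d r : ℕ} (Λ : Matrix (Fin d) (Fin r) ℝ) :
    ∃ R, IsGramEigenbasis Λ R :=
  exists_sorted_spectral (gram_isHermitian Λ)

/-- The loadings scaled by `1/√d`. -/
def scaledLoadings {d r : ℕ} (Λ : Matrix (Fin d) (Fin r) ℝ) : Matrix (Fin d) (Fin r) ℝ :=
  (Real.sqrt d)⁻¹ • Λ

theorem scaledLoadings_gram {d r : ℕ} {Λ : Matrix (Fin d) (Fin r) ℝ}
    {R : Matrix (Fin r) (Fin r) ℝ} (hR : IsGramEigenbasis Λ R) :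
    (scaledLoadings Λ)ᵀ * scaledLoadings Λ =
      R * Matrix.diagonal (fun i => gramEigenvalues Λ i / d) * Rᵀ := by
  have h : (fun i => gramEigenvalues Λ i / d) = (d : ℝ)⁻¹ • gramEigenvalues Λ := by
    funext i; simp [div_eq_inv_mul]
  rw [scaledLoadings, Matrix.transpose_smul, Matrix.smul_mul, Matrix.mul_smul, smul_smul, hR.2, h,
    Matrix.diagonal_smul, Matrix.mul_smul, Matrix.smul_mul, ← mul_inv,
    Real.mul_self_sqrt (Nat.cast_nonneg d)]

/-- Uniform bounds on the scaled loadings. -/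
theorem exists_loading_bounds {r : ℕ} {Λ : (d : ℕ) → Matrix (Fin d) (Fin r) ℝ} {π : Fin r → ℝ}
    (hπ : ∀ i, 0 < π i)
    (hlim : ∀ i, Tendsto (fun d : ℕ => gramEigenvalues (Λ d) i / d) atTop (𝓝 (π i))) :
    ∃ b B : ℝ, 0 < b ∧ ∀ᶠ d : ℕ in atTop, ‖scaledLoadings (Λ d)‖ ≤ B ∧
      ∀ (k : ℕ) (u : Matrix (Fin r) (Fin k) ℝ), b * ‖u‖ ≤ ‖scaledLoadings (Λ d) * u‖ := by
  obtain ⟨g, hg, hgπ⟩ := exists_pos_forall_le hπ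
  have hev : ∀ᶠ d : ℕ in atTop, ∀ i, gramEigenvalues (Λ d) i / d ∈ Set.Ioo (g / 2) (π i + 1) := by
    rw [eventually_all]
    intro i
    refine (hlim i).eventually (Ioo_mem_nhds ?_ (by linarith))
    have := hgπ i
    linarith
  refine ⟨Real.sqrt (g / 2), Real.sqrt (∑ i, (π i + 1)), by positivity, ?_⟩
  filter_upwards [hev] with d hd
  obtain ⟨R, hR⟩ := exists_isGramEigenbasis (Λ d)
  have hgram := scaledLoadings_gram hR
  refine ⟨Real.le_sqrt_of_sq_le ?_, fun k u => ?_⟩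
  · rw [norm_sq_eq_trace, hgram, Matrix.trace_mul_comm, ← Matrix.mul_assoc, hR.1, Matrix.one_mul,
      Matrix.trace_diagonal]
    exact Finset.sum_le_sum fun i _ => (hd i).2.le
  · refine abs_le_of_sq_le_sq' ?_ (norm_nonneg _) |>.2
    rw [mul_pow, Real.sq_sqrt (by positivity), norm_mul_sq_eq_trace]
    exact le_trace_quadratic hR.1 hgram (fun i => (hd i).1.le) u

/-- Bounds on the moments of a sample from a factor model. -/
structure SampleBounds {T d r : ℕ} (Λ : Matrix (Fin d) (Fin r) ℝ) (Γ : Matrix (Fin r) (Fin r) ℝ)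
    (F : Matrix (Fin T) (Fin r) ℝ) (e : Matrix (Fin T) (Fin d) ℝ) (S : ℝ) : Prop where
  factor_cov : frobSq (Fᵀ * F - (T : ℝ) • Γ) ≤ S * T
  error_loading : frobSq (e * Λ) ≤ S * (T * d)
  error_outer : frobSq (e * eᵀ) ≤ S * ((T : ℝ) ^ 2 * d + T * (d : ℝ) ^ 2)
  error : frobSq e ≤ S * (T * d)
  error_factor : frobSq (eᵀ * F) ≤ S * (T * d)

theorem norm_smul_le_of_frobSq_le {m n : ℕ} {A : Matrix (Fin m) (Fin n) ℝ} {s a b : ℝ}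
    (h : frobSq A ≤ a) (hb : 0 ≤ b) (hs : s ^ 2 * a ≤ b ^ 2) : ‖s • A‖ ≤ b := by
  refine abs_le_of_sq_le_sq' ?_ hb |>.2
  rw [norm_smul, mul_pow, Real.norm_eq_abs, sq_abs, ← frobSq_eq_norm_sq]
  exact (mul_le_mul_of_nonneg_left h (sq_nonneg _)).trans hs

/-- The product f l' is unchanged when f and l are both rotated, so the model may be put in the
coordinates in which l'l is diagonal. -/
theorem FactorBounds.rotate {T d r : ℕ} {f : Matrix (Fin T) (Fin r) ℝ}
    {l : Matrix (Fin d) (Fin r) ℝ} {e : Matrix (Fin T) (Fin d) ℝ} {B c η : ℝ}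
    (h : FactorBounds f l e B c η) {R : Matrix (Fin r) (Fin r) ℝ} (hR : Rᵀ * R = 1) :
    FactorBounds (f * R) (l * R) e B c η where
  dim_le := h.dim_le
  pos := h.pos
  factor_le := (norm_mul_of_orthogonal_right hR f).le.trans h.factor_le
  loading_le := (norm_mul_of_orthogonal_right hR l).le.trans h.loading_le
  factor_ge := fun u => by
    rw [Matrix.mul_assoc, ← norm_mul_of_orthonormal hR u]
    exact h.factor_ge _
  loading_ge := fun u => by
    rw [Matrix.mul_assoc, ← norm_mul_of_orthonormal hR u]
    exact h.loading_ge _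
  error_loading := by
    rw [← Matrix.mul_assoc, norm_mul_of_orthogonal_right hR]
    exact h.error_loading
  error_outer := h.error_outer

theorem abs_trace_le {r : ℕ} (A : Matrix (Fin r) (Fin r) ℝ) : |A.trace| ≤ r * ‖A‖ := by
  rw [Matrix.trace]
  refine (Finset.abs_sum_le_sum_abs _ _).trans ?_
  calc ∑ i, |A.diag i| ≤ ∑ _i : Fin r, ‖A‖ :=
        Finset.sum_le_sum fun i _ => abs_entry_le_norm A i i
    _ = _ := by simp

/-- After scaling, a sample with bounded moments satisfies the bounds that are needed for the
perturbation theory. -/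
theorem exists_factorBounds {r : ℕ} {Γ : Matrix (Fin r) (Fin r) ℝ} (hΓ : Γ.PosDef) {b B₀ : ℝ}
    (hb : 0 < b) {S : ℝ} (hS : 0 ≤ S) :
    ∃ B₁ c₁ η₀ : ℝ, 0 < c₁ ∧ 0 < η₀ ∧ ∀ B c, B₁ ≤ B → 0 < c → c ≤ c₁ →
      ∀ (T d : ℕ) (Λ : Matrix (Fin d) (Fin r) ℝ)
      (F : Matrix (Fin T) (Fin r) ℝ) (e : Matrix (Fin T) (Fin d) ℝ), 0 < T → 0 < d →
      ‖scaledLoadings Λ‖ ≤ B₀ →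
      (∀ (k : ℕ) (u : Matrix (Fin r) (Fin k) ℝ), b * ‖u‖ ≤ ‖scaledLoadings Λ * u‖) →
      SampleBounds Λ Γ F e S → Real.sqrt (S * (1 / d + 1 / T)) ≤ η₀ →
      FactorBounds ((Real.sqrt T)⁻¹ • F) (scaledLoadings Λ) ((Real.sqrt (T * d))⁻¹ • e) B c
        (Real.sqrt (S * (1 / d + 1 / T))) ∧
      ‖(Real.sqrt (T * d))⁻¹ • e‖ ≤ B ∧
      ‖((Real.sqrt (T * d))⁻¹ • e)ᵀ * ((Real.sqrt T)⁻¹ • F)‖ ≤ Real.sqrt (S * (1 / d + 1 / T)) ∧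
      ‖((Real.sqrt T)⁻¹ • F)ᵀ * ((Real.sqrt T)⁻¹ • F) - Γ‖ ≤ Real.sqrt (S * (1 / d + 1 / T)) := by
  obtain ⟨γ, hγ, hγΓ⟩ := exists_pos_le_trace_quadratic hΓ
  -- The four entries of the maximum bound the dimension, l, e and f. The lower bound is b for l and
  -- √(γ/2) for f, where half of the coercivity constant γ of Γ is given up to the sampling error η
  -- ≤ γ/2. Allowing any larger B and smaller c lets both series share their constants.
  refine ⟨max (max (r + 1) B₀) (max (Real.sqrt S) (Real.sqrt (|Γ.trace| + r))),
    min b (Real.sqrt (γ / 2)), min 1 (γ / 2), by positivity, by positivity, ?_⟩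
  intro B c hB hc hc₁ T d Λ F e hT hd hΛ hΛu h hη
  set η := Real.sqrt (S * (1 / d + 1 / T)) with hηdef
  have hT' : (0 : ℝ) < T := by exact_mod_cast hT
  have hd' : (0 : ℝ) < d := by exact_mod_cast hd
  have hη2 : η ^ 2 = S * (1 / d + 1 / T) := Real.sq_sqrt (by positivity)
  have hη0 : 0 ≤ η := Real.sqrt_nonneg _
  have sT : (Real.sqrt T)⁻¹ ^ 2 = (T : ℝ)⁻¹ := by rw [inv_pow, Real.sq_sqrt hT'.le]
  have sd : (Real.sqrt d)⁻¹ ^ 2 = (d : ℝ)⁻¹ := by rw [inv_pow, Real.sq_sqrt hd'.le]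
  have sTd : (Real.sqrt (T * d))⁻¹ ^ 2 = ((T : ℝ) * d)⁻¹ := by
    rw [inv_pow, Real.sq_sqrt (by positivity)]
  have hSd : S / d ≤ S * (1 / d + 1 / T) := by
    rw [div_eq_mul_one_div]
    gcongr
    have : (0 : ℝ) ≤ 1 / T := by positivity
    linarith
  have hST : S / T ≤ S * (1 / d + 1 / T) := by
    rw [div_eq_mul_one_div]
    gcongr
    have : (0 : ℝ) ≤ 1 / d := by positivity
    linarith
  have hff : ‖((Real.sqrt T)⁻¹ • F)ᵀ * ((Real.sqrt T)⁻¹ • F) - Γ‖ ≤ η := by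
    have h1 : ((Real.sqrt T)⁻¹ • F)ᵀ * ((Real.sqrt T)⁻¹ • F) - Γ =
        (T : ℝ)⁻¹ • (Fᵀ * F - (T : ℝ) • Γ) := by
      rw [smul_sub, smul_smul, inv_mul_cancel₀ hT'.ne', one_smul, Matrix.transpose_smul,
        Matrix.smul_mul, Matrix.mul_smul, smul_smul, ← sq, sT]
    rw [h1]
    refine norm_smul_le_of_frobSq_le h.factor_cov hη0 (le_trans (le_of_eq ?_) (hST.trans hη2.ge))
    field_simp
  have hfn : ‖(Real.sqrt T)⁻¹ • F‖ ≤ Real.sqrt (|Γ.trace| + r) := by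
    refine Real.le_sqrt_of_sq_le ?_
    rw [norm_sq_eq_trace]
    have h1 := abs_le.mp (abs_trace_le (((Real.sqrt T)⁻¹ • F)ᵀ * ((Real.sqrt T)⁻¹ • F) - Γ))
    rw [Matrix.trace_sub] at h1
    have h2 : ‖((Real.sqrt T)⁻¹ • F)ᵀ * ((Real.sqrt T)⁻¹ • F) - Γ‖ ≤ 1 :=
      hff.trans (hη.trans (min_le_left _ _))
    have h3 := mul_le_mul_of_nonneg_left h2 (Nat.cast_nonneg (α := ℝ) r)
    have h4 := le_abs_self Γ.trace
    linarith [h1.2]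
  refine ⟨⟨?_, hc, ?_, ?_, ?_, ?_, ?_, ?_⟩, ?_, ?_, hff⟩
  · exact le_trans ((le_max_left _ _).trans (le_max_left _ _)) hB
  · exact hfn.trans (((le_max_right _ _).trans (le_max_right _ _)).trans hB)
  · exact hΛ.trans (((le_max_right _ _).trans (le_max_left _ _)).trans hB)
  · intro u
    refine (mul_le_mul_of_nonneg_right (hc₁.trans (min_le_right _ _)) (norm_nonneg _)).trans ?_
    refine abs_le_of_sq_le_sq' ?_ (norm_nonneg _) |>.2
    rw [mul_pow, Real.sq_sqrt (by positivity), norm_mul_sq_eq_trace]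
    have h1 := hγΓ u
    set G := ((Real.sqrt T)⁻¹ • F)ᵀ * ((Real.sqrt T)⁻¹ • F)
    have h2 : uᵀ * G * u = uᵀ * Γ * u + uᵀ * (G - Γ) * u := by
      rw [Matrix.mul_sub, Matrix.sub_mul]; abel
    have h3 : |(uᵀ * (G - Γ) * u).trace| ≤ ‖u‖ * η * ‖u‖ := by
      rw [Matrix.trace_fin_one]
      exact (abs_entry_le_norm _ _ _).trans (norm_mul_le_of_le
        (norm_mul_le_of_le (Matrix.frobenius_norm_transpose _).le hff) le_rfl)
    have h4 : ‖u‖ * η * ‖u‖ ≤ γ / 2 * ‖u‖ ^ 2 := by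
      have := mul_le_mul_of_nonneg_right (hη.trans (min_le_right _ _)) (sq_nonneg ‖u‖)
      linarith
    rw [h2, Matrix.trace_add]
    linarith [(abs_le.mp h3).1]
  · intro u
    exact (mul_le_mul_of_nonneg_right (hc₁.trans (min_le_left _ _)) (norm_nonneg _)).trans
      (hΛu 1 u)
  · rw [scaledLoadings, Matrix.smul_mul, Matrix.mul_smul, smul_smul]
    refine norm_smul_le_of_frobSq_le h.error_loading hη0 (le_trans (le_of_eq ?_)
      (hSd.trans hη2.ge))
    rw [mul_pow, sTd, sd]
    field_simp
  -- (T²d + Td²)/(Td)² = 1/d + 1/T, so this bound exhausts η². By itself e l gives 1/d, while e'f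
  -- and the factor covariance give 1/T.
  · rw [Matrix.transpose_smul, Matrix.smul_mul, Matrix.mul_smul, smul_smul, ← sq]
    refine norm_smul_le_of_frobSq_le h.error_outer hη0 (le_of_eq ?_)
    rw [sTd, hη2]
    field_simp
  · refine norm_smul_le_of_frobSq_le h.error ((Real.sqrt_nonneg S).trans
      (((le_max_left _ _).trans (le_max_right _ _)).trans hB)) ?_
    have h1 : Real.sqrt S ^ 2 ≤ B ^ 2 := pow_le_pow_left₀ (Real.sqrt_nonneg _)
      (((le_max_left _ _).trans (le_max_right _ _)).trans hB) 2
    rw [Real.sq_sqrt hS] at h1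
    refine le_trans (le_of_eq ?_) h1
    rw [sTd]
    field_simp
  · rw [Matrix.transpose_smul, Matrix.smul_mul, Matrix.mul_smul, smul_smul]
    refine norm_smul_le_of_frobSq_le h.error_factor hη0 (le_trans (le_of_eq ?_)
      (hST.trans hη2.ge))
    rw [mul_pow, sTd, sT]
    field_simp

end

section

open scoped Matrix.Norms.Frobenius Matrix Topology

/-! ### The bound on the event that the moments of the samples are bounded -/

theorem IsPCAFactors.exists_isLeadingPair {T d r : ℕ} {X : Matrix (Fin T) (Fin d) ℝ}
    {Fh : Matrix (Fin T) (Fin r) ℝ} (h : IsPCAFactors X Fh) {s : ℝ} (hs : s ≠ 0) :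
    ∃ Q v, IsLeadingPair (s • X) Q v ∧ Fh = Real.sqrt T • Q := by
  obtain ⟨Q, hQ, rfl⟩ := h
  obtain ⟨v, hv⟩ := hQ.isLeadingPair
  exact ⟨Q, _, hv.smul hs, rfl⟩

/-- The sign convention survives the scaling because κ is positive. -/
theorem pcaLoadings_smul {T d r : ℕ} (hT : 0 < T) {s : ℝ} (hs : 0 < s)
    (X : Matrix (Fin T) (Fin d) ℝ) (Q : Matrix (Fin T) (Fin r) ℝ) :
    ∃ κ : ℝ, 0 < κ ∧ pcaLoadings X (Real.sqrt T • Q) = κ • ((s • X)ᵀ * Q) := by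
  have hT' : (0 : ℝ) < T := by exact_mod_cast hT
  refine ⟨1 / T * Real.sqrt T / s, by positivity, ?_⟩
  rw [pcaLoadings, Matrix.mul_smul, smul_smul, Matrix.transpose_smul, Matrix.smul_mul, smul_smul,
    div_mul_cancel₀ _ hs.ne']

/-- The diagonal matrix that selects the first half of the sample. -/
def firstHalf (T : ℕ) : Matrix (Fin T) (Fin T) ℝ :=
  Matrix.diagonal fun t => if (t : ℕ) < T / 2 then 1 else 0

theorem firstHalf_transpose (T : ℕ) : (firstHalf T)ᵀ = firstHalf T :=
  Matrix.diagonal_transpose _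

theorem firstHalf_idempotent (T : ℕ) : firstHalf T * firstHalf T = firstHalf T := by
  rw [firstHalf, Matrix.diagonal_mul_diagonal]
  congr 1
  funext t
  split_ifs <;> simp

/-- Observations are rows, so the projections act from the right; symmetry removes the transpose. -/
theorem transformedMatrix_eq {T d : ℕ} {P₁ P₂ : Matrix (Fin d) (Fin d) ℝ} (h₁ : P₁ᵀ = P₁)
    (h₂ : P₂ᵀ = P₂) (X : Matrix (Fin T) (Fin d) ℝ) :
    transformedMatrix P₁ P₂ X = firstHalf T * X * ((1 / 2 : ℝ) • (P₁ + 1)) +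
      (1 - firstHalf T) * X * ((1 / 2 : ℝ) • (P₂ + 1)) := by
  have hmul : ∀ P : Matrix (Fin d) (Fin d) ℝ, Pᵀ = P → ∀ t j,
      (((1 / 2 : ℝ) • (P + 1)).mulVec (X t)) j =
        (X * ((1 / 2 : ℝ) • (P + 1)) : Matrix (Fin T) (Fin d) ℝ) t j := by
    intro P hP t j
    have hs : ((1 / 2 : ℝ) • (P + 1))ᵀ = (1 / 2 : ℝ) • (P + 1) := by simp [hP]
    conv_lhs => rw [← hs, Matrix.mulVec_transpose]
    rfl
  have hone : (1 : Matrix (Fin T) (Fin T) ℝ) - firstHalf T =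
      Matrix.diagonal fun t : Fin T => if (t : ℕ) < T / 2 then (0 : ℝ) else 1 := by
    rw [firstHalf, ← Matrix.diagonal_one, Matrix.diagonal_sub]
    congr 1
    funext t
    split_ifs <;> simp
  ext t j
  rw [hone, firstHalf, Matrix.add_apply, Matrix.mul_assoc, Matrix.mul_assoc, Matrix.diagonal_mul,
    Matrix.diagonal_mul, transformedMatrix, Matrix.of_apply]
  split_ifs
  · rw [hmul _ h₁]; simp
  · rw [hmul _ h₂]; simp

theorem exists_gap {r : ℕ} {π : Fin r → ℝ} (hpos : ∀ i, 0 < π i) (hanti : Antitone π)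
    (hinj : Function.Injective π) :
    ∃ g, 0 < g ∧ (∀ i, g ≤ π i) ∧ ∀ i j, i < j → π j + g ≤ π i := by
  obtain ⟨g₁, hg₁, h₁⟩ := exists_pos_forall_le hpos
  obtain ⟨g₂, hg₂, h₂⟩ := exists_pos_forall_le
    (a := fun q : {q : Fin r × Fin r // q.1 < q.2} => π q.1.1 - π q.1.2) fun q =>
      sub_pos.mpr (lt_of_le_of_ne (hanti q.2.le) fun h => q.2.ne' (hinj h))
  refine ⟨min g₁ g₂, lt_min hg₁ hg₂, fun i => (min_le_left _ _).trans (h₁ i), fun i j hij => ?_⟩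
  have := (min_le_right g₁ g₂).trans (h₂ ⟨(i, j), hij⟩)
  simp only at this
  linarith

/-- The eigenvalues are sorted before the limit, so the limits are ordered; with distinctness this
yields the gap g. -/
theorem antitone_of_tendsto_gramEigenvalues {r : ℕ} {Λ : (d : ℕ) → Matrix (Fin d) (Fin r) ℝ}
    {π : Fin r → ℝ}
    (hlim : ∀ i, Tendsto (fun d : ℕ => gramEigenvalues (Λ d) i / d) atTop (𝓝 (π i))) :
    Antitone π := fun i j hij =>
  le_of_tendsto_of_tendsto' (hlim j) (hlim i) fun d =>
    div_le_div_of_nonneg_right (sortedEigenvalues_antitone _ hij) (Nat.cast_nonneg d)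

theorem NullHypothesis.exists_eq_mul {d r : ℕ} {Λ₁ Λ₂ : Matrix (Fin d) (Fin r) ℝ}
    (h : NullHypothesis Λ₁ Λ₂) : ∃ S : Matrix (Fin r) (Fin r) ℝ, Λ₂ = Λ₁ * S := by
  obtain ⟨Λ, Φ₁, Φ₂, -, h₁, -, rfl, rfl⟩ := h
  refine ⟨Φ₁⁻¹ * Φ₂, ?_⟩
  rw [Matrix.mul_assoc, ← Matrix.mul_assoc Φ₁,
    Matrix.mul_nonsing_inv _ ((Matrix.isUnit_iff_isUnit_det _).mp h₁), Matrix.one_mul]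

theorem smul_sample_eq {T d r : ℕ} (F : Matrix (Fin T) (Fin r) ℝ) (Λ : Matrix (Fin d) (Fin r) ℝ)
    (e : Matrix (Fin T) (Fin d) ℝ) :
    (Real.sqrt (T * d))⁻¹ • (F * Λᵀ + e) =
      ((Real.sqrt T)⁻¹ • F) * (scaledLoadings Λ)ᵀ + (Real.sqrt (T * d))⁻¹ • e := by
  rw [smul_add, scaledLoadings, Matrix.transpose_smul, Matrix.smul_mul, Matrix.mul_smul, smul_smul,
    ← mul_inv, ← Real.sqrt_mul (Nat.cast_nonneg T)]

/-- The bound for the estimated factors of the transformed series holds for all large samples with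
bounded moments. -/
theorem exists_bound_of_sampleBounds {r : ℕ} {Λ₁ Λ₂ : (d : ℕ) → Matrix (Fin d) (Fin r) ℝ}
    {π₁ π₂ : Fin r → ℝ} {Γ₁ : Matrix (Fin r) (Fin r) ℝ} (hΓ₁ : Γ₁.PosDef)
    (hπ₁ : ∀ i, 0 < π₁ i) (hπ₂ : ∀ i, 0 < π₂ i)
    (hlim₁ : ∀ i, Tendsto (fun d : ℕ => gramEigenvalues (Λ₁ d) i / d) atTop (𝓝 (π₁ i)))
    (hlim₂ : ∀ i, Tendsto (fun d : ℕ => gramEigenvalues (Λ₂ d) i / d) atTop (𝓝 (π₂ i)))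
    (hNull : ∀ d, r < d → NullHypothesis (Λ₁ d) (Λ₂ d)) (hDistinct : Function.Injective π₂)
    {R : ℕ → Matrix (Fin r) (Fin r) ℝ} (hR : ∀ d, r < d → IsGramEigenbasis (Λ₂ d) (R d))
    {S : ℝ} (hS : 0 ≤ S) :
    ∃ C : ℝ, 0 ≤ C ∧ ∀ᶠ n : ℕ × ℕ in atTop ×ˢ atTop, ∀ d T : ℕ, (d, T) = n →
      ∀ (F₁ F₂ Fh₁ Fh₂ Fh : Matrix (Fin T) (Fin r) ℝ) (e₁ e₂ : Matrix (Fin T) (Fin d) ℝ),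
      SampleBounds (Λ₁ d) Γ₁ F₁ e₁ S → SampleBounds (Λ₂ d) 1 F₂ e₂ S →
      IsPCAFactors (F₁ * (Λ₁ d)ᵀ + e₁) Fh₁ → IsPCAFactors (F₂ * (Λ₂ d)ᵀ + e₂) Fh₂ →
      ∀ Y, Y = transformedSample (F₁ * (Λ₁ d)ᵀ + e₁) (F₂ * (Λ₂ d)ᵀ + e₂) Fh₁ Fh₂ →
      IsPCAFactors Y Fh →
      (∀ j : Fin r, 0 ≤ ((pcaLoadings Y Fh)ᵀ * (Λ₂ d * R d)) j j) →
      1 / (T : ℝ) * frobSq (Fh - F₂ * R d) ≤ C * (1 / d + 1 / T) := by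
  obtain ⟨b₁, L₁, hb₁, hL₁⟩ := exists_loading_bounds hπ₁ hlim₁
  obtain ⟨b₂, L₂, hb₂, hL₂⟩ := exists_loading_bounds hπ₂ hlim₂
  obtain ⟨g, hg, hgπ, hgap⟩ := exists_gap hπ₂ (antitone_of_tendsto_gramEigenvalues hlim₂) hDistinct
  obtain ⟨B₁, c₁, η₁, hc₁, hη₁, H₁⟩ := exists_factorBounds (B₀ := L₁) hΓ₁ hb₁ hS
  obtain ⟨B₂, c₂, η₂, hc₂, hη₂, H₂⟩ := exists_factorBounds (B₀ := L₂)
    (Matrix.PosDef.one (n := Fin r) (R := ℝ)) hb₂ hS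
  set B := max (max B₁ B₂) (max 1 (L₂ / b₁)) with hB
  have hB1 : 1 ≤ B := (le_max_left _ _).trans (le_max_right _ _)
  obtain ⟨C, η₀, hC, hη₀, H⟩ := exists_bound_transformed r hB1 (lt_min hc₁ hc₂) hg
  refine ⟨C ^ 2 * S, by positivity, ?_⟩
  have hpev : ∀ᶠ d : ℕ in atTop, ∀ i, |gramEigenvalues (Λ₂ d) i / d - π₂ i| ≤ g / 8 := by
    rw [eventually_all]
    intro i
    filter_upwards [Metric.tendsto_nhds.mp (hlim₂ i) (g / 8) (by positivity)] with d hd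
    rw [Real.dist_eq] at hd
    exact hd.le
  have hηev : ∀ᶠ n : ℕ × ℕ in atTop ×ˢ atTop,
      Real.sqrt (S * (1 / n.1 + 1 / n.2)) < min η₀ (min η₁ η₂) := by
    have h1 : Tendsto (fun n : ℕ × ℕ => Real.sqrt (S * (1 / (n.1 : ℝ) + 1 / (n.2 : ℝ))))
        (atTop ×ˢ atTop) (𝓝 (Real.sqrt (S * (0 + 0)))) :=
      ((((tendsto_one_div_atTop_nhds_zero_nat (𝕜 := ℝ)).comp tendsto_fst).add
        ((tendsto_one_div_atTop_nhds_zero_nat (𝕜 := ℝ)).comp tendsto_snd)).const_mul S).sqrt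
    rw [add_zero, mul_zero, Real.sqrt_zero] at h1
    exact h1.eventually_lt_const (by positivity)
  filter_upwards [hηev, (((hL₁.and hL₂).and hpev).and (eventually_gt_atTop r)).prod_inl _,
    (eventually_gt_atTop 0).prod_inr _] with n hn hnd hnT
  rintro d T rfl F₁ F₂ Fh₁ Fh₂ Fh e₁ e₂ hs₁ hs₂ hp₁ hp₂ Y hY hp hsign
  obtain ⟨⟨⟨⟨hl₁, hu₁⟩, hl₂, hu₂⟩, hpi⟩, hrd⟩ := hnd
  simp only at hn hnT hl₁ hu₁ hl₂ hu₂ hpi hrd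
  have hd0 : 0 < d := (Nat.zero_le r).trans_lt hrd
  have hT' : (0 : ℝ) < T := by exact_mod_cast hnT
  have hd' : (0 : ℝ) < d := by exact_mod_cast hd0
  set η := Real.sqrt (S * (1 / d + 1 / T)) with hη
  have hη2 : η ^ 2 = S * (1 / d + 1 / T) := Real.sq_sqrt (by positivity)
  obtain ⟨hηa, hηb⟩ := lt_min_iff.mp hn
  obtain ⟨hηb, hηc⟩ := lt_min_iff.mp hηb
  set s := (Real.sqrt (T * d))⁻¹ with hs
  have hs0 : 0 < s := by positivity
  obtain ⟨hfb₁, he₁, hef₁, -⟩ := H₁ B (min c₁ c₂) ((le_max_left _ _).trans (le_max_left _ _))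
    (lt_min hc₁ hc₂) (min_le_left _ _) T d (Λ₁ d) F₁ e₁ hnT hd0 hl₁ hu₁ hs₁ hηb.le
  obtain ⟨hfb₂, he₂, hef₂, hff₂⟩ := H₂ B (min c₁ c₂) ((le_max_right _ _).trans (le_max_left _ _))
    (lt_min hc₁ hc₂) (min_le_right _ _) T d (Λ₂ d) F₂ e₂ hnT hd0 hl₂ hu₂ hs₂ hηc.le
  obtain ⟨hRR, hRΛ⟩ := hR d hrd
  have hRR' : R d * (R d)ᵀ = 1 := mul_eq_one_comm.mp hRR
  set f₁ := (Real.sqrt T)⁻¹ • F₁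
  set f₂ := (Real.sqrt T)⁻¹ • F₂ with hf₂
  set l₁ := scaledLoadings (Λ₁ d) with hl₁def
  set l₂ := scaledLoadings (Λ₂ d) with hl₂def
  obtain ⟨Q₁, v₁, hQ₁, rfl⟩ := hp₁.exists_isLeadingPair hs0.ne'
  obtain ⟨Q₂, v₂, hQ₂, rfl⟩ := hp₂.exists_isLeadingPair hs0.ne'
  obtain ⟨Q, v, hQ, rfl⟩ := hp.exists_isLeadingPair hs0.ne'
  have hx₁ : s • (F₁ * (Λ₁ d)ᵀ + e₁) = f₁ * l₁ᵀ + s • e₁ := smul_sample_eq _ _ _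
  have hx₂ : s • (F₂ * (Λ₂ d)ᵀ + e₂) = f₂ * l₂ᵀ + s • e₂ := smul_sample_eq _ _ _
  have hrot : f₂ * R d * (l₂ * R d)ᵀ = f₂ * l₂ᵀ := by
    rw [Matrix.transpose_mul, Matrix.mul_assoc, ← Matrix.mul_assoc (R d), hRR', Matrix.one_mul]
  obtain ⟨κ₁, hκ₁, hpl₁⟩ := pcaLoadings_smul hnT hs0 (F₁ * (Λ₁ d)ᵀ + e₁) Q₁
  obtain ⟨κ₂, hκ₂, hpl₂⟩ := pcaLoadings_smul hnT hs0 (F₂ * (Λ₂ d)ᵀ + e₂) Q₂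
  obtain ⟨κ, hκ, hpl⟩ := pcaLoadings_smul hnT hs0 Y Q
  rw [hx₁] at hpl₁
  rw [hx₂] at hpl₂
  rw [hx₁] at hQ₁
  rw [hx₂] at hQ₂
  have hy : s • Y = firstHalf T * (f₂ * l₂ᵀ + s • e₂) *
        ((1 / 2 : ℝ) • (colProj ((f₁ * l₁ᵀ + s • e₁)ᵀ * Q₁) + 1)) +
      (1 - firstHalf T) * (f₂ * l₂ᵀ + s • e₂) *
        ((1 / 2 : ℝ) • (colProj ((f₂ * l₂ᵀ + s • e₂)ᵀ * Q₂) + 1)) := by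
    rw [hY, transformedSample, transformedMatrix_eq (colProj_transpose _) (colProj_transpose _),
      hpl₁, hpl₂, colProj_smul _ hκ₁.ne', colProj_smul _ hκ₂.ne', ← hx₂, smul_add]
    simp only [Matrix.mul_smul, Matrix.smul_mul, smul_comm s (1 / 2 : ℝ)]
  obtain ⟨S₀, hS₀⟩ := (hNull d hrd).exists_eq_mul
  have hl₂₁ : l₂ = l₁ * S₀ := by
    rw [hl₂def, hl₁def, scaledLoadings, scaledLoadings, hS₀, Matrix.smul_mul]
  -- The change of basis between the loadings is bounded uniformly in d: b₁ ‖S₀‖ ≤ ‖l₁ S₀‖ = ‖l₂‖ ≤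
  -- L₂. This is why B includes L₂ / b₁.
  have hS₀n : ‖S₀ * R d‖ ≤ B := by
    rw [norm_mul_of_orthogonal_right hRR]
    have h1 := hu₁ r S₀
    rw [← hl₂₁] at h1
    refine le_trans ?_ ((le_max_right _ _).trans (le_max_right _ _))
    rw [le_div_iff₀ hb₁]
    linarith
  have hfb := hfb₂.rotate hRR
  rw [← hrot] at hQ₂ hy
  have hmain := H T d f₁ (f₂ * R d) l₁ (l₂ * R d) (s • e₁) (s • e₂) (S₀ * R d) Q₁ Q₂ Q v₁ v₂ _
    (fun i => gramEigenvalues (Λ₂ d) i / d) π₂ (firstHalf T) η hηa.le hfb₁ he₁ hef₁ hfb he₂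
    (by rwa [← Matrix.mul_assoc, norm_mul_of_orthogonal_right hRR])
    (by rw [hl₂₁, Matrix.mul_assoc]) hS₀n hQ₁ hQ₂
    (by
      have h1 : (f₂ * R d)ᵀ * (f₂ * R d) - 1 = (R d)ᵀ * (f₂ᵀ * f₂ - 1) * R d := by
        rw [Matrix.mul_sub, Matrix.sub_mul, Matrix.mul_one, hRR, Matrix.transpose_mul]
        simp only [Matrix.mul_assoc]
      rw [h1, norm_mul_of_orthogonal_right hRR, norm_mul_of_orthonormal
        (by rwa [Matrix.transpose_transpose])]
      exact hff₂)
    (by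
      rw [Matrix.transpose_mul, Matrix.mul_assoc, ← Matrix.mul_assoc l₂ᵀ,
        scaledLoadings_gram (hR d hrd), Matrix.mul_assoc, Matrix.mul_assoc, hRR, Matrix.mul_one,
        ← Matrix.mul_assoc, hRR, Matrix.one_mul])
    hgap hpi
    (fun i => by
      have h1 := (abs_le.mp (hpi i)).1
      have h2 := hgπ i
      linarith)
    (firstHalf_transpose T) (firstHalf_idempotent T) (s • Y) hy hQ
    (fun j => by
      have h1 := hsign j
      rw [hpl] at h1
      have h2 : ((s • Y)ᵀ * Q)ᵀ * (l₂ * R d) =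
          (κ⁻¹ * (Real.sqrt d)⁻¹) • ((κ • ((s • Y)ᵀ * Q))ᵀ * (Λ₂ d * R d)) := by
        generalize (s • Y)ᵀ * Q = Z
        rw [hl₂def, scaledLoadings, Matrix.transpose_smul, Matrix.smul_mul, Matrix.smul_mul,
          Matrix.mul_smul, smul_smul, mul_right_comm, inv_mul_cancel₀ hκ.ne', one_mul]
      rw [h2, Matrix.smul_apply, smul_eq_mul]
      exact mul_nonneg (by positivity) h1)
  have hfin : Real.sqrt T • Q - F₂ * R d = Real.sqrt T • (Q - f₂ * R d) := by
    rw [smul_sub, hf₂, Matrix.smul_mul, smul_smul, mul_inv_cancel₀ (by positivity), one_smul]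
  rw [frobSq_eq_norm_sq, hfin, norm_smul, mul_pow, Real.norm_eq_abs, sq_abs, Real.sq_sqrt hT'.le,
    ← mul_assoc, one_div_mul_cancel hT'.ne', one_mul, mul_assoc, ← hη2, ← mul_pow]
  exact pow_le_pow_left₀ (norm_nonneg _) hmain 2

end

section

open scoped Matrix.Norms.Frobenius Matrix Topology

/-! ### Moments of white noise -/

set_option linter.unusedSectionVars false

variable {Ω : Type*} [MeasurableSpace Ω] {P : Measure Ω}

/-- The second moment of a sum of orthogonal random variables. -/
theorem integral_sq_sum_le {ι : Type*} [Fintype ι] {f : ι → Ω → ℝ} {M : ι → ℝ}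
    (hf : ∀ t, MemLp (f t) 2 P) (ho : ∀ t s, t ≠ s → ∫ ω, f t ω * f s ω ∂P = 0)
    (hM : ∀ t, ∫ ω, f t ω ^ 2 ∂P ≤ M t) :
    Integrable (fun ω => (∑ t, f t ω) ^ 2) P ∧ ∫ ω, (∑ t, f t ω) ^ 2 ∂P ≤ ∑ t, M t := by
  have hint : ∀ t s, Integrable (fun ω => f t ω * f s ω) P := fun t s =>
    (hf t).integrable_mul (hf s)
  have hexp : (fun ω => (∑ t, f t ω) ^ 2) = fun ω => ∑ t, ∑ s, f t ω * f s ω := by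
    funext ω
    rw [sq, Finset.sum_mul_sum]
  rw [hexp]
  refine ⟨integrable_finsetSum _ fun t _ => integrable_finsetSum _ fun s _ => hint t s, ?_⟩
  rw [integral_finsetSum _ fun t _ => integrable_finsetSum _ fun s _ => hint t s]
  refine Finset.sum_le_sum fun t _ => ?_
  rw [integral_finsetSum _ fun s _ => hint t s, Finset.sum_eq_single t (fun s _ hst => ho t s hst.symm)
    (by simp)]
  simpa [sq] using hM t

/-- The covariance matrix of the noise. -/
def noiseCov {n : ℕ} (P : Measure Ω) (b : ℤ → Ω → Fin n → ℝ) : Matrix (Fin n) (Fin n) ℝ :=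
  Matrix.of fun i j => ∫ ω, b 0 ω i * b 0 ω j ∂P

variable {n : ℕ} {b : ℤ → Ω → Fin n → ℝ}

theorem IsWhiteNoise.measurable_apply (hb : IsWhiteNoise P b) (t : ℤ) (i : Fin n) :
    Measurable fun ω => b t ω i :=
  (measurable_pi_apply i).comp (hb.measurable t)

theorem IsWhiteNoise.memLp_two [IsProbabilityMeasure P] (hb : IsWhiteNoise P b) (t : ℤ) (i : Fin n) :
    MemLp (fun ω => b t ω i) 2 P :=
  (hb.memLp_four t i).mono_exponent (by norm_num)

theorem IsWhiteNoise.integrable_pow_four (hb : IsWhiteNoise P b) (t : ℤ) (i : Fin n) :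
    Integrable (fun ω => b t ω i ^ 4) P := by
  have h := MemLp.integrable_norm_pow (p := 4) (hb.memLp_four t i) (by norm_num)
  refine h.congr (Eventually.of_forall fun ω => ?_)
  simp only [Real.norm_eq_abs]
  exact Even.pow_abs (by decide) _

theorem IsWhiteNoise.integral_mul_self (hb : IsWhiteNoise P b) (t : ℤ) (i j : Fin n) :
    ∫ ω, b t ω i * b t ω j ∂P = noiseCov P b i j :=
  ((hb.identDistrib t).comp (u := fun x : Fin n → ℝ => x i * x j) (by fun_prop)).integral_eq

variable [IsProbabilityMeasure P]

theorem IsWhiteNoise.integrable_mul (hb : IsWhiteNoise P b) (s t : ℤ) (i j : Fin n) :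
    Integrable (fun ω => b s ω i * b t ω j) P :=
  (hb.memLp_two s i).integrable_mul (hb.memLp_two t j)

/-- The noise at a time is independent of the noise at other times. -/
theorem IsWhiteNoise.integral_mul_eq_zero (hb : IsWhiteNoise P b) {p : ℤ} {S : Finset ℤ}
    (hp : p ∉ S) (i : Fin n) {ψ : (S → Fin n → ℝ) → ℝ} (hψ : Measurable ψ) :
    ∫ ω, b p ω i * ψ (fun q => b q ω) ∂P = 0 := by
  have h := hb.indep.indepFun_finset {p} S (by simpa using hp) hb.measurable
  have h2 := h.comp (φ := fun x : (({p} : Finset ℤ) → Fin n → ℝ) => x ⟨p, by simp⟩ i) (ψ := ψ)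
    (by fun_prop) hψ
  have hm : Measurable fun ω => (fun q : S => b q ω) :=
    measurable_pi_lambda _ fun q => hb.measurable q
  have h3 := h2.integral_fun_mul_eq_mul_integral (hb.measurable_apply p i).aestronglyMeasurable
    (hψ.comp hm).aestronglyMeasurable
  refine h3.trans ?_
  have h4 := hb.mean_zero p i
  simp only [Function.comp_def]
  rw [h4, zero_mul]

theorem IsWhiteNoise.integral_mul_of_ne (hb : IsWhiteNoise P b) {s t : ℤ} (hst : s ≠ t)
    (i j : Fin n) : ∫ ω, b s ω i * b t ω j ∂P = 0 :=
  hb.integral_mul_eq_zero (S := {t}) (by simpa using hst) i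
    (ψ := fun x => x ⟨t, by simp⟩ j) (by fun_prop)

theorem IsWhiteNoise.integral_mul_three_eq_zero (hb : IsWhiteNoise P b) {p q₁ q₂ q₃ : ℤ}
    (h₁ : p ≠ q₁) (h₂ : p ≠ q₂) (h₃ : p ≠ q₃) (i j₁ j₂ j₃ : Fin n) :
    ∫ ω, b p ω i * (b q₁ ω j₁ * b q₂ ω j₂ * b q₃ ω j₃) ∂P = 0 :=
  hb.integral_mul_eq_zero (S := {q₁, q₂, q₃}) (by simp [h₁, h₂, h₃]) i
    (ψ := fun x => x ⟨q₁, by simp⟩ j₁ * x ⟨q₂, by simp⟩ j₂ * x ⟨q₃, by simp⟩ j₃) (by fun_prop)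

theorem IsWhiteNoise.memLp_mul (hb : IsWhiteNoise P b) (s t : ℤ) (i j : Fin n) :
    MemLp (fun ω => b s ω i * b t ω j) 2 P := by
  refine (memLp_two_iff_integrable_sq
    ((hb.measurable_apply s i).mul (hb.measurable_apply t j)).aestronglyMeasurable).mpr ?_
  refine ((hb.integrable_pow_four s i).add (hb.integrable_pow_four t j)).mono'
    (((hb.measurable_apply s i).mul (hb.measurable_apply t j)).pow_const 2).aestronglyMeasurable
    (Eventually.of_forall fun ω => ?_)
  rw [Real.norm_eq_abs, abs_of_nonneg (sq_nonneg _)]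
  simp only [Pi.add_apply, Pi.mul_apply]
  nlinarith [sq_nonneg (b s ω i ^ 2 - b t ω j ^ 2), sq_nonneg (b s ω i ^ 2),
    sq_nonneg (b t ω j ^ 2)]

theorem IsWhiteNoise.integral_mul_sq_le (hb : IsWhiteNoise P b) {M : ℝ}
    (hM : ∀ t j, ∫ ω, b t ω j ^ 4 ∂P ≤ M) (s t : ℤ) (i j : Fin n) :
    ∫ ω, (b s ω i * b t ω j) ^ 2 ∂P ≤ M := by
  have h1 : ∫ ω, (b s ω i * b t ω j) ^ 2 ∂P ≤
      ∫ ω, (1 / 2 : ℝ) * (b s ω i ^ 4 + b t ω j ^ 4) ∂P := by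
    refine integral_mono (hb.memLp_mul s t i j).integrable_sq
      (((hb.integrable_pow_four s i).add (hb.integrable_pow_four t j)).const_mul _) fun ω => ?_
    simp only
    nlinarith [sq_nonneg (b s ω i ^ 2 - b t ω j ^ 2)]
  rw [integral_const_mul, integral_add (hb.integrable_pow_four s i)
    (hb.integrable_pow_four t j)] at h1
  linarith [hM s i, hM t j]

theorem IsWhiteNoise.integral_sq_le (hb : IsWhiteNoise P b) {M : ℝ}
    (hM : ∀ t j, ∫ ω, b t ω j ^ 4 ∂P ≤ M) (t : ℤ) (i : Fin n) :
    ∫ ω, b t ω i ^ 2 ∂P ≤ 1 + M := by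
  have h1 : ∫ ω, b t ω i ^ 2 ∂P ≤ ∫ ω, (1 + b t ω i ^ 4) ∂P := by
    refine integral_mono (hb.memLp_two t i).integrable_sq
      ((integrable_const _).add (hb.integrable_pow_four t i)) fun ω => ?_
    simp only
    nlinarith [sq_nonneg (b t ω i ^ 2 - 1)]
  rw [integral_add (integrable_const _) (hb.integrable_pow_four t i), integral_const] at h1
  simp at h1
  linarith [hM t i]

/-- The products of the noise at the lags `k` and `l`, centered, for the entry `(i, j)`. -/
def noiseProd {n : ℕ} (P : Measure Ω) (b : ℤ → Ω → Fin n → ℝ) (k l : ℕ) (t : ℤ) (i j : Fin n)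
    (ω : Ω) : ℝ :=
  b (t - k) ω i * b (t - l) ω j - if k = l then noiseCov P b i j else 0

theorem IsWhiteNoise.memLp_noiseProd (hb : IsWhiteNoise P b) (k l : ℕ) (t : ℤ) (i j : Fin n) :
    MemLp (noiseProd P b k l t i j) 2 P :=
  (hb.memLp_mul _ _ i j).sub (memLp_const _)

theorem IsWhiteNoise.integral_noiseProd (hb : IsWhiteNoise P b) (k l : ℕ) (t : ℤ) (i j : Fin n) :
    ∫ ω, noiseProd P b k l t i j ω ∂P = 0 := by
  unfold noiseProd
  rw [integral_sub (hb.integrable_mul _ _ i j) (integrable_const _), integral_const]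
  rcases eq_or_ne k l with rfl | hkl
  · rw [hb.integral_mul_self]; simp
  · rw [hb.integral_mul_of_ne (by simpa using hkl)]; simp [hkl]

/-- Subtracting the mean can only lower the second moment. -/
theorem IsWhiteNoise.integral_noiseProd_sq_le (hb : IsWhiteNoise P b) {M : ℝ}
    (hM : ∀ t j, ∫ ω, b t ω j ^ 4 ∂P ≤ M) (k l : ℕ) (t : ℤ) (i j : Fin n) :
    ∫ ω, noiseProd P b k l t i j ω ^ 2 ∂P ≤ M := by
  refine le_trans ?_ (hb.integral_mul_sq_le hM (t - k) (t - l) i j)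
  set X := fun ω => b (t - k) ω i * b (t - l) ω j with hX
  set c : ℝ := if k = l then noiseCov P b i j else 0 with hc
  have hXc : ∫ ω, X ω ∂P = c := by
    have h := hb.integral_noiseProd k l t i j
    unfold noiseProd at h
    rw [integral_sub (hb.integrable_mul _ _ i j) (integrable_const _), integral_const] at h
    simp only [probReal_univ, one_smul] at h
    linarith
  have hX2 : Integrable (fun ω => X ω ^ 2) P := (hb.memLp_mul _ _ i j).integrable_sq
  have hX1 : Integrable X P := hb.integrable_mul _ _ i j
  have h1 : (fun ω => noiseProd P b k l t i j ω ^ 2) = fun ω => X ω ^ 2 - (2 * c * X ω - c ^ 2) := by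
    funext ω
    simp only [noiseProd, hX, ← hc]
    ring
  have h2 : Integrable (fun ω => 2 * c * X ω - c ^ 2) P :=
    (hX1.const_mul _).sub (integrable_const _)
  rw [h1, integral_sub hX2 h2, integral_sub (hX1.const_mul _) (integrable_const _), integral_const_mul, hXc, integral_const]
  simp only [probReal_univ, one_smul]
  nlinarith [sq_nonneg c]

/-- For equal lags the two factors depend on innovations at different times. For k ≠ l, one of the
four times occurs only once and its mean-zero innovation factors out: t - k can coincide only with s
- l, and in that case t - l is isolated, since t - l = s - k would give k = l. -/
theorem IsWhiteNoise.integral_noiseProd_mul (hb : IsWhiteNoise P b) (k l : ℕ) {s t : ℤ}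
    (hst : t ≠ s) (i j : Fin n) :
    ∫ ω, noiseProd P b k l t i j ω * noiseProd P b k l s i j ω ∂P = 0 := by
  rcases eq_or_ne k l with rfl | hkl
  · have hne : t - k ≠ s - k := by simpa using hst
    have h1 := (hb.indep.indepFun hne).comp
      (φ := fun x : Fin n → ℝ => x i * x j - noiseCov P b i j)
      (ψ := fun x : Fin n → ℝ => x i * x j - noiseCov P b i j) (by fun_prop) (by fun_prop)
    have h2 := h1.integral_fun_mul_eq_mul_integral
      (Measurable.comp (by fun_prop) (hb.measurable _)).aestronglyMeasurable
      (Measurable.comp (by fun_prop) (hb.measurable _)).aestronglyMeasurable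
    have h3 := hb.integral_noiseProd k k t i j
    simp only [noiseProd, if_true, Function.comp_def] at h2 h3 ⊢
    rw [h2, h3, zero_mul]
  · simp only [noiseProd, hkl, if_false, sub_zero]
    rcases eq_or_ne (t - (k : ℤ)) (s - l) with h | h
    · have h1 : t - (l : ℤ) ≠ t - k := by
        intro h'; apply hkl; have : (l : ℤ) = k := by linarith
        exact_mod_cast this.symm
      have h2 : t - (l : ℤ) ≠ s - k := by
        intro h'; apply hkl; have : (k : ℤ) = l := by linarith
        exact_mod_cast this
      have h3 : t - (l : ℤ) ≠ s - l := by simpa using hst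
      rw [← hb.integral_mul_three_eq_zero h1 h2 h3 j i i j]
      congr 1; funext ω; ring
    · have h1 : t - (k : ℤ) ≠ t - l := by
        intro h'; apply hkl; have : (k : ℤ) = l := by linarith
        exact_mod_cast this
      have h2 : t - (k : ℤ) ≠ s - k := by simpa using hst
      rw [← hb.integral_mul_three_eq_zero h1 h2 h i j i j]
      congr 1; funext ω; ring

/-- The centered products of the noise, summed over the sample. -/
def noiseOuter {n : ℕ} {ι : Type*} [Fintype ι] (P : Measure Ω) (b : ℤ → Ω → Fin n → ℝ)
    (τ : ι → ℤ) (k l : ℕ) (ω : Ω) : Matrix (Fin n) (Fin n) ℝ :=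
  Matrix.of fun i j => ∑ t, noiseProd P b k l (τ t) i j ω

/-- Orthogonality over time makes the bound linear in the sample size rather than quadratic.
Coordinates at the same time may be dependent; they contribute the factor n². -/
theorem IsWhiteNoise.integral_frobSq_noiseOuter_le {ι : Type*} [Fintype ι] (hb : IsWhiteNoise P b)
    {M : ℝ} (hM : ∀ t j, ∫ ω, b t ω j ^ 4 ∂P ≤ M) {τ : ι → ℤ} (hτ : Function.Injective τ)
    (k l : ℕ) :
    Integrable (fun ω => frobSq (noiseOuter P b τ k l ω)) P ∧
      ∫ ω, frobSq (noiseOuter P b τ k l ω) ∂P ≤ Fintype.card ι * n ^ 2 * M := by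
  have h : ∀ i j, Integrable (fun ω => (∑ t, noiseProd P b k l (τ t) i j ω) ^ 2) P ∧
      ∫ ω, (∑ t, noiseProd P b k l (τ t) i j ω) ^ 2 ∂P ≤ ∑ _t : ι, M := fun i j =>
    integral_sq_sum_le (fun t => hb.memLp_noiseProd k l (τ t) i j)
      (fun t s hts => hb.integral_noiseProd_mul k l (hτ.ne hts) i j)
      (fun t => hb.integral_noiseProd_sq_le hM k l (τ t) i j)
  simp only [frobSq, noiseOuter, Matrix.of_apply]
  refine ⟨integrable_finsetSum _ fun i _ => integrable_finsetSum _ fun j _ => (h i j).1, ?_⟩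
  rw [integral_finsetSum _ fun i _ => integrable_finsetSum _ fun j _ => (h i j).1]
  calc ∑ i, ∫ ω, ∑ j, (∑ t, noiseProd P b k l (τ t) i j ω) ^ 2 ∂P
      ≤ ∑ _i : Fin n, ∑ _j : Fin n, ∑ _t : ι, M := by
        refine Finset.sum_le_sum fun i _ => ?_
        rw [integral_finsetSum _ fun j _ => (h i j).1]
        exact Finset.sum_le_sum fun j _ => (h i j).2
    _ = _ := by simp; ring

/-- The products of the noise with fixed vectors, summed over the sample. -/
def noiseCross {n m : ℕ} {ι : Type*} [Fintype ι] (b : ℤ → Ω → Fin n → ℝ)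
    (τ : ι → ℤ) (f : ι → Fin m → ℝ) (k : ℕ) (ω : Ω) : Matrix (Fin n) (Fin m) ℝ :=
  Matrix.of fun i j => ∑ t, b (τ t - k) ω i * f t j

theorem IsWhiteNoise.integral_frobSq_noiseCross_le {m : ℕ} {ι : Type*} [Fintype ι]
    (hb : IsWhiteNoise P b) {M : ℝ} (hM : ∀ t j, ∫ ω, b t ω j ^ 4 ∂P ≤ M) {τ : ι → ℤ}
    (hτ : Function.Injective τ) (f : ι → Fin m → ℝ) (k : ℕ) :
    Integrable (fun ω => frobSq (noiseCross b τ f k ω)) P ∧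
      ∫ ω, frobSq (noiseCross b τ f k ω) ∂P ≤ n * (1 + M) * ∑ t, ∑ j, f t j ^ 2 := by
  have h : ∀ i j, Integrable (fun ω => (∑ t, b (τ t - k) ω i * f t j) ^ 2) P ∧
      ∫ ω, (∑ t, b (τ t - k) ω i * f t j) ^ 2 ∂P ≤ ∑ t, (1 + M) * f t j ^ 2 := by
    intro i j
    refine integral_sq_sum_le (f := fun t ω => b (τ t - k) ω i * f t j)
      (fun t => (hb.memLp_two _ i).mul_const _) (fun t s hts => ?_) (fun t => ?_)
    · have h1 : ∀ ω, b (τ t - k) ω i * f t j * (b (τ s - k) ω i * f s j) =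
          b (τ t - k) ω i * b (τ s - k) ω i * (f t j * f s j) := fun ω => by ring
      simp only [h1]
      rw [integral_mul_const, hb.integral_mul_of_ne (by simpa using hτ.ne hts), zero_mul]
    · simp only [mul_pow]
      rw [integral_mul_const]
      exact mul_le_mul_of_nonneg_right (hb.integral_sq_le hM _ i) (sq_nonneg _)
  simp only [frobSq, noiseCross, Matrix.of_apply]
  refine ⟨integrable_finsetSum _ fun i _ => integrable_finsetSum _ fun j _ => (h i j).1, ?_⟩
  rw [integral_finsetSum _ fun i _ => integrable_finsetSum _ fun j _ => (h i j).1]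
  calc ∑ i, ∫ ω, ∑ j, (∑ t, b (τ t - k) ω i * f t j) ^ 2 ∂P
      ≤ ∑ _i : Fin n, ∑ j, ∑ t, (1 + M) * f t j ^ 2 := by
        refine Finset.sum_le_sum fun i _ => ?_
        rw [integral_finsetSum _ fun j _ => (h i j).1]
        exact Finset.sum_le_sum fun j _ => (h i j).2
    _ = _ := by
        rw [Finset.sum_const, Finset.card_univ, Fintype.card_fin, nsmul_eq_mul, mul_assoc,
          Finset.sum_comm]
        simp only [Finset.mul_sum]

end

section

open scoped Matrix.Norms.Frobenius Matrix Topology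

/-! ### Linear processes -/

variable {Ω : Type*} [MeasurableSpace Ω] {P : Measure Ω}

/-- Triangle inequality, then Cauchy-Schwarz with the weights w and w q. -/
theorem frobSq_sum_le {ι : Type*} {m n : ℕ} (s : Finset ι) {w q : ι → ℝ}
    {A : ι → Matrix (Fin m) (Fin n) ℝ} (hw : ∀ k, 0 ≤ w k) (hq : ∀ k, 0 ≤ q k)
    (hA : ∀ k, frobSq (A k) ≤ w k ^ 2 * q k) :
    frobSq (∑ k ∈ s, A k) ≤ (∑ k ∈ s, w k) * ∑ k ∈ s, w k * q k := by
  rw [frobSq_eq_norm_sq]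
  refine (pow_le_pow_left₀ (norm_nonneg _) (norm_sum_le s A) 2).trans ?_
  refine Finset.sum_sq_le_sum_mul_sum_of_sq_le_mul s (fun k _ => hw k)
    (fun k _ => mul_nonneg (hw k) (hq k)) fun k _ => ?_
  rw [← frobSq_eq_norm_sq]
  exact (hA k).trans (le_of_eq (by ring))

/-- Weighted sums of random matrices with bounded second moments are dominated by a random variable
with a bounded mean. -/
theorem exists_dominating {ι : Type*} [Countable ι] {m n : ℕ} {w : ι → ℝ} (hw : ∀ k, 0 ≤ w k)
    (hs : Summable w) {q : ι → Ω → ℝ} (hq : ∀ k ω, 0 ≤ q k ω) (hqi : ∀ k, Integrable (q k) P)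
    {B : ℝ} (hqB : ∀ k, ∫ ω, q k ω ∂P ≤ B)
    {A : ι → Ω → Matrix (Fin m) (Fin n) ℝ} (hA : ∀ k ω, frobSq (A k ω) ≤ w k ^ 2 * q k ω) :
    ∃ G : Ω → ENNReal, AEMeasurable G P ∧
      ∫⁻ ω, G ω ∂P ≤ ENNReal.ofReal ((∑' k, w k) ^ 2 * B) ∧
      ∀ (s : Finset ι) (ω : Ω), ENNReal.ofReal (frobSq (∑ k ∈ s, A k ω)) ≤ G ω := by
  have hm : ∀ k, AEMeasurable (fun ω => ENNReal.ofReal (w k * q k ω)) P := fun k =>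
    ((hqi k).1.aemeasurable.const_mul _).ennreal_ofReal
  have hS : 0 ≤ ∑' k, w k := tsum_nonneg hw
  -- The variable (∑ w)(∑ w q) dominates all finite partial sums simultaneously. Taking it with
  -- values in `ENNReal` removes any question of convergence.
  refine ⟨fun ω => ENNReal.ofReal (∑' k, w k) * ∑' k, ENNReal.ofReal (w k * q k ω),
    (AEMeasurable.tsum hm).const_mul _, ?_, fun s ω => ?_⟩
  · rw [lintegral_const_mul'' _ (AEMeasurable.tsum hm), lintegral_tsum hm]
    have h1 : ∀ k, ∫⁻ ω, ENNReal.ofReal (w k * q k ω) ∂P ≤ ENNReal.ofReal (w k * B) := by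
      intro k
      rw [← ofReal_integral_eq_lintegral_ofReal ((hqi k).const_mul _)
        (Eventually.of_forall fun ω => mul_nonneg (hw k) (hq k ω)), integral_const_mul]
      exact ENNReal.ofReal_le_ofReal (mul_le_mul_of_nonneg_left (hqB k) (hw k))
    rcases isEmpty_or_nonempty ι with hι | ⟨⟨k₀⟩⟩
    · simp
    have hB : 0 ≤ B := (integral_nonneg (hq k₀)).trans (hqB k₀)
    calc ENNReal.ofReal (∑' k, w k) * ∑' k, ∫⁻ ω, ENNReal.ofReal (w k * q k ω) ∂P
        ≤ ENNReal.ofReal (∑' k, w k) * ∑' k, ENNReal.ofReal (w k * B) := by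
          gcongr with k; exact h1 k
      _ = ENNReal.ofReal (∑' k, w k) * ENNReal.ofReal ((∑' k, w k) * B) := by
          rw [← ENNReal.ofReal_tsum_of_nonneg (fun k => mul_nonneg (hw k) hB) (hs.mul_right B),
            tsum_mul_right]
      _ = _ := by
          rw [← ENNReal.ofReal_mul hS]
          congr 1
          ring
  · refine (ENNReal.ofReal_le_ofReal (frobSq_sum_le s hw (fun k => hq k ω)
      fun k => hA k ω)).trans ?_
    rw [ENNReal.ofReal_mul (Finset.sum_nonneg fun k _ => hw k),
      ENNReal.ofReal_sum_of_nonneg fun k _ => mul_nonneg (hw k) (hq k ω)]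
    exact mul_le_mul' (ENNReal.ofReal_le_ofReal (hs.sum_le_tsum s fun k _ => hw k))
      (ENNReal.sum_le_tsum s)

theorem frobSq_mul_le {m n k : ℕ} (C : Matrix (Fin m) (Fin n) ℝ) (A : Matrix (Fin n) (Fin k) ℝ) :
    frobSq (C * A) ≤ specNorm C ^ 2 * frobSq A := by
  rw [frobSq_eq_norm_sq, frobSq_eq_norm_sq, ← mul_pow]
  exact pow_le_pow_left₀ (norm_nonneg _) (norm_mul_le_specNorm_mul C A) 2

theorem frobSq_transpose {m n : ℕ} (A : Matrix (Fin m) (Fin n) ℝ) : frobSq Aᵀ = frobSq A := by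
  rw [frobSq_eq_norm_sq, frobSq_eq_norm_sq, Matrix.frobenius_norm_transpose]

theorem frobSq_mul_mul_transpose_le {m n : ℕ} (C D : Matrix (Fin m) (Fin n) ℝ)
    (A : Matrix (Fin n) (Fin n) ℝ) :
    frobSq (C * A * Dᵀ) ≤ (specNorm C * specNorm D) ^ 2 * frobSq A := by
  have h1 : frobSq (C * A * Dᵀ) = frobSq (D * (C * A)ᵀ) := by
    rw [← frobSq_transpose, Matrix.transpose_mul, Matrix.transpose_transpose]
  rw [h1]
  refine (frobSq_mul_le _ _).trans ?_
  rw [frobSq_transpose]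
  calc specNorm D ^ 2 * frobSq (C * A) ≤ specNorm D ^ 2 * (specNorm C ^ 2 * frobSq A) :=
        mul_le_mul_of_nonneg_left (frobSq_mul_le _ _) (sq_nonneg _)
    _ = _ := by ring

theorem continuous_frobSq {m n : ℕ} :
    Continuous (frobSq : Matrix (Fin m) (Fin n) ℝ → ℝ) := by
  unfold frobSq
  fun_prop

variable {n : ℕ} {b Z : ℤ → Ω → Fin n → ℝ} {C : ℕ → Matrix (Fin n) (Fin n) ℝ}

/-- The partial sums of a linear process. -/
def partialSum (C : ℕ → Matrix (Fin n) (Fin n) ℝ) (b : ℤ → Ω → Fin n → ℝ) (N : ℕ) (t : ℤ)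
    (ω : Ω) : Fin n → ℝ :=
  ∑ k ∈ Finset.range N, (C k).mulVec (b (t - k) ω)

theorem IsLinearProcess.tendsto_partialSum (h : IsLinearProcess P Z C b) :
    ∀ᵐ ω ∂P, ∀ t, Tendsto (fun N => partialSum C b N t ω) atTop (𝓝 (Z t ω)) := by
  rw [ae_all_iff]
  intro t
  filter_upwards [h t] with ω hω
  exact hω.tendsto_sum_nat

theorem mul_vecMulVec_mul_transpose {n : ℕ} (C D : Matrix (Fin n) (Fin n) ℝ) (x y : Fin n → ℝ) :
    C * Matrix.vecMulVec x y * Dᵀ = Matrix.vecMulVec (C.mulVec x) (D.mulVec y) := by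
  rw [Matrix.mul_vecMulVec, Matrix.vecMulVec_mul, Matrix.vecMul_transpose]

theorem noiseOuter_eq {ι : Type*} [Fintype ι] (b : ℤ → Ω → Fin n → ℝ) (τ : ι → ℤ) (k l : ℕ)
    (ω : Ω) :
    noiseOuter P b τ k l ω = ∑ t, Matrix.vecMulVec (b (τ t - k) ω) (b (τ t - l) ω) -
      (Fintype.card ι : ℝ) • (if k = l then noiseCov P b else 0) := by
  ext i j
  rw [noiseOuter, Matrix.of_apply, Matrix.sub_apply, Matrix.sum_apply, Matrix.smul_apply]
  simp only [noiseProd, Finset.sum_sub_distrib, Matrix.vecMulVec_apply]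
  congr 1
  rw [Finset.sum_const, Finset.card_univ, nsmul_eq_mul, smul_eq_mul]
  split_ifs <;> simp

/-- The outer product of a truncated series is a double sum over lags, and the centerings, present
for equal lags only, add up to the truncated covariance. -/
theorem sum_mul_noiseOuter_mul {ι : Type*} [Fintype ι] (C : ℕ → Matrix (Fin n) (Fin n) ℝ)
    (b : ℤ → Ω → Fin n → ℝ) (τ : ι → ℤ) (N : ℕ) (ω : Ω) :
    ∑ p ∈ Finset.range N ×ˢ Finset.range N, C p.1 * noiseOuter P b τ p.1 p.2 ω * (C p.2)ᵀ =
      ∑ t, Matrix.vecMulVec (partialSum C b N (τ t) ω) (partialSum C b N (τ t) ω) -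
      (Fintype.card ι : ℝ) • ∑ k ∈ Finset.range N, C k * noiseCov P b * (C k)ᵀ := by
  have h1 : ∀ k l, C k * noiseOuter P b τ k l ω * (C l)ᵀ =
      ∑ t, Matrix.vecMulVec ((C k).mulVec (b (τ t - k) ω)) ((C l).mulVec (b (τ t - l) ω)) -
      (Fintype.card ι : ℝ) • (if k = l then C k * noiseCov P b * (C k)ᵀ else 0) := by
    intro k l
    rw [noiseOuter_eq, Matrix.mul_sub, Matrix.sub_mul, Matrix.mul_sum, Matrix.sum_mul]
    simp only [mul_vecMulVec_mul_transpose, Matrix.mul_smul, Matrix.smul_mul]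
    split_ifs with h
    · rw [h]
    · simp
  rw [Finset.sum_product]
  simp only [h1, Finset.sum_sub_distrib, ← Finset.smul_sum]
  congr 1
  · have h2 : ∀ t, Matrix.vecMulVec (partialSum C b N (τ t) ω)
        (partialSum C b N (τ t) ω) = ∑ k ∈ Finset.range N, ∑ l ∈ Finset.range N,
        Matrix.vecMulVec ((C k).mulVec (b (τ t - k) ω)) ((C l).mulVec (b (τ t - l) ω)) := by
      intro t
      ext i j
      simp only [partialSum, Matrix.vecMulVec_apply, Finset.sum_apply, Matrix.sum_apply,
        Finset.sum_mul_sum]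
    simp only [h2]
    refine Eq.trans (Finset.sum_congr rfl fun k _ => Finset.sum_comm) ?_
    exact Finset.sum_comm
  · congr 1
    refine Finset.sum_congr rfl fun k hk => ?_
    rw [Finset.sum_ite_eq]
    simp [hk]

/-- The covariance matrix of a linear process. -/
def linearCov (P : Measure Ω) (C : ℕ → Matrix (Fin n) (Fin n) ℝ) (b : ℤ → Ω → Fin n → ℝ) :
    Matrix (Fin n) (Fin n) ℝ :=
  ∑' k, C k * noiseCov P b * (C k)ᵀ

theorem summable_mul_self {w : ℕ → ℝ} (hw : ∀ k, 0 ≤ w k) (hs : Summable w) :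
    Summable fun p : ℕ × ℕ => w p.1 * w p.2 :=
  hs.mul_of_nonneg hs hw hw

theorem hasSum_linearCov (hC : Summable fun k => specNorm (C k)) :
    HasSum (fun k => C k * noiseCov P b * (C k)ᵀ) (linearCov P C b) := by
  refine Summable.hasSum ?_
  have h1 : Summable fun k => specNorm (C k) * specNorm (C k) * ‖noiseCov P b‖ :=
    (((summable_mul_self (fun k => specNorm_nonneg (C k)) hC).comp_injective
      (i := fun k : ℕ => (k, k)) fun a b h => congrArg Prod.fst h)).mul_right _
  refine Summable.of_norm_bounded h1 fun k => ?_
  refine abs_le_of_sq_le_sq' ?_ (by have := specNorm_nonneg (C k); positivity) |>.2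
  rw [← frobSq_eq_norm_sq, mul_pow, ← frobSq_eq_norm_sq]
  exact frobSq_mul_mul_transpose_le _ _ _

/-- The centered products of the partial sums of a linear process, summed over the sample. -/
def partialOuter {ι : Type*} [Fintype ι] (P : Measure Ω) (C : ℕ → Matrix (Fin n) (Fin n) ℝ)
    (b : ℤ → Ω → Fin n → ℝ) (τ : ι → ℤ) (N : ℕ) (ω : Ω) : Matrix (Fin n) (Fin n) ℝ :=
  ∑ p ∈ Finset.range N ×ˢ Finset.range N, C p.1 * noiseOuter P b τ p.1 p.2 ω * (C p.2)ᵀ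

/-- The products of a linear process, summed over the sample and centered. -/
def centeredOuter {ι : Type*} [Fintype ι] (P : Measure Ω) (C : ℕ → Matrix (Fin n) (Fin n) ℝ)
    (b Z : ℤ → Ω → Fin n → ℝ) (τ : ι → ℤ) (ω : Ω) : Matrix (Fin n) (Fin n) ℝ :=
  ∑ t, Matrix.vecMulVec (Z (τ t) ω) (Z (τ t) ω) - (Fintype.card ι : ℝ) • linearCov P C b

theorem IsLinearProcess.tendsto_partialOuter {ι : Type*} [Fintype ι]
    (h : IsLinearProcess P Z C b) (hC : Summable fun k => specNorm (C k)) (τ : ι → ℤ) :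
    ∀ᵐ ω ∂P, Tendsto (fun N => partialOuter P C b τ N ω) atTop
      (𝓝 (centeredOuter P C b Z τ ω)) := by
  filter_upwards [h.tendsto_partialSum] with ω hω
  have h1 : ∀ t, Tendsto (fun N => Matrix.vecMulVec (partialSum C b N (τ t) ω)
      (partialSum C b N (τ t) ω)) atTop (𝓝 (Matrix.vecMulVec (Z (τ t) ω) (Z (τ t) ω))) :=
    fun t => ((Continuous.matrix_vecMulVec (A := fun x : Fin n → ℝ => x) (B := fun x => x)
      continuous_id continuous_id).tendsto _).comp (hω (τ t))
  simp only [partialOuter, sum_mul_noiseOuter_mul]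
  have h2 : Tendsto (fun N => (Fintype.card ι : ℝ) • ∑ k ∈ Finset.range N,
      C k * noiseCov P b * (C k)ᵀ) atTop (𝓝 ((Fintype.card ι : ℝ) • linearCov P C b)) :=
    (hasSum_linearCov hC).tendsto_sum_nat.const_smul _
  exact (tendsto_finsetSum Finset.univ fun t _ => h1 t).sub h2

variable [IsProbabilityMeasure P]

theorem IsWhiteNoise.exists_dominating_outer {ι : Type*} [Fintype ι] (hb : IsWhiteNoise P b)
    {M : ℝ} (hM : ∀ t j, ∫ ω, b t ω j ^ 4 ∂P ≤ M) (hC : Summable fun k => specNorm (C k))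
    {τ : ι → ℤ} (hτ : Function.Injective τ) :
    ∃ G : Ω → ENNReal, AEMeasurable G P ∧
      ∫⁻ ω, G ω ∂P ≤ ENNReal.ofReal
        (((∑' k, specNorm (C k)) ^ 2) ^ 2 * (Fintype.card ι * n ^ 2 * M)) ∧
      ∀ N ω, ENNReal.ofReal (frobSq (partialOuter P C b τ N ω)) ≤ G ω := by
  have hw : Summable fun p : ℕ × ℕ => specNorm (C p.1) * specNorm (C p.2) :=
    summable_mul_self (w := fun k => specNorm (C k)) (fun k => specNorm_nonneg (C k)) hC
  have hsum : ∑' p : ℕ × ℕ, specNorm (C p.1) * specNorm (C p.2) =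
      (∑' k, specNorm (C k)) ^ 2 := by
    rw [sq]
    exact (hC.tsum_mul_tsum hC hw).symm
  obtain ⟨G, hGm, hGi, hG⟩ := exists_dominating (P := P)
    (fun p : ℕ × ℕ => mul_nonneg (specNorm_nonneg (C p.1)) (specNorm_nonneg (C p.2))) hw
    (q := fun p ω => frobSq (noiseOuter P b τ p.1 p.2 ω)) (fun p ω => frobSq_nonneg _)
    (fun p => (hb.integral_frobSq_noiseOuter_le hM hτ p.1 p.2).1)
    (fun p => (hb.integral_frobSq_noiseOuter_le hM hτ p.1 p.2).2)
    (A := fun p ω => C p.1 * noiseOuter P b τ p.1 p.2 ω * (C p.2)ᵀ)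
    (fun p ω => frobSq_mul_mul_transpose_le _ _ _)
  rw [hsum] at hGi
  exact ⟨G, hGm, hGi, fun N ω => hG _ ω⟩

/-- The sample covariance matrix of a linear process. -/
theorem IsLinearProcess.lintegral_centeredOuter_le {ι : Type*} [Fintype ι]
    (h : IsLinearProcess P Z C b) (hb : IsWhiteNoise P b)
    {M : ℝ} (hM : ∀ t j, ∫ ω, b t ω j ^ 4 ∂P ≤ M) (hC : Summable fun k => specNorm (C k))
    {τ : ι → ℤ} (hτ : Function.Injective τ) :
    ∫⁻ ω, ENNReal.ofReal (frobSq (centeredOuter P C b Z τ ω)) ∂P ≤ ENNReal.ofReal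
      (((∑' k, specNorm (C k)) ^ 2) ^ 2 * (Fintype.card ι * n ^ 2 * M)) := by
  obtain ⟨G, -, hGi, hG⟩ := hb.exists_dominating_outer hM hC hτ
  refine (lintegral_mono_ae ?_).trans hGi
  filter_upwards [h.tendsto_partialOuter hC τ] with ω hω
  exact le_of_tendsto ((ENNReal.continuous_ofReal.comp continuous_frobSq).continuousAt.tendsto.comp
    hω) (Eventually.of_forall fun N => hG N ω)

theorem IsWhiteNoise.integrable_partialOuter {ι : Type*} [Fintype ι] (hb : IsWhiteNoise P b)
    (τ : ι → ℤ) (N : ℕ) (i j : Fin n) :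
    Integrable (fun ω => partialOuter P C b τ N ω i j) P ∧
      ∫ ω, partialOuter P C b τ N ω i j ∂P = 0 := by
  have h0 : ∀ k l a c, Integrable (fun ω => noiseOuter P b τ k l ω a c) P ∧
      ∫ ω, noiseOuter P b τ k l ω a c ∂P = 0 := by
    intro k l a c
    have h1 : ∀ t, Integrable (noiseProd P b k l (τ t) a c) P := fun t =>
      (hb.memLp_noiseProd k l (τ t) a c).integrable (by norm_num)
    simp only [noiseOuter, Matrix.of_apply]
    refine ⟨integrable_finsetSum _ fun t _ => h1 t, ?_⟩
    rw [integral_finsetSum _ fun t _ => h1 t]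
    exact Finset.sum_eq_zero fun t _ => hb.integral_noiseProd k l (τ t) a c
  have h1 : (fun ω => partialOuter P C b τ N ω i j) = fun ω =>
      ∑ p ∈ Finset.range N ×ˢ Finset.range N, ∑ c, ∑ a,
        C p.1 i a * noiseOuter P b τ p.1 p.2 ω a c * C p.2 j c := by
    funext ω
    simp only [partialOuter, Matrix.sum_apply, Matrix.mul_apply, Matrix.transpose_apply,
      Finset.sum_mul]
  have h2 : ∀ (p : ℕ × ℕ) a c, Integrable
      (fun ω => C p.1 i a * noiseOuter P b τ p.1 p.2 ω a c * C p.2 j c) P := fun p a c =>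
    ((h0 p.1 p.2 a c).1.const_mul _).mul_const _
  rw [h1]
  refine ⟨integrable_finsetSum _ fun p _ => integrable_finsetSum _ fun c _ =>
    integrable_finsetSum _ fun a _ => h2 p a c, ?_⟩
  rw [integral_finsetSum _ fun p _ => integrable_finsetSum _ fun c _ =>
    integrable_finsetSum _ fun a _ => h2 p a c]
  refine Finset.sum_eq_zero fun p _ => ?_
  rw [integral_finsetSum _ fun c _ => integrable_finsetSum _ fun a _ => h2 p a c]
  refine Finset.sum_eq_zero fun c _ => ?_
  rw [integral_finsetSum _ fun a _ => h2 p a c]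
  refine Finset.sum_eq_zero fun a _ => ?_
  rw [integral_mul_const, integral_const_mul, (h0 p.1 p.2 a c).2, mul_zero, zero_mul]

/-- The second moments of a linear process. -/
theorem IsLinearProcess.integral_mul_eq (h : IsLinearProcess P Z C b) (hb : IsWhiteNoise P b)
    {M : ℝ} (hM : ∀ t j, ∫ ω, b t ω j ^ 4 ∂P ≤ M) (hC : Summable fun k => specNorm (C k))
    (t : ℤ) (i j : Fin n) :
    Integrable (fun ω => Z t ω i * Z t ω j) P ∧
      ∫ ω, Z t ω i * Z t ω j ∂P = linearCov P C b i j := by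
  -- For a sample of one observation the centered outer product is Z_t Z_t' minus the candidate
  -- covariance; dominated convergence shows that its mean is zero.
  set τ : Unit → ℤ := fun _ => t with hτ
  have hinj : Function.Injective τ := fun _ _ _ => rfl
  obtain ⟨G, hGm, hGi, hG⟩ := hb.exists_dominating_outer hM hC hinj
  have hGfin : ∫⁻ ω, G ω ∂P ≠ ⊤ := (hGi.trans_lt ENNReal.ofReal_lt_top).ne
  -- The variable G dominates squares of entries, and |x| ≤ 1 + x² makes 1 + G an integrable bound
  -- for the entries.
  have hGint : Integrable (fun ω => 1 + (G ω).toReal) P :=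
    (integrable_const _).add (integrable_toReal_of_lintegral_ne_top hGm hGfin)
  have hbound : ∀ N, ∀ᵐ ω ∂P, ‖partialOuter P C b τ N ω i j‖ ≤ 1 + (G ω).toReal := by
    intro N
    filter_upwards [ae_lt_top' hGm hGfin] with ω hω
    have h1 : frobSq (partialOuter P C b τ N ω) ≤ (G ω).toReal :=
      (ENNReal.ofReal_le_iff_le_toReal hω.ne).mp (hG N ω)
    have h2 := abs_entry_le_norm (partialOuter P C b τ N ω) i j
    rw [frobSq_eq_norm_sq] at h1
    rw [Real.norm_eq_abs]
    nlinarith [sq_nonneg (‖partialOuter P C b τ N ω‖ - 1)]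
  have hlim : ∀ᵐ ω ∂P, Tendsto (fun N => partialOuter P C b τ N ω i j) atTop
      (𝓝 (centeredOuter P C b Z τ ω i j)) := by
    filter_upwards [h.tendsto_partialOuter hC τ] with ω hω
    exact (tendsto_pi_nhds.mp (tendsto_pi_nhds.mp hω i)) j
  have hmeas : ∀ N, AEStronglyMeasurable (fun ω => partialOuter P C b τ N ω i j) P := fun N =>
    (hb.integrable_partialOuter τ N i j).1.1
  have hint : Integrable (fun ω => centeredOuter P C b Z τ ω i j) P := by
    refine hGint.mono' (aestronglyMeasurable_of_tendsto_ae atTop hmeas hlim) ?_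
    filter_upwards [hlim, ae_all_iff.mpr hbound] with ω h1 h2
    exact le_of_tendsto h1.norm (Eventually.of_forall h2)
  have hzero : ∫ ω, centeredOuter P C b Z τ ω i j ∂P = 0 := by
    refine tendsto_nhds_unique (tendsto_integral_of_dominated_convergence _ hmeas hGint hbound
      hlim) ?_
    simp only [(hb.integrable_partialOuter τ _ i j).2]
    exact tendsto_const_nhds
  have hE : (fun ω => Z t ω i * Z t ω j) =
      fun ω => centeredOuter P C b Z τ ω i j + linearCov P C b i j := by
    funext ω
    simp [centeredOuter, hτ, Matrix.vecMulVec_apply]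
  rw [hE]
  refine ⟨hint.add (integrable_const _), ?_⟩
  rw [integral_add hint (integrable_const _), hzero, integral_const]
  simp

theorem IsLinearProcess.autocov_zero (h : IsLinearProcess P Z C b) (hb : IsWhiteNoise P b)
    {M : ℝ} (hM : ∀ t j, ∫ ω, b t ω j ^ 4 ∂P ≤ M) (hC : Summable fun k => specNorm (C k)) :
    autocov P Z 0 = linearCov P C b := by
  ext i j
  simp only [autocov, lagCov, Matrix.of_apply, add_zero]
  exact (h.integral_mul_eq hb hM hC 0 i j).2

/-- The sample cross products of a linear process with fixed vectors. -/
theorem IsLinearProcess.lintegral_cross_le {m : ℕ} {ι : Type*} [Fintype ι]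
    (h : IsLinearProcess P Z C b) (hb : IsWhiteNoise P b)
    {M : ℝ} (hM : ∀ t j, ∫ ω, b t ω j ^ 4 ∂P ≤ M) (hC : Summable fun k => specNorm (C k))
    {τ : ι → ℤ} (hτ : Function.Injective τ) (f : ι → Fin m → ℝ) :
    ∫⁻ ω, ENNReal.ofReal (frobSq (∑ t, Matrix.vecMulVec (Z (τ t) ω) (f t))) ∂P ≤
      ENNReal.ofReal ((∑' k, specNorm (C k)) ^ 2 * (n * (1 + M) * ∑ t, ∑ j, f t j ^ 2)) := by
  obtain ⟨G, -, hGi, hG⟩ := exists_dominating (P := P)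
    (fun k => specNorm_nonneg (C k)) hC
    (q := fun k ω => frobSq (noiseCross b τ f k ω)) (fun k ω => frobSq_nonneg _)
    (fun k => (hb.integral_frobSq_noiseCross_le hM hτ f k).1)
    (fun k => (hb.integral_frobSq_noiseCross_le hM hτ f k).2)
    (A := fun k ω => C k * noiseCross b τ f k ω)
    (fun k ω => frobSq_mul_le _ _)
  refine (lintegral_mono_ae ?_).trans hGi
  filter_upwards [h.tendsto_partialSum] with ω hω
  have hsum : ∀ N, ∑ k ∈ Finset.range N, C k * noiseCross b τ f k ω =
      ∑ t, Matrix.vecMulVec (partialSum C b N (τ t) ω) (f t) := by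
    intro N
    have h1 : ∀ k, C k * noiseCross b τ f k ω =
        ∑ t, Matrix.vecMulVec ((C k).mulVec (b (τ t - k) ω)) (f t) := by
      intro k
      have h2 : noiseCross b τ f k ω = ∑ t, Matrix.vecMulVec (b (τ t - k) ω) (f t) := by
        ext i j
        simp [noiseCross, Matrix.sum_apply, Matrix.vecMulVec_apply]
      rw [h2, Matrix.mul_sum]
      simp only [Matrix.mul_vecMulVec]
    simp only [h1]
    rw [Finset.sum_comm]
    refine Finset.sum_congr rfl fun t _ => ?_
    ext i j
    simp only [partialSum, Matrix.vecMulVec_apply, Finset.sum_apply, Matrix.sum_apply,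
      Finset.sum_mul]
  have hlim : Tendsto (fun N => ∑ k ∈ Finset.range N, C k * noiseCross b τ f k ω) atTop
      (𝓝 (∑ t, Matrix.vecMulVec (Z (τ t) ω) (f t))) := by
    simp only [hsum]
    refine tendsto_finsetSum _ fun t _ => ?_
    exact (Continuous.matrix_vecMulVec continuous_id continuous_const).continuousAt.tendsto.comp
      (hω (τ t))
  exact le_of_tendsto ((ENNReal.continuous_ofReal.comp continuous_frobSq).continuousAt.tendsto.comp
    hlim) (Eventually.of_forall fun N => hG _ ω)

end

section

open scoped Matrix.Norms.Frobenius Matrix Topology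

/-! ### Samples from a factor model -/

set_option linter.unusedSectionVars false

variable {Ω : Type*} [MeasurableSpace Ω] {P : Measure Ω}

/-- The times of a sample of size `T`. -/
def sampleTime (T : ℕ) (t : Fin T) : ℤ := (t : ℕ) + 1

theorem sampleTime_injective (T : ℕ) : Function.Injective (sampleTime T) := fun s t h => by
  simpa [sampleTime, Fin.ext_iff] using h

theorem sampleMatrix_transpose_mul {n m T : ℕ} (x : ℤ → Fin n → ℝ) (y : ℤ → Fin m → ℝ) :
    (sampleMatrix x T)ᵀ * sampleMatrix y T =
      ∑ t, Matrix.vecMulVec (x (sampleTime T t)) (y (sampleTime T t)) := by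
  ext i j
  simp [Matrix.mul_apply, Matrix.sum_apply, Matrix.vecMulVec_apply, sampleMatrix, sampleTime]

theorem sampleMatrix_factorSeries {d r T : ℕ} (Λ : Matrix (Fin d) (Fin r) ℝ)
    (F : ℤ → Ω → Fin r → ℝ) (ε : ℤ → Ω → Fin d → ℝ) (ω : Ω) :
    sampleMatrix (fun t => factorSeries Λ F ε t ω) T =
      sampleMatrix (fun t => F t ω) T * Λᵀ + sampleMatrix (fun t => ε t ω) T := by
  ext i j
  simp [sampleMatrix, factorSeries, Matrix.mul_apply, Matrix.mulVec, dotProduct, mul_comm]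

theorem measurable_frobSq {m n : ℕ} {A : Ω → Matrix (Fin m) (Fin n) ℝ}
    (hA : ∀ i j, Measurable fun ω => A ω i j) : Measurable fun ω => frobSq (A ω) :=
  Finset.measurable_fun_sum _ fun i _ => Finset.measurable_fun_sum _ fun j _ =>
    (hA i j).pow_const 2

theorem measurable_mul_apply {m n k : ℕ} {A : Ω → Matrix (Fin m) (Fin n) ℝ}
    {B : Ω → Matrix (Fin n) (Fin k) ℝ} (hA : ∀ i j, Measurable fun ω => A ω i j)
    (hB : ∀ i j, Measurable fun ω => B ω i j) (i : Fin m) (j : Fin k) :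
    Measurable fun ω => (A ω * B ω) i j := by
  simp only [Matrix.mul_apply]
  exact Finset.measurable_fun_sum _ fun l _ => (hA i l).mul (hB l j)

/-- Markov's inequality. -/
theorem measure_lt_le_of_lintegral_le {X : Ω → ℝ} (hX : Measurable X) {K D S : ℝ} (hD : 0 < D)
    (hS : 0 < S) (h : ∫⁻ ω, ENNReal.ofReal (X ω) ∂P ≤ ENNReal.ofReal (K * D)) :
    P {ω | S * D < X ω} ≤ ENNReal.ofReal (K / S) := by
  have hSD : 0 < S * D := mul_pos hS hD
  calc P {ω | S * D < X ω} ≤ P {ω | ENNReal.ofReal (S * D) ≤ ENNReal.ofReal (X ω)} :=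
        measure_mono fun ω hω => ENNReal.ofReal_le_ofReal (le_of_lt hω)
    _ ≤ (∫⁻ ω, ENNReal.ofReal (X ω) ∂P) / ENNReal.ofReal (S * D) :=
        meas_ge_le_lintegral_div hX.ennreal_ofReal.aemeasurable
          (by simpa using hSD) ENNReal.ofReal_ne_top
    _ ≤ ENNReal.ofReal (K * D) / ENNReal.ofReal (S * D) := ENNReal.div_le_div_right h _
    _ = ENNReal.ofReal (K / S) := by
        rw [← ENNReal.ofReal_div_of_pos hSD, mul_div_mul_right _ _ hD.ne']

/-- Young's inequality with weight κ bounds ⟨A, ΓA⟩ by κ/2 ‖A‖² + ‖ΓA‖²/(2κ), so neither symmetry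
nor positivity of Γ is needed. -/
theorem sum_mul_mul_le {m n : ℕ} (Γ : Matrix (Fin m) (Fin m) ℝ) (A : Matrix (Fin m) (Fin n) ℝ)
    {κ : ℝ} (hκ : 0 < κ) (h : specNorm Γ ≤ κ) :
    ∑ i, ∑ j, A i j * (Γ * A) i j ≤ κ * frobSq A := by
  have h1 : ∀ i j, A i j * (Γ * A) i j ≤ κ / 2 * A i j ^ 2 + 1 / (2 * κ) * (Γ * A) i j ^ 2 := by
    intro i j
    have h2 : κ / 2 * A i j ^ 2 + 1 / (2 * κ) * (Γ * A) i j ^ 2 - A i j * (Γ * A) i j =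
        1 / (2 * κ) * (κ * A i j - (Γ * A) i j) ^ 2 := by
      field_simp
      ring
    have h3 : 0 ≤ 1 / (2 * κ) * (κ * A i j - (Γ * A) i j) ^ 2 := by positivity
    linarith
  have h4 : frobSq (Γ * A) ≤ κ ^ 2 * frobSq A :=
    (frobSq_mul_le Γ A).trans (mul_le_mul_of_nonneg_right
      (pow_le_pow_left₀ (specNorm_nonneg Γ) h 2) (frobSq_nonneg A))
  calc ∑ i, ∑ j, A i j * (Γ * A) i j
      ≤ ∑ i, ∑ j, (κ / 2 * A i j ^ 2 + 1 / (2 * κ) * (Γ * A) i j ^ 2) :=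
        Finset.sum_le_sum fun i _ => Finset.sum_le_sum fun j _ => h1 i j
    _ = κ / 2 * frobSq A + 1 / (2 * κ) * frobSq (Γ * A) := by
        simp only [frobSq, Finset.sum_add_distrib, Finset.mul_sum]
    _ ≤ κ / 2 * frobSq A + 1 / (2 * κ) * (κ ^ 2 * frobSq A) := by gcongr
    _ = κ * frobSq A := by
        field_simp
        ring

/-- The second moments of the linear combinations of a stationary series. -/
theorem lintegral_frobSq_sampleMatrix_mul_le {n m : ℕ} {Z : ℤ → Ω → Fin n → ℝ}
    (hZ : ∀ t i j, Integrable (fun ω => Z t ω i * Z t ω j) P ∧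
      ∫ ω, Z t ω i * Z t ω j ∂P = autocov P Z 0 i j) {κ : ℝ} (hκ : 0 < κ)
    (h : specNorm (autocov P Z 0) ≤ κ) (A : Matrix (Fin n) (Fin m) ℝ) (T : ℕ) :
    ∫⁻ ω, ENNReal.ofReal (frobSq (sampleMatrix (fun t => Z t ω) T * A)) ∂P ≤
      ENNReal.ofReal (T * (κ * frobSq A)) := by
  have hexp : ∀ ω, frobSq (sampleMatrix (fun t => Z t ω) T * A) =
      ∑ t : Fin T, ∑ j, ∑ i, ∑ k, Z (sampleTime T t) ω i * Z (sampleTime T t) ω k *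
        (A i j * A k j) := by
    intro ω
    refine Finset.sum_congr rfl fun t _ => Finset.sum_congr rfl fun j _ => ?_
    rw [Matrix.mul_apply, sq, Finset.sum_mul_sum]
    refine Finset.sum_congr rfl fun i _ => Finset.sum_congr rfl fun k _ => ?_
    simp only [sampleMatrix, sampleTime, Matrix.of_apply]
    ring
  have hint : ∀ (t : Fin T) j i k, Integrable (fun ω => Z (sampleTime T t) ω i *
      Z (sampleTime T t) ω k * (A i j * A k j)) P := fun t j i k => (hZ _ i k).1.mul_const _
  have hval : ∫ ω, frobSq (sampleMatrix (fun t => Z t ω) T * A) ∂P =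
      T * ∑ i, ∑ j, A i j * (autocov P Z 0 * A) i j := by
    simp only [hexp]
    rw [integral_finsetSum _ fun t _ => integrable_finsetSum _ fun j _ => integrable_finsetSum _
      fun i _ => integrable_finsetSum _ fun k _ => hint t j i k]
    have h1 : ∀ t : Fin T, ∫ ω, ∑ j, ∑ i, ∑ k, Z (sampleTime T t) ω i * Z (sampleTime T t) ω k *
        (A i j * A k j) ∂P = ∑ i, ∑ j, A i j * (autocov P Z 0 * A) i j := by
      intro t
      rw [integral_finsetSum _ fun j _ => integrable_finsetSum _
        fun i _ => integrable_finsetSum _ fun k _ => hint t j i k, Finset.sum_comm]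
      refine Finset.sum_congr rfl fun j _ => ?_
      rw [integral_finsetSum _ fun i _ => integrable_finsetSum _ fun k _ => hint t j i k]
      refine Finset.sum_congr rfl fun i _ => ?_
      rw [integral_finsetSum _ fun k _ => hint t j i k, Matrix.mul_apply, Finset.mul_sum]
      refine Finset.sum_congr rfl fun k _ => ?_
      rw [integral_mul_const, (hZ _ i k).2]
      ring
    simp only [h1]
    simp
  have hI : Integrable (fun ω => frobSq (sampleMatrix (fun t => Z t ω) T * A)) P := by
    simp only [hexp]
    exact integrable_finsetSum _ fun t _ => integrable_finsetSum _ fun j _ => integrable_finsetSum _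
      fun i _ => integrable_finsetSum _ fun k _ => hint t j i k
  rw [← ofReal_integral_eq_lintegral_ofReal hI (Eventually.of_forall fun ω => frobSq_nonneg _), hval]
  exact ENNReal.ofReal_le_ofReal (mul_le_mul_of_nonneg_left (sum_mul_mul_le _ _ hκ h)
    (Nat.cast_nonneg T))

variable [IsProbabilityMeasure P]

/-- The sample cross products of a linear process with an independent series. -/
theorem lintegral_frobSq_cross_le {n m : ℕ} {Z : ℤ → Ω → Fin n → ℝ} {F : ℤ → Ω → Fin m → ℝ}
    (hZm : ∀ t, Measurable (Z t)) (hFm : ∀ t, Measurable (F t))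
    (hind : IndepFun (fun ω t => F t ω) (fun ω t => Z t ω) P)
    {C : ℕ → Matrix (Fin n) (Fin n) ℝ} {b : ℤ → Ω → Fin n → ℝ}
    (h : IsLinearProcess P Z C b) (hb : IsWhiteNoise P b)
    {M : ℝ} (hM : ∀ t j, ∫ ω, b t ω j ^ 4 ∂P ≤ M) (hM0 : 0 ≤ M)
    (hC : Summable fun k => specNorm (C k))
    (hF : ∀ t j, Integrable (fun ω => F t ω j * F t ω j) P ∧
      ∫ ω, F t ω j * F t ω j ∂P = autocov P F 0 j j) (T : ℕ) :
    ∫⁻ ω, ENNReal.ofReal (frobSq ((sampleMatrix (fun t => Z t ω) T)ᵀ *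
        sampleMatrix (fun t => F t ω) T)) ∂P ≤
      ENNReal.ofReal ((∑' k, specNorm (C k)) ^ 2 * (n * (1 + M)) *
        (T * (autocov P F 0).trace)) := by
  set c : ℝ := (∑' k, specNorm (C k)) ^ 2 * (n * (1 + M)) with hc
  have hc0 : 0 ≤ c := by positivity
  -- Written as a function of the two paths, the quantity is integrated against a product law by
  -- independence. The factor path can then be frozen, which reduces to cross products with fixed
  -- vectors.
  set Φ : (ℤ → Fin m → ℝ) × (ℤ → Fin n → ℝ) → ENNReal := fun p =>
    ENNReal.ofReal (frobSq ((sampleMatrix p.2 T)ᵀ * sampleMatrix p.1 T)) with hΦ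
  have hΦm : Measurable Φ := by
    refine (measurable_frobSq (measurable_mul_apply (fun i t => ?_) fun t j => ?_)).ennreal_ofReal
    · simp only [sampleMatrix, Matrix.transpose_apply, Matrix.of_apply]
      fun_prop
    · simp only [sampleMatrix, Matrix.of_apply]
      fun_prop
  have hFm' : Measurable fun ω t => F t ω := measurable_pi_lambda _ hFm
  have hZm' : Measurable fun ω t => Z t ω := measurable_pi_lambda _ hZm
  have hsq : ∀ t j, Measurable fun x : ℤ → Fin m → ℝ => x (sampleTime T t) j ^ 2 := by
    intro t j
    fun_prop
  calc ∫⁻ ω, ENNReal.ofReal (frobSq ((sampleMatrix (fun t => Z t ω) T)ᵀ *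
        sampleMatrix (fun t => F t ω) T)) ∂P
      = ∫⁻ p, Φ p ∂(P.map fun ω => ((fun t => F t ω), (fun t => Z t ω))) := by
        rw [lintegral_map hΦm (hFm'.prodMk hZm')]
    _ = ∫⁻ x, ∫⁻ y, Φ (x, y) ∂(P.map fun ω t => Z t ω) ∂(P.map fun ω t => F t ω) := by
        rw [(indepFun_iff_map_prod_eq_prod_map_map hFm'.aemeasurable hZm'.aemeasurable).mp hind,
          lintegral_prod _ hΦm.aemeasurable]
    _ ≤ ∫⁻ x, ENNReal.ofReal (c * ∑ t, ∑ j, x (sampleTime T t) j ^ 2)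
          ∂(P.map fun ω t => F t ω) := by
        refine lintegral_mono fun x => ?_
        have hx : Measurable fun y => Φ (x, y) := hΦm.comp measurable_prodMk_left
        rw [lintegral_map hx hZm']
        simp only [hΦ, sampleMatrix_transpose_mul]
        refine (h.lintegral_cross_le hb hM hC (sampleTime_injective T)
          (fun t => x (sampleTime T t))).trans (le_of_eq ?_)
        rw [hc, mul_assoc, mul_assoc, mul_assoc]
    _ = ∫⁻ ω, ENNReal.ofReal (c * ∑ t, ∑ j, F (sampleTime T t) ω j ^ 2) ∂P := by
        rw [lintegral_map _ hFm']
        exact ((Finset.measurable_fun_sum _ fun t _ => Finset.measurable_fun_sum _ fun j _ =>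
          hsq t j).const_mul c).ennreal_ofReal
    _ = ENNReal.ofReal (c * (T * (autocov P F 0).trace)) := by
        have h1 : ∀ t j, Integrable (fun ω => F t ω j ^ 2) P ∧
            ∫ ω, F t ω j ^ 2 ∂P = autocov P F 0 j j := by
          intro t j
          simpa only [sq] using hF t j
        have h2 : ∀ t : Fin T, Integrable (fun ω => ∑ j, F (sampleTime T t) ω j ^ 2) P := fun t =>
          integrable_finsetSum _ fun j _ => (h1 _ j).1
        rw [← ofReal_integral_eq_lintegral_ofReal
          ((integrable_finsetSum _ fun t _ => h2 t).const_mul c) (Eventually.of_forall fun ω =>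
            mul_nonneg hc0 (Finset.sum_nonneg fun t _ => Finset.sum_nonneg fun j _ => sq_nonneg _)),
          integral_const_mul, integral_finsetSum _ fun t _ => h2 t]
        have h3 : ∀ t : Fin T, ∫ ω, ∑ j, F (sampleTime T t) ω j ^ 2 ∂P =
            (autocov P F 0).trace := by
          intro t
          rw [integral_finsetSum _ fun j _ => (h1 _ j).1]
          exact Finset.sum_congr rfl fun j _ => (h1 _ j).2
        simp only [h3]
        simp

end

/-! ### Moment bounds for samples from one factor model. -/

section

open scoped Matrix.Norms.Frobenius Matrix Topology

variable {Ω : Type*} [MeasurableSpace Ω] {P : Measure Ω}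

/-- The fourth moments of white noise are bounded. -/
theorem IsWhiteNoise.exists_integral_pow_four_le {n : ℕ} {a : ℤ → Ω → Fin n → ℝ}
    (ha : IsWhiteNoise P a) : ∃ M : ℝ, 0 ≤ M ∧ ∀ t j, ∫ ω, a t ω j ^ 4 ∂P ≤ M := by
  have h0 : ∀ j, 0 ≤ ∫ ω, a 0 ω j ^ 4 ∂P := fun j => integral_nonneg fun ω => by positivity
  refine ⟨∑ j, ∫ ω, a 0 ω j ^ 4 ∂P, Finset.sum_nonneg fun j _ => h0 j, fun t j => ?_⟩
  have h1 : ∫ ω, a t ω j ^ 4 ∂P = ∫ ω, a 0 ω j ^ 4 ∂P :=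
    ((ha.identDistrib t).comp (u := fun x : Fin n → ℝ => x j ^ 4) (by fun_prop)).integral_eq
  rw [h1]
  exact Finset.single_le_sum (f := fun j => ∫ ω, a 0 ω j ^ 4 ∂P) (fun j _ => h0 j)
    (Finset.mem_univ j)

/-- The term at lag zero is at most the whole sum; 1 ≤ κ keeps the bound positive. -/
theorem exists_specNorm_autocov_le {ε : (d : ℕ) → ℤ → Ω → Fin d → ℝ}
    (h : limsup (fun d : ℕ => ∑' h : ℤ, ENNReal.ofReal (specNorm (autocov P (ε d) h))) atTop < ⊤) :
    ∃ κ : ℝ, 1 ≤ κ ∧ ∀ᶠ d : ℕ in atTop, specNorm (autocov P (ε d) 0) ≤ κ := by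
  obtain ⟨K, hK, hK'⟩ := exists_between h
  refine ⟨max 1 K.toReal, le_max_left _ _, ?_⟩
  filter_upwards [eventually_lt_of_limsup_lt hK] with d hd
  refine le_trans ?_ (le_max_right _ _)
  exact (ENNReal.ofReal_le_iff_le_toReal hK'.ne).mp ((ENNReal.le_tsum 0).trans hd.le)

theorem frobSq_add_le {m n : ℕ} (A B : Matrix (Fin m) (Fin n) ℝ) :
    frobSq (A + B) ≤ 2 * frobSq A + 2 * frobSq B := by
  rw [frobSq_eq_norm_sq, frobSq_eq_norm_sq, frobSq_eq_norm_sq]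
  have h := pow_le_pow_left₀ (norm_nonneg _) (norm_add_le A B) 2
  nlinarith [sq_nonneg (‖A‖ - ‖B‖)]

theorem frobSq_one (n : ℕ) : frobSq (1 : Matrix (Fin n) (Fin n) ℝ) = n := by
  simp [frobSq, Matrix.one_apply]

theorem frobSq_le_specNorm {n : ℕ} (A : Matrix (Fin n) (Fin n) ℝ) {κ : ℝ} (h : specNorm A ≤ κ) :
    frobSq A ≤ κ ^ 2 * n := by
  have h1 := frobSq_mul_le A (1 : Matrix (Fin n) (Fin n) ℝ)
  rw [Matrix.mul_one, frobSq_one] at h1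
  exact h1.trans (mul_le_mul_of_nonneg_right (pow_le_pow_left₀ (specNorm_nonneg A) h 2)
    (Nat.cast_nonneg n))

theorem frobSq_smul {m n : ℕ} (c : ℝ) (A : Matrix (Fin m) (Fin n) ℝ) :
    frobSq (c • A) = c ^ 2 * frobSq A := by
  simp [frobSq, mul_pow, Finset.mul_sum]

theorem measurable_sampleMatrix_apply {n : ℕ} {Z : ℤ → Ω → Fin n → ℝ} (hZ : ∀ t, Measurable (Z t))
    (T : ℕ) (t : Fin T) (j : Fin n) : Measurable fun ω => sampleMatrix (fun t => Z t ω) T t j :=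
  (measurable_pi_apply j).comp (hZ _)

/-- Markov's inequality for each of the five quantities and a union bound. -/
theorem measure_not_sampleBounds_le {T d r : ℕ} {Λ : Matrix (Fin d) (Fin r) ℝ}
    {Γ : Matrix (Fin r) (Fin r) ℝ} {F : Ω → Matrix (Fin T) (Fin r) ℝ}
    {e : Ω → Matrix (Fin T) (Fin d) ℝ} (hF : ∀ t j, Measurable fun ω => F ω t j)
    (he : ∀ t j, Measurable fun ω => e ω t j) (hT : 0 < T) (hd : 0 < d) {K S : ℝ} (hS : 0 < S)
    (h₁ : ∫⁻ ω, ENNReal.ofReal (frobSq ((F ω)ᵀ * F ω - (T : ℝ) • Γ)) ∂P ≤ ENNReal.ofReal (K * T))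
    (h₂ : ∫⁻ ω, ENNReal.ofReal (frobSq (e ω * Λ)) ∂P ≤ ENNReal.ofReal (K * (T * d)))
    (h₃ : ∫⁻ ω, ENNReal.ofReal (frobSq (e ω * (e ω)ᵀ)) ∂P ≤
      ENNReal.ofReal (K * ((T : ℝ) ^ 2 * d + T * (d : ℝ) ^ 2)))
    (h₄ : ∫⁻ ω, ENNReal.ofReal (frobSq (e ω)) ∂P ≤ ENNReal.ofReal (K * (T * d)))
    (h₅ : ∫⁻ ω, ENNReal.ofReal (frobSq ((e ω)ᵀ * F ω)) ∂P ≤ ENNReal.ofReal (K * (T * d))) :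
    P {ω | ¬ SampleBounds Λ Γ (F ω) (e ω) S} ≤ 5 * ENNReal.ofReal (K / S) := by
  have hT' : (0 : ℝ) < T := Nat.cast_pos.mpr hT
  have hd' : (0 : ℝ) < d := Nat.cast_pos.mpr hd
  have heT : ∀ i t, Measurable fun ω => (e ω)ᵀ i t := fun i t => he t i
  have hFT : ∀ i t, Measurable fun ω => (F ω)ᵀ i t := fun i t => hF t i
  have x₁ : Measurable fun ω => frobSq ((F ω)ᵀ * F ω - (T : ℝ) • Γ) :=
    measurable_frobSq fun i j => (measurable_mul_apply hFT hF i j).sub_const _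
  have x₂ : Measurable fun ω => frobSq (e ω * Λ) :=
    measurable_frobSq (measurable_mul_apply he fun i j => measurable_const)
  have x₃ : Measurable fun ω => frobSq (e ω * (e ω)ᵀ) :=
    measurable_frobSq (measurable_mul_apply he heT)
  have x₄ : Measurable fun ω => frobSq (e ω) := measurable_frobSq he
  have x₅ : Measurable fun ω => frobSq ((e ω)ᵀ * F ω) :=
    measurable_frobSq (measurable_mul_apply heT hF)
  have hTd : (0 : ℝ) < T * d := mul_pos hT' hd'
  have m₁ := measure_lt_le_of_lintegral_le x₁ hT' hS h₁
  have m₂ := measure_lt_le_of_lintegral_le x₂ hTd hS h₂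
  have m₃ := measure_lt_le_of_lintegral_le x₃ (by positivity) hS h₃
  have m₄ := measure_lt_le_of_lintegral_le x₄ hTd hS h₄
  have m₅ := measure_lt_le_of_lintegral_le x₅ hTd hS h₅
  have hsub : {ω | ¬ SampleBounds Λ Γ (F ω) (e ω) S} ⊆
      {ω | S * T < frobSq ((F ω)ᵀ * F ω - (T : ℝ) • Γ)} ∪
      ({ω | S * (T * d) < frobSq (e ω * Λ)} ∪
      ({ω | S * ((T : ℝ) ^ 2 * d + T * (d : ℝ) ^ 2) < frobSq (e ω * (e ω)ᵀ)} ∪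
      ({ω | S * (T * d) < frobSq (e ω)} ∪ {ω | S * (T * d) < frobSq ((e ω)ᵀ * F ω)}))) := by
    intro ω hω
    by_contra hc
    simp only [Set.mem_union, Set.mem_ofPred_eq, not_or, not_lt] at hc
    exact hω ⟨hc.1, hc.2.1, hc.2.2.1, hc.2.2.2.1, hc.2.2.2.2⟩
  calc P {ω | ¬ SampleBounds Λ Γ (F ω) (e ω) S} ≤ _ := measure_mono hsub
    _ ≤ ENNReal.ofReal (K / S) + (ENNReal.ofReal (K / S) + (ENNReal.ofReal (K / S) +
        (ENNReal.ofReal (K / S) + ENNReal.ofReal (K / S)))) :=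
        (measure_union_le _ _).trans (add_le_add m₁ ((measure_union_le _ _).trans (add_le_add m₂
          ((measure_union_le _ _).trans (add_le_add m₃ ((measure_union_le _ _).trans
            (add_le_add m₄ m₅)))))))
    _ = 5 * ENNReal.ofReal (K / S) := by ring

variable [IsProbabilityMeasure P]

theorem IsLinearProcess.lintegral_sample_cov_le {n : ℕ} {b Z : ℤ → Ω → Fin n → ℝ}
    {C : ℕ → Matrix (Fin n) (Fin n) ℝ} (h : IsLinearProcess P Z C b) (hb : IsWhiteNoise P b)
    {M : ℝ} (hM : ∀ t j, ∫ ω, b t ω j ^ 4 ∂P ≤ M) (hC : Summable fun k => specNorm (C k))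
    (T : ℕ) :
    ∫⁻ ω, ENNReal.ofReal (frobSq ((sampleMatrix (fun t => Z t ω) T)ᵀ *
        sampleMatrix (fun t => Z t ω) T - (T : ℝ) • autocov P Z 0)) ∂P ≤
      ENNReal.ofReal (((∑' k, specNorm (C k)) ^ 2) ^ 2 * (T * n ^ 2 * M)) := by
  have h1 := h.lintegral_centeredOuter_le hb hM hC (sampleTime_injective T)
  simpa only [sampleMatrix_transpose_mul, h.autocov_zero hb hM hC, centeredOuter,
    Fintype.card_fin] using h1

theorem IsLinearProcess.integral_mul_eq_autocov {n : ℕ} {b Z : ℤ → Ω → Fin n → ℝ}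
    {C : ℕ → Matrix (Fin n) (Fin n) ℝ} (h : IsLinearProcess P Z C b) (hb : IsWhiteNoise P b)
    {M : ℝ} (hM : ∀ t j, ∫ ω, b t ω j ^ 4 ∂P ≤ M) (hC : Summable fun k => specNorm (C k))
    (t : ℤ) (i j : Fin n) :
    Integrable (fun ω => Z t ω i * Z t ω j) P ∧
      ∫ ω, Z t ω i * Z t ω j ∂P = autocov P Z 0 i j := by
  rw [h.autocov_zero hb hM hC]
  exact h.integral_mul_eq hb hM hC t i j

/-- The sample outer products of a linear process, when the covariance matrix has a bounded spectral
norm. -/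
theorem IsLinearProcess.lintegral_sample_outer_le {n : ℕ} {b Z : ℤ → Ω → Fin n → ℝ}
    (hZ : ∀ t, Measurable (Z t))
    {C : ℕ → Matrix (Fin n) (Fin n) ℝ} (h : IsLinearProcess P Z C b) (hb : IsWhiteNoise P b)
    {M : ℝ} (hM : ∀ t j, ∫ ω, b t ω j ^ 4 ∂P ≤ M) (hM0 : 0 ≤ M)
    (hC : Summable fun k => specNorm (C k)) {κ : ℝ} (hκ : specNorm (autocov P Z 0) ≤ κ) (T : ℕ) :
    ∫⁻ ω, ENNReal.ofReal (frobSq (sampleMatrix (fun t => Z t ω) T *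
        (sampleMatrix (fun t => Z t ω) T)ᵀ)) ∂P ≤
      ENNReal.ofReal (2 * (((∑' k, specNorm (C k)) ^ 2) ^ 2 * (T * n ^ 2 * M)) +
        2 * (T ^ 2 * (κ ^ 2 * n))) := by
  set E := fun ω => (sampleMatrix (fun t => Z t ω) T)ᵀ * sampleMatrix (fun t => Z t ω) T -
    (T : ℝ) • autocov P Z 0 with hE
  set c : ℝ := 2 * (T ^ 2 * (κ ^ 2 * n)) with hc
  have hc0 : 0 ≤ c := by positivity
  -- The d × d Gram matrix replaces the outer product and is centered at T times the covariance,
  -- whose squared Frobenius norm is at most κ²n.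
  have h1 : ∀ ω, frobSq (sampleMatrix (fun t => Z t ω) T * (sampleMatrix (fun t => Z t ω) T)ᵀ) ≤
      2 * frobSq (E ω) + c := by
    intro ω
    have h2 : frobSq (sampleMatrix (fun t => Z t ω) T * (sampleMatrix (fun t => Z t ω) T)ᵀ) =
        frobSq (E ω + (T : ℝ) • autocov P Z 0) := by
      rw [hE]
      simp only [sub_add_cancel]
      rw [frobSq_eq_norm_sq, frobSq_eq_norm_sq, norm_gram_eq_norm_outer]
    rw [h2]
    refine (frobSq_add_le _ _).trans ?_
    rw [frobSq_smul, hc]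
    gcongr
    exact frobSq_le_specNorm _ hκ
  have hZs := measurable_sampleMatrix_apply hZ T
  have hm : Measurable fun ω => frobSq (E ω) := by
    refine measurable_frobSq fun i j => ?_
    simp only [hE, Matrix.sub_apply]
    exact (measurable_mul_apply (fun i t => by simpa using hZs t i) hZs i j).sub_const _
  have hK := h.lintegral_sample_cov_le hb hM hC T
  set K := ((∑' k, specNorm (C k)) ^ 2) ^ 2 * (T * n ^ 2 * M) with hKdef
  have hK0 : 0 ≤ K := by positivity
  calc _ ≤ ∫⁻ ω, (2 * ENNReal.ofReal (frobSq (E ω)) + ENNReal.ofReal c) ∂P := by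
        refine lintegral_mono fun ω => (ENNReal.ofReal_le_ofReal (h1 ω)).trans (le_of_eq ?_)
        rw [ENNReal.ofReal_add (by have := frobSq_nonneg (E ω); positivity) hc0,
          ENNReal.ofReal_mul zero_le_two, ENNReal.ofReal_ofNat]
    _ = 2 * ∫⁻ ω, ENNReal.ofReal (frobSq (E ω)) ∂P + ENNReal.ofReal c := by
        rw [lintegral_add_right _ measurable_const, lintegral_const_mul _ hm.ennreal_ofReal]
        simp
    _ ≤ 2 * ENNReal.ofReal K + ENNReal.ofReal c := by gcongr
    _ = _ := by
        rw [ENNReal.ofReal_add (by positivity) hc0, ENNReal.ofReal_mul (q := K) zero_le_two,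
          ENNReal.ofReal_ofNat]

/-- The samples from a factor model have bounded moments with a large probability. -/
theorem FactorModel.exists_measure_not_sampleBounds_le {r : ℕ}
    {Λ : (d : ℕ) → Matrix (Fin d) (Fin r) ℝ} {F : ℤ → Ω → Fin r → ℝ}
    {ε : (d : ℕ) → ℤ → Ω → Fin d → ℝ} {π : Fin r → ℝ} (h : FactorModel P Λ F ε π) :
    ∃ K : ℝ, ∀ᶠ d : ℕ in atTop, ∀ T : ℕ, 0 < T → ∀ S : ℝ, 0 < S →
      P {ω | ¬ SampleBounds (Λ d) (autocov P F 0) (sampleMatrix (fun t => F t ω) T)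
        (sampleMatrix (fun t => ε d t ω) T) S} ≤ 5 * ENNReal.ofReal (K / S) := by
  obtain ⟨C, a, ha, hC, hF⟩ := h.factor_linear
  obtain ⟨Ma, -, hMa⟩ := ha.exists_integral_pow_four_le
  obtain ⟨M, hM⟩ := h.error_linear
  obtain ⟨κ, hκ1, hκ⟩ := exists_specNorm_autocov_le h.error_autocov
  obtain ⟨b, B, hb, hB⟩ := exists_loading_bounds h.limit_pos (tendsto_gramEigenvalues h.limit_rate)
  have hFc := hF.integral_mul_eq_autocov ha hMa hC
  -- There is one constant for each of the five moment bounds. They must be free of d and T,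
  -- although the coefficients and innovations of the errors are chosen for each d separately
  -- further below.
  set K₁ : ℝ := ((∑' k, specNorm (C k)) ^ 2) ^ 2 * (r ^ 2 * Ma) with hK₁
  set K₂ : ℝ := κ * B ^ 2 with hK₂
  set K₃ : ℝ := max (2 * (M ^ 4 * M)) (2 * κ ^ 2) with hK₃
  set K₅ : ℝ := M ^ 2 * (1 + M) * (autocov P F 0).trace with hK₅
  set K : ℝ := max K₁ (max K₂ (max K₃ (max κ K₅))) with hK
  have hKK₁ : K₁ ≤ K := le_max_left _ _
  have hKK₂ : K₂ ≤ K := (le_max_left _ _).trans (le_max_right _ _)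
  have hKK₃ : K₃ ≤ K := (le_max_left _ _).trans ((le_max_right _ _).trans (le_max_right _ _))
  have hKκ : κ ≤ K := (le_max_left _ _).trans
    ((le_max_right _ _).trans ((le_max_right _ _).trans (le_max_right _ _)))
  have hKK₅ : K₅ ≤ K := (le_max_right _ _).trans
    ((le_max_right _ _).trans ((le_max_right _ _).trans (le_max_right _ _)))
  have htr : 0 ≤ (autocov P F 0).trace := h.factor_posDef.posSemidef.trace_nonneg
  refine ⟨K, ?_⟩
  filter_upwards [hκ, hB, eventually_gt_atTop r] with d hκd hBd hd T hT S hS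
  obtain ⟨D, u, hu, hMu, hD, hDM, hε⟩ := hM d hd
  have hd0 : 0 < d := by omega
  have hM0 : 0 ≤ M := (tsum_nonneg fun k => specNorm_nonneg (D k)).trans hDM
  have hεc := hε.integral_mul_eq_autocov hu hMu hD
  have hDnn : 0 ≤ ∑' k, specNorm (D k) := tsum_nonneg fun k => specNorm_nonneg (D k)
  have hεm : ∀ t, Measurable (ε d t) := fun t => h.measurable_error d t hd
  have hT' : (0 : ℝ) < T := Nat.cast_pos.mpr hT
  have hd' : (0 : ℝ) < d := Nat.cast_pos.mpr hd0
  have hκ0 : 0 < κ := zero_lt_one.trans_le hκ1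
  refine measure_not_sampleBounds_le (measurable_sampleMatrix_apply h.measurable_factor T)
    (measurable_sampleMatrix_apply hεm T) hT hd0 hS ?_ ?_ ?_ ?_ ?_
  · refine (hF.lintegral_sample_cov_le ha hMa hC T).trans (ENNReal.ofReal_le_ofReal ?_)
    calc _ = K₁ * T := by rw [hK₁]; ring
      _ ≤ K * T := by gcongr
  · refine (lintegral_frobSq_sampleMatrix_mul_le hεc hκ0 hκd (Λ d) T).trans
      (ENNReal.ofReal_le_ofReal ?_)
    have hΛ : frobSq (Λ d) ≤ B ^ 2 * d := by
      have h1 := pow_le_pow_left₀ (norm_nonneg _) hBd.1 2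
      rw [← frobSq_eq_norm_sq, scaledLoadings, frobSq_smul, inv_pow,
        Real.sq_sqrt (Nat.cast_nonneg d), inv_mul_le_iff₀ hd'] at h1
      linarith
    calc (T : ℝ) * (κ * frobSq (Λ d)) ≤ T * (κ * (B ^ 2 * d)) := by gcongr
      _ = K₂ * (T * d) := by rw [hK₂]; ring
      _ ≤ K * (T * d) := by gcongr
  · refine (hε.lintegral_sample_outer_le hεm hu hMu hM0 hD hκd T).trans
      (ENNReal.ofReal_le_ofReal ?_)
    calc _ ≤ 2 * ((M ^ 2) ^ 2 * (T * d ^ 2 * M)) + 2 * (T ^ 2 * (κ ^ 2 * d)) := by gcongr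
      _ = 2 * κ ^ 2 * ((T : ℝ) ^ 2 * d) + 2 * (M ^ 4 * M) * (T * (d : ℝ) ^ 2) := by ring
      _ ≤ K₃ * ((T : ℝ) ^ 2 * d) + K₃ * (T * (d : ℝ) ^ 2) := by
          gcongr
          · exact le_max_right _ _
          · exact le_max_left _ _
      _ = K₃ * ((T : ℝ) ^ 2 * d + T * (d : ℝ) ^ 2) := by ring
      _ ≤ _ := by gcongr
  · have h1 := lintegral_frobSq_sampleMatrix_mul_le hεc hκ0 hκd (1 : Matrix (Fin d) (Fin d) ℝ) T
    simp only [Matrix.mul_one, frobSq_one] at h1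
    refine h1.trans (ENNReal.ofReal_le_ofReal ?_)
    calc (T : ℝ) * (κ * d) = κ * (T * d) := by ring
      _ ≤ K * (T * d) := by gcongr
  · refine (lintegral_frobSq_cross_le hεm h.measurable_factor (h.indep d hd) hε hu hMu hM0 hD
      (fun t j => hFc t j j) T).trans (ENNReal.ofReal_le_ofReal ?_)
    calc _ ≤ M ^ 2 * (d * (1 + M)) * (T * (autocov P F 0).trace) := by gcongr
      _ = K₅ * (T * d) := by rw [hK₅]; ring
      _ ≤ K * (T * d) := by gcongr

end

/-! ### Splitting the bound into the two rates. -/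

section

open scoped Matrix.Norms.Frobenius Matrix Topology

variable {Ω : Type*} [MeasurableSpace Ω] {P : Measure Ω}

/-- A nonnegative array that is bounded by the sum of two rates splits into two terms of these
rates. -/
theorem exists_add_isBigOP {Q : ℕ × ℕ → Ω → ℝ} (hQ : ∀ n ω, 0 ≤ Q n ω)
    (h : ∀ δ : ℝ, 0 < δ → ∃ C : ℝ, 0 ≤ C ∧ ∀ᶠ n : ℕ × ℕ in atTop ×ˢ atTop,
      P {ω | C * (1 / n.1 + 1 / n.2) < Q n ω} ≤ ENNReal.ofReal δ) :
    ∃ A B : ℕ × ℕ → Ω → ℝ, (∀ n ω, Q n ω = A n ω + B n ω) ∧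
      IsBigOP P (atTop ×ˢ atTop) A (fun n => 1 / (n.1 : ℝ)) ∧
      IsBigOP P (atTop ×ˢ atTop) B (fun n => 1 / (n.2 : ℝ)) := by
  have hpos : ∀ᶠ n : ℕ × ℕ in atTop ×ˢ atTop, 0 < n.1 ∧ 0 < n.2 :=
    (eventually_gt_atTop 0).prod_mk (eventually_gt_atTop 0)
  -- As 1/d + 1/T is at most twice the larger rate, the whole quantity is charged to 1/d when d ≤ T
  -- and to 1/T otherwise, hence the constant 2C.
  refine ⟨fun n ω => if n.1 ≤ n.2 then Q n ω else 0, fun n ω => if n.1 ≤ n.2 then 0 else Q n ω,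
    fun n ω => by dsimp only; split_ifs <;> simp, fun δ hδ => ?_, fun δ hδ => ?_⟩
  all_goals
    obtain ⟨C, hC, hev⟩ := h δ hδ
    refine ⟨2 * C, ?_⟩
    filter_upwards [hev, hpos] with n hn hn0
    refine (measure_mono fun ω hω => ?_).trans hn
    have h1 : (0 : ℝ) < n.1 := Nat.cast_pos.mpr hn0.1
    have h2 : (0 : ℝ) < n.2 := Nat.cast_pos.mpr hn0.2
    simp only [Set.mem_ofPred_eq] at hω ⊢
    split_ifs at hω with hle
  · have h3 : 1 / (n.2 : ℝ) ≤ 1 / n.1 := one_div_le_one_div_of_le h1 (Nat.cast_le.mpr hle)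
    rw [abs_of_nonneg (hQ n ω), abs_of_pos (by positivity)] at hω
    nlinarith
  · rw [abs_zero] at hω
    exact absurd hω (not_lt.mpr (by positivity))
  · rw [abs_zero] at hω
    exact absurd hω (not_lt.mpr (by positivity))
  · have h3 : 1 / (n.1 : ℝ) ≤ 1 / n.2 :=
      one_div_le_one_div_of_le h2 (Nat.cast_le.mpr (not_le.mp hle).le)
    rw [abs_of_nonneg (hQ n ω), abs_of_pos (by positivity)] at hω
    nlinarith

end

end FactorTest

end

/-! ### The main theorem. -/

theorem mainTheorem8 {Ω : Type*} [MeasurableSpace Ω] (P : Measure Ω) [IsProbabilityMeasure P]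
    {r : ℕ}
    (Λ₁ Λ₂ : (d : ℕ) → Matrix (Fin d) (Fin r) ℝ)
    (F₁ F₂ : ℤ → Ω → Fin r → ℝ)
    (ε₁ ε₂ : (d : ℕ) → ℤ → Ω → Fin d → ℝ)
    (π₁ π₂ : Fin r → ℝ)
    -- the assumptions on the two factor models
    (hModel₁ : FactorTest.FactorModel P Λ₁ F₁ ε₁ π₁)
    (hModel₂ : FactorTest.FactorModel P Λ₂ F₂ ε₂ π₂)
    -- the null hypothesis
    (hNull : ∀ d, r < d → FactorTest.NullHypothesis (Λ₁ d) (Λ₂ d))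
    -- identification of the factors of the second series
    (hCov : FactorTest.autocov P F₂ 0 = 1)
    (hDistinct : Function.Injective π₂)
    (R : ℕ → Matrix (Fin r) (Fin r) ℝ)
    (hR : ∀ d, r < d → FactorTest.IsGramEigenbasis (Λ₂ d) (R d))
    -- the samples
    (X₁ X₂ : (d T : ℕ) → Ω → Matrix (Fin T) (Fin d) ℝ)
    (hX₁ : ∀ d T ω, X₁ d T ω =
      FactorTest.sampleMatrix (fun t => FactorTest.factorSeries (Λ₁ d) F₁ (ε₁ d) t ω) T)
    (hX₂ : ∀ d T ω, X₂ d T ω =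
      FactorTest.sampleMatrix (fun t => FactorTest.factorSeries (Λ₂ d) F₂ (ε₂ d) t ω) T)
    -- PCA estimates of the factors of the two series
    (Fh₁ Fh₂ : (d T : ℕ) → Ω → Matrix (Fin T) (Fin r) ℝ)
    (hFh₁ : ∀ d T ω, r < d → r ≤ T → FactorTest.IsPCAFactors (X₁ d T ω) (Fh₁ d T ω))
    (hFh₂ : ∀ d T ω, r < d → r ≤ T → FactorTest.IsPCAFactors (X₂ d T ω) (Fh₂ d T ω))
    -- the transformed series
    (Y : (d T : ℕ) → Ω → Matrix (Fin T) (Fin d) ℝ)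
    (hY : ∀ d T ω, Y d T ω =
      FactorTest.transformedSample (X₁ d T ω) (X₂ d T ω) (Fh₁ d T ω) (Fh₂ d T ω))
    -- PCA estimate of the factors of the transformed series, with the choice of the signs
    (Fh : (d T : ℕ) → Ω → Matrix (Fin T) (Fin r) ℝ)
    (hFh : ∀ d T ω, r < d → r ≤ T → FactorTest.IsPCAFactors (Y d T ω) (Fh d T ω))
    (hSign : ∀ d T ω, r < d → r ≤ T → ∀ j : Fin r,
      0 ≤ ((FactorTest.pcaLoadings (Y d T ω) (Fh d T ω)).transpose * (Λ₂ d * R d)) j j) :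
    ∃ A B : ℕ × ℕ → Ω → ℝ,
      (∀ (d T : ℕ) (ω : Ω), (1 / (T : ℝ)) * FactorTest.frobSq
          (Fh d T ω - FactorTest.sampleMatrix (fun t => F₂ t ω) T * R d)
        = A (d, T) ω + B (d, T) ω) ∧
      FactorTest.IsBigOP P (atTop ×ˢ atTop) A (fun n => 1 / (n.1 : ℝ)) ∧
      FactorTest.IsBigOP P (atTop ×ˢ atTop) B (fun n => 1 / (n.2 : ℝ)) := by
  have hlim₁ := FactorTest.tendsto_gramEigenvalues hModel₁.limit_rate
  have hlim₂ := FactorTest.tendsto_gramEigenvalues hModel₂.limit_rate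
  obtain ⟨K₁, hK₁⟩ := hModel₁.exists_measure_not_sampleBounds_le
  obtain ⟨K₂, hK₂⟩ := hModel₂.exists_measure_not_sampleBounds_le
  rw [hCov] at hK₂
  obtain ⟨A, B, hAB, hA, hB⟩ := FactorTest.exists_add_isBigOP (P := P)
    (Q := fun n ω => (1 / (n.2 : ℝ)) * FactorTest.frobSq
      (Fh n.1 n.2 ω - FactorTest.sampleMatrix (fun t => F₂ t ω) n.2 * R n.1))
    (fun n ω => mul_nonneg (by positivity) (FactorTest.frobSq_nonneg _)) fun δ hδ => by
    set K : ℝ := max 1 (max K₁ K₂) with hK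
    have hK1 : 1 ≤ K := le_max_left _ _
    -- Five Markov bounds for each of the two series, each of at most δ/10.
    set S : ℝ := 10 * K / δ with hSdef
    have hS : 0 < S := by positivity
    have hKS : K / S = δ / 10 := by
      rw [hSdef]
      field_simp
    have hsum : 5 * ENNReal.ofReal (K / S) + 5 * ENNReal.ofReal (K / S) = ENNReal.ofReal δ := by
      rw [hKS, ← add_mul, show (5 + 5 : ENNReal) = ENNReal.ofReal 10 by norm_num,
        ← ENNReal.ofReal_mul (by norm_num)]
      congr 1
      ring
    obtain ⟨C, hC, hev⟩ := FactorTest.exists_bound_of_sampleBounds hModel₁.factor_posDef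
      hModel₁.limit_pos hModel₂.limit_pos hlim₁ hlim₂ hNull hDistinct hR hS.le
    refine ⟨C, hC, ?_⟩
    filter_upwards [hev, tendsto_fst.eventually hK₁, tendsto_fst.eventually hK₂,
      tendsto_fst.eventually (eventually_gt_atTop r),
      tendsto_snd.eventually (eventually_gt_atTop r)] with ⟨d, T⟩ hdT h₁ h₂ hd hT
    have hT0 : 0 < T := by omega
    -- Monotonicity and subadditivity hold for arbitrary sets, so the estimators, chosen pointwise
    -- in ω, need not be measurable.
    refine (measure_mono (t := _ ∪ _) fun ω hω => ?_).trans ((measure_union_le _ _).trans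
      ((add_le_add (h₁ T hT0 S hS) (h₂ T hT0 S hS)).trans (le_trans ?_ hsum.le)))
    · by_contra hc
      simp only [Set.mem_union, Set.mem_ofPred_eq, not_or, not_not] at hc
      simp only [Set.mem_ofPred_eq] at hω
      have hF₁ := hFh₁ d T ω hd hT.le
      have hF₂ := hFh₂ d T ω hd hT.le
      have hYω := hY d T ω
      rw [hX₁, FactorTest.sampleMatrix_factorSeries] at hF₁ hYω
      rw [hX₂, FactorTest.sampleMatrix_factorSeries] at hF₂ hYω
      exact absurd (hdT d T rfl _ _ _ _ _ _ _ hc.1 hc.2 hF₁ hF₂ _ hYω (hFh d T ω hd hT.le)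
        (hSign d T ω hd hT.le)) (not_le.mpr hω)
    · gcongr
      · exact (le_max_left _ _).trans (le_max_right _ _)
      · exact (le_max_right _ _).trans (le_max_right _ _)
  exact ⟨A, B, fun d T ω => hAB (d, T) ω, hA, hB⟩
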